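/- Let $1\le k<d$, write $x=(x^\parallel,x^\perp)\in\mathbb R^k\times\mathbb R^{d-k}=\mathbb R^d$, and let $\mathcal H=L^2(\mathbb R^d)$. Let $H_0=-\Delta$ with domain $H^2(\mathbb R^d)$ and $H=H_0+V$, where $V:\mathbb R^d\to\mathbb R$ is a measurable function with $\sup_x|V(x)|<\infty$ and $\operatorname{supp}V\subset\{x:\|x^\perp\|\le r_0\}$ for some $r_0>0$. Let $\eta\in\mathcal S(\mathbb R^d)$ satisfy $\|\eta\|_{L^2}=1$, $\operatorname{supp}\hat\eta\subset\{\xi:\|\xi\|\le1\}$, where $\hat\eta(\xi)=(2\pi)^{-d/2}\int\eta(x)e^{-i\langle x,\xi\rangle}\,dx$, and $\eta(x)=\eta^\parallel(x^\parallel)\,\eta^\perp(x^\perp)$ with $\eta^\parallel\in\mathcal S(\mathbb R^k)$, $\eta^\perp\in\mathcal S(\mathbb R^{d-k})$. For $\delta>0$ put $\eta_\delta(y)=\delta^{d/2}\eta(\delta y)$ and $\eta_{x,p;\delta}(y)=e^{i\langle p,y-x\rangle}\eta_\delta(y-x)$. For Borel $E\subset\mathbb R^d\times\mathbb R^d$ let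 $P_\delta(E)$ be the bounded operator on $\mathcal H$ given by the weakly convergent integral $$P_\delta(E)\psi=(2\pi)^{-d}\iint_E\langle\eta_{x,p;\delta},\psi\rangle\,\eta_{x,p;\delta}\,dx\,dp .$$ For $n,m>0$ let $W_{n,m;\mathrm{far}}=\{(x,p):\|x^\perp\|>n,\ \|p^\perp\|>m\}$, and define $$\mathcal N^m_H(\psi)=\limsup_{\delta\to0^+}\ \limsup_{n\to\infty}\ \sup_{t\ge0}\ \bigl\|P_\delta(W_{n,m;\mathrm{far}})e^{-itH}\psi\bigr\|,\qquad \tilde{\mathcal H}_{\mathrm{sur}}=\bigcap_{m>0}\{\psi\in\mathcal H:\mathcal N^m_H(\psi)=0\}.$$ Then the wave operator $\Omega^-=\operatorname*{s-lim}_{t\to+\infty}e^{itH}e^{-itH_0}$ exists on all of $\mathcal H$, and $$\mathcal H=\operatorname{Ran}(\Omega^-)\oplus\tilde{\mathcal H}_{\mathrm{sur}}$$ as an orthogonal direct sum. -/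

import Mathlib

open MeasureTheory Filter Topology
open scoped ENNReal SchwartzMap Laplacian

noncomputable section

namespace SurfaceScattering

/-- `ℝᵈ` with the Euclidean norm. -/
abbrev E (d : ℕ) : Type := EuclideanSpace ℝ (Fin d)

/-- The Hilbert space `L²(ℝᵈ)` of complex-valued functions. -/
abbrev L2 (d : ℕ) : Type := Lp ℂ 2 (volume : Measure (E d))

/-! ### Longitudinal and transverse coordinates -/

/-- The longitudinal part `(x₁, …, x_k)` of `x ∈ ℝᵏ⁺ˡ`. -/
def par {k l : ℕ} (x : E (k + l)) : E k := WithLp.toLp 2 fun i => x (Fin.castAdd l i)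

/-- The transverse part `(x_{k+1}, …, x_{k+l})` of `x ∈ ℝᵏ⁺ˡ`. -/
def perp {k l : ℕ} (x : E (k + l)) : E l := WithLp.toLp 2 fun i => x (Fin.natAdd k i)

/-- The slab `S_R` of points within `R` of `ℝᵏ × {0}`. -/
def slab (k l : ℕ) (R : ℝ) : Set (E (k + l)) := {x | ‖perp x‖ ≤ R}

/-! ### The Hamiltonians -/

/-- The graph of `-Δ` on `L²(ℝᵈ)`: the pairs `(ψ, φ)` with `-Δψ = φ` in the sense of tempered
distributions. -/
def freeGraph (d : ℕ) : Submodule ℂ (L2 d × L2 d) where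
  carrier := {q | -(Δ (q.1 : 𝓢'(E d, ℂ))) = (q.2 : 𝓢'(E d, ℂ))}
  zero_mem' := by
    simp only [Set.mem_ofPred_eq, Prod.fst_zero, Prod.snd_zero,
      ← Lp.toTemperedDistributionCLM_apply, ← TemperedDistribution.laplacianCLM_apply, map_zero,
      neg_zero]
  add_mem' := by
    intro a b ha hb
    simp only [Set.mem_ofPred_eq, Prod.fst_add, Prod.snd_add,
      ← Lp.toTemperedDistributionCLM_apply, ← TemperedDistribution.laplacianCLM_apply,
      map_add, neg_add] at *
    rw [ha, hb]
  smul_mem' := by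
    intro c a ha
    simp only [Set.mem_ofPred_eq, Prod.smul_fst, Prod.smul_snd,
      ← Lp.toTemperedDistributionCLM_apply, ← TemperedDistribution.laplacianCLM_apply,
      map_smul, ← smul_neg] at *
    rw [ha]

theorem freeGraph_functional {d : ℕ} (q : L2 d × L2 d) (hq : q ∈ freeGraph d) (h : q.1 = 0) :
    q.2 = 0 := by
  change -(Δ (q.1 : 𝓢'(E d, ℂ))) = (q.2 : 𝓢'(E d, ℂ)) at hq
  rw [h] at hq
  simp only [← Lp.toTemperedDistributionCLM_apply, ← TemperedDistribution.laplacianCLM_apply,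
      map_zero, neg_zero] at hq
  have hk := Lp.ker_toTemperedDistributionCLM_eq_bot (F := ℂ) (μ := (volume : Measure (E d)))
    (p := 2)
  exact (LinearMap.ker_eq_bot'.1 hk) _ hq.symm

/-- The free Hamiltonian `H₀ = -Δ`, with domain `{ψ ∈ L² | Δψ ∈ L²} = H²(ℝᵈ)`. -/
def freeHamiltonian (d : ℕ) : L2 d →ₗ.[ℂ] L2 d := (freeGraph d).toLinearPMap

/-- The graph of multiplication by `V` on `L²(ℝᵈ)`. -/
def multGraph {d : ℕ} (V : E d → ℝ) : Submodule ℂ (L2 d × L2 d) where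
  carrier := {q | ∀ᵐ x, q.2 x = (V x : ℂ) * q.1 x}
  zero_mem' := by
    change ∀ᵐ x, (0 : L2 d) x = (V x : ℂ) * (0 : L2 d) x
    filter_upwards [Lp.coeFn_zero ℂ 2 (volume : Measure (E d))] with x hx
    rw [hx]
    simp
  add_mem' := by
    intro a b ha hb
    change ∀ᵐ x, (a.2 + b.2 : L2 d) x = (V x : ℂ) * (a.1 + b.1 : L2 d) x
    filter_upwards [Lp.coeFn_add a.1 b.1, Lp.coeFn_add a.2 b.2, ha, hb] with x h1 h2 h3 h4
    rw [h1, h2, Pi.add_apply, Pi.add_apply, h3, h4, mul_add]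
  smul_mem' := by
    intro c a ha
    change ∀ᵐ x, (c • a.2 : L2 d) x = (V x : ℂ) * (c • a.1 : L2 d) x
    filter_upwards [Lp.coeFn_smul c a.1, Lp.coeFn_smul c a.2, ha] with x h1 h2 h3
    rw [h1, h2, Pi.smul_apply, Pi.smul_apply, h3, smul_eq_mul, smul_eq_mul, mul_left_comm]

theorem multGraph_functional {d : ℕ} (V : E d → ℝ) (q : L2 d × L2 d) (hq : q ∈ multGraph V)
    (h : q.1 = 0) : q.2 = 0 := by
  have hq' : ∀ᵐ x, q.2 x = (V x : ℂ) * q.1 x := hq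
  rw [h] at hq'
  refine Lp.ext ?_
  filter_upwards [hq', Lp.coeFn_zero ℂ 2 (volume : Measure (E d))] with x h1 h2
  rw [h1, h2]
  simp

/-- The multiplication operator by `V`, with domain `{ψ ∈ L² | Vψ ∈ L²}`. -/
def multOp {d : ℕ} (V : E d → ℝ) : L2 d →ₗ.[ℂ] L2 d := (multGraph V).toLinearPMap

/-- `H = H₀ + V`, on the intersection of the domains (which is `H²(ℝᵈ)` for bounded `V`). -/
def hamiltonian {d : ℕ} (V : E d → ℝ) : L2 d →ₗ.[ℂ] L2 d := freeHamiltonian d + multOp V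

/-! ### Strong limits and the unitary group `e^{-itA}` -/

section Abstract

variable {𝓗 : Type*} [NormedAddCommGroup 𝓗] [InnerProductSpace ℂ 𝓗]

/-- The graph of the strong limit of `T t` as `t → +∞`. -/
def strongLimGraph (T : ℝ → 𝓗 →L[ℂ] 𝓗) : Submodule ℂ (𝓗 × 𝓗) where
  carrier := {q | Tendsto (fun t => T t q.1) atTop (𝓝 q.2)}
  zero_mem' := by simp
  add_mem' := by
    intro a b ha hb
    simpa using Tendsto.add ha hb
  smul_mem' := by
    intro c a ha
    simpa using Tendsto.const_smul ha c

theorem strongLimGraph_functional (T : ℝ → 𝓗 →L[ℂ] 𝓗) (q : 𝓗 × 𝓗)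
    (hq : q ∈ strongLimGraph T) (h : q.1 = 0) : q.2 = 0 := by
  have hq' : Tendsto (fun t => T t q.1) atTop (𝓝 q.2) := hq
  simp only [h, map_zero] at hq'
  exact tendsto_nhds_unique hq' tendsto_const_nhds

/-- The strong limit `s-lim_{t → +∞} T t`, defined on the subspace of the vectors for which the
limit exists. -/
def strongLim (T : ℝ → 𝓗 →L[ℂ] 𝓗) : 𝓗 →ₗ.[ℂ] 𝓗 := (strongLimGraph T).toLinearPMap

variable [CompleteSpace 𝓗]

/-- `U` is a strongly continuous one-parameter unitary group whose generator is exactly `-iA`: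
the orbit of `ψ` is differentiable at time `0`, with derivative `φ`, if and only if `ψ` lies in the
domain of `A` and `Aψ = iφ`. -/
structure IsUnitaryGroupOf (A : 𝓗 →ₗ.[ℂ] 𝓗) (U : ℝ → 𝓗 →L[ℂ] 𝓗) : Prop where
  unitary : ∀ t, U t ∈ unitary (𝓗 →L[ℂ] 𝓗)
  zero : U 0 = 1
  add : ∀ s t, U (s + t) = U s * U t
  continuous : ∀ ψ, Continuous fun t => U t ψ
  generator : ∀ ψ φ, HasDerivAt (fun t => U t ψ) φ 0 ↔ (ψ, Complex.I • φ) ∈ A.graph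

open Classical in
/-- `propagator A t = e^{-itA}`, the unitary group that Stone's theorem attaches to the self-adjoint
operator `A` (and the constant `1` if `A` generates no unitary group). -/
def propagator (A : 𝓗 →ₗ.[ℂ] 𝓗) : ℝ → 𝓗 →L[ℂ] 𝓗 :=
  if h : ∃ U, IsUnitaryGroupOf A U then h.choose else fun _ => 1

end Abstract

/-- The wave operator `Ω⁻ = s-lim_{t → +∞} e^{itH} e^{-itH₀}`. -/
def waveMinus {d : ℕ} (V : E d → ℝ) : L2 d →ₗ.[ℂ] L2 d :=
  strongLim fun t => propagator (hamiltonian V) (-t) * propagator (freeHamiltonian d) t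

/-- `Ran(Ω⁻)`. -/
def ranWaveMinus {d : ℕ} (V : E d → ℝ) : Submodule ℂ (L2 d) := (waveMinus V).toFun.range

/-! ### Phase space observables -/

/-- The unitary Fourier transform `(2π)^{-d/2} ∫ f(x) e^{-i⟨x, ξ⟩} dx`. -/
def fourierU {d : ℕ} (f : E d → ℂ) (ξ : E d) : ℂ :=
  (((2 * Real.pi) ^ (-(d : ℝ) / 2) : ℝ) : ℂ) *
    ∫ x, f x * Complex.exp (-Complex.I * (inner ℝ x ξ : ℝ))

/-- The admissible `η`: a normalized Schwartz function whose Fourier transform is supported in the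
unit ball and which factors as `η = η^∥ ⊗ η^⊥` with Schwartz factors. -/
structure IsWindow {k l : ℕ} (η : 𝓢(E (k + l), ℂ)) : Prop where
  norm_one : ∫ x, ‖η x‖ ^ 2 = 1
  fourier_supp : tsupport (fourierU η) ⊆ Metric.closedBall 0 1
  tensor : ∃ (ηpar : 𝓢(E k, ℂ)) (ηperp : 𝓢(E l, ℂ)), ∀ x, η x = ηpar (par x) * ηperp (perp x)

/-- The rescaled function `η_δ(y) = δ^{d/2} η(δy)`, so that
`fourierU η_δ p = δ^{-d/2} fourierU η (p/δ)` for `δ > 0`. -/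
def rescale {d : ℕ} (η : E d → ℂ) (δ : ℝ) (y : E d) : ℂ :=
  ((δ ^ ((d : ℝ) / 2) : ℝ) : ℂ) * η (δ • y)

/-- The coherent state `η_{x,p;δ}(y) = e^{i⟨p, y - x⟩} η_δ(y - x)`. -/
def coherent {d : ℕ} (η : E d → ℂ) (δ : ℝ) (x p y : E d) : ℂ :=
  Complex.exp (Complex.I * (inner ℝ p (y - x) : ℝ)) * rescale η δ (y - x)

/-- The coefficient `⟨η_{x,p;δ}, ψ⟩`, where `z = (x, p)` is a point of phase space. -/
def coeff {d : ℕ} (η : E d → ℂ) (δ : ℝ) (ψ : L2 d) (z : E d × E d) : ℂ :=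
  ∫ y, (starRingEnd ℂ) (coherent η δ z.1 z.2 y) * ψ y

/-- `T` is the weakly convergent integral `(2π)^{-d} ∬_S |η_{x,p;δ}⟩⟨η_{x,p;δ}| dx dp`: the matrix
element `⟨φ, Tψ⟩` is `(2π)^{-d} ∬_S ⟨φ, η_{x,p;δ}⟩ ⟨η_{x,p;δ}, ψ⟩ dx dp`, the integral converging
absolutely. -/
def IsObservable {d : ℕ} (η : E d → ℂ) (δ : ℝ) (S : Set (E d × E d)) (T : L2 d →L[ℂ] L2 d) :
    Prop :=
  ∀ φ ψ : L2 d,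
    IntegrableOn (fun z => (starRingEnd ℂ) (coeff η δ φ z) * coeff η δ ψ z) S ∧
    inner ℂ φ (T ψ) = (((2 * Real.pi) ^ (-(d : ℝ)) : ℝ) : ℂ) *
      ∫ z in S, (starRingEnd ℂ) (coeff η δ φ z) * coeff η δ ψ z

open Classical in
/-- The phase space observable `P_δ(S)`: the bounded operator on `L²(ℝᵈ)` given by the weakly
convergent integral `(2π)^{-d} ∬_S ⟨η_{x,p;δ}, ·⟩ η_{x,p;δ} dx dp`. -/
def observable {d : ℕ} (η : E d → ℂ) (δ : ℝ) (S : Set (E d × E d)) : L2 d →L[ℂ] L2 d :=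
  if h : ∃ T, IsObservable η δ S T then h.choose else 0

/-- The far set `W_{n,m;far}`: transverse position outside the ball `B_n` and transverse momentum
outside the ball `B_m`. -/
def farSet (k l : ℕ) (n m : ℝ) : Set (E (k + l) × E (k + l)) :=
  {z | n < ‖perp z.1‖ ∧ m < ‖perp z.2‖}

/-! ### The auxiliary surface subspace -/

/-- The seminorm
`N^m_A(ψ) = limsup_{δ → 0+} limsup_{n → ∞} sup_{t ≥ 0} ‖P_δ(W_{n,m;far}) e^{-itA} ψ‖`,
with values in `[0, ∞]`. -/
def surNorm {k l : ℕ} (η : E (k + l) → ℂ) (A : L2 (k + l) →ₗ.[ℂ] L2 (k + l)) (m : ℝ)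
    (ψ : L2 (k + l)) : ℝ≥0∞ :=
  limsup (fun δ : ℝ => limsup (fun n : ℝ => ⨆ (t : ℝ) (_ : 0 ≤ t),
    ‖observable η δ (farSet k l n m) (propagator A t ψ)‖ₑ) atTop) (𝓝[>] 0)

theorem surNorm_zero {k l : ℕ} (η : E (k + l) → ℂ) (A : L2 (k + l) →ₗ.[ℂ] L2 (k + l)) (m : ℝ) :
    surNorm η A m 0 = 0 := by
  simp [surNorm]

theorem limsup_add_le_ennreal {α : Type*} (f : Filter α) (u v : α → ℝ≥0∞) :
    limsup (fun a => u a + v a) f ≤ limsup u f + limsup v f := by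
  refine ENNReal.le_of_forall_pos_le_add fun ε hε htop => ?_
  have hu : limsup u f ≠ ∞ := fun h => by simp [h] at htop
  have hv : limsup v f ≠ ∞ := fun h => by simp [h] at htop
  have hε' : (ε / 2 : ℝ≥0∞) ≠ 0 := by simpa using hε.ne'
  have h1 := eventually_lt_of_limsup_lt (ENNReal.lt_add_right hu hε')
  have h2 := eventually_lt_of_limsup_lt (ENNReal.lt_add_right hv hε')
  refine limsup_le_of_le (h := ?_)
  filter_upwards [h1, h2] with a ha hb
  calc u a + v a ≤ (limsup u f + ε / 2) + (limsup v f + ε / 2) := add_le_add ha.le hb.le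
    _ = limsup u f + limsup v f + ε := by
      rw [add_add_add_comm, ENNReal.add_halves]

theorem surNorm_add_le {k l : ℕ} (η : E (k + l) → ℂ) (A : L2 (k + l) →ₗ.[ℂ] L2 (k + l)) (m : ℝ)
    (ψ φ : L2 (k + l)) : surNorm η A m (ψ + φ) ≤ surNorm η A m ψ + surNorm η A m φ := by
  refine le_trans (limsup_le_limsup (Eventually.of_forall fun δ => ?_))
    (limsup_add_le_ennreal _ _ _)
  refine le_trans (limsup_le_limsup (Eventually.of_forall fun n => ?_))
    (limsup_add_le_ennreal _ _ _)
  refine iSup₂_le fun t ht => ?_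
  rw [map_add, map_add]
  exact (enorm_add_le _ _).trans (add_le_add
    (le_iSup₂ (f := fun (t : ℝ) (_ : 0 ≤ t) =>
      ‖observable η δ (farSet k l n m) (propagator A t ψ)‖ₑ) t ht)
    (le_iSup₂ (f := fun (t : ℝ) (_ : 0 ≤ t) =>
      ‖observable η δ (farSet k l n m) (propagator A t φ)‖ₑ) t ht))

theorem surNorm_smul {k l : ℕ} (η : E (k + l) → ℂ) (A : L2 (k + l) →ₗ.[ℂ] L2 (k + l)) (m : ℝ)
    (c : ℂ) (ψ : L2 (k + l)) : surNorm η A m (c • ψ) = ‖c‖ₑ * surNorm η A m ψ := by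
  simp only [surNorm, map_smul, enorm_smul, ← ENNReal.mul_iSup,
    ENNReal.limsup_const_mul_of_ne_top enorm_ne_top]

/-- The auxiliary surface subspace `⋂_{m > 0} {ψ | N^m_A(ψ) = 0}` of the Hamiltonian `A`. -/
def surTilde {k l : ℕ} (η : E (k + l) → ℂ) (A : L2 (k + l) →ₗ.[ℂ] L2 (k + l)) :
    Submodule ℂ (L2 (k + l)) where
  carrier := {ψ | ∀ m : ℝ, 0 < m → surNorm η A m ψ = 0}
  zero_mem' := fun m _ => surNorm_zero η A m
  add_mem' := by
    intro a b ha hb m hm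
    have h := surNorm_add_le η A m a b
    rw [ha m hm, hb m hm, add_zero] at h
    exact nonpos_iff_eq_zero.1 h
  smul_mem' := by
    intro c a ha m hm
    rw [surNorm_smul, ha m hm, mul_zero]

end SurfaceScattering

end

/-!
# Wave operators and surface states for a potential supported near a subspace

The free Hamiltonian is diagonalized by the Fourier transform, so `e^{-itH₀}` is an explicit Fourier
multiplier (`isUnitaryGroupOf_freeGroup`). As `V` is bounded, `H` generates a unitary group too: in
the interaction picture the Schrödinger equation has bounded coefficients and is solved by the Dyson
series (`IsUnitaryGroupOf.exists_perturbation`). The observable `P_δ(S)` factors as `L_S† L_S`,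
where `L_S = coeffOp S` maps a state to its coherent state coefficients on `S`; by Moyal's identity
(`norm_coeffOp_univ`), `L_S` is an isometry for `S` the whole phase space.

The analytic input is a propagation estimate. The free evolution moves the coherent state at `(x,
p)` to the one at `(x + 2τp, p)`, up to a phase and to the spreading of the window
(`IsBand.windowCoeff_freeGroup`). The spread window is small in the region that its momenta cannot
reach classically (`IsBand.exists_decay`): there, position times the wave packet equals `2τ` times
the momentum operator on it, plus a lower order term, and as the momentum is bounded by half of what
would be needed this is a contraction which can be iterated. Hence
(`exists_norm_coeffOp_freeGroup_le`) a state localized in `⟨y, u⟩ ≤ R` and evolved for the time `-τ`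
has coefficients of size `O((n - R + |τ|)⁻²)` at the points `(x, p)` for which `⟨x + 2τp, u⟩` is at
least `n + 2m|τ|`. The rate is integrable in time. Here `u` is a transverse direction, so that `V`
is supported in a slab `|⟨y, u⟩| ≤ R`.

Existence of `Ω⁻`. By duality, states `P_δ(S) g` with `S` an outgoing region `{⟨x, u⟩ ≥ n, ⟨p, u⟩ ≥
m}` leave the support of `V` at an integrable rate, so Cook's method applies to them. They span a
dense subspace, since a state orthogonal to all of them, for `u` and `-u`, would have momentum
exactly orthogonal to `u` (`eq_top_of_forall_observable_sector_mem`). The same density argument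
shows that every state leaves every slab under the free evolution (`tendsto_mulLp_freeGroup`).

The orthogonal complement of `Ran Ω⁻` consists of surface states (`orthogonal_le_surTilde`). The far
region is covered by finitely many sectors `{⟨x, u⟩ ≥ cn, ±⟨p, u⟩ ≥ cm}`. If `χ ⟂ Ran Ω⁻`, then also
`χ_t = e^{-itH} χ ⟂ Ran Ω⁻`, and in an outgoing sector `‖L_S χ_t‖² = ⟨χ_t, (1 - Ω⁻) P_δ(S) χ_t⟩`,
which Cook's estimate makes small uniformly in `t`. In an incoming sector Duhamel's formula and the
propagation estimate, backwards in time, compare `χ_t` with `e^{-itH₀} χ`, which is small there.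

Surface states are orthogonal to `Ran Ω⁻` (`surTilde_le_orthogonal`). In `⟨Ω⁻φ, χ⟩ = lim ⟨e^{-itH₀}
φ, e^{-itH} χ⟩` the far region contributes little because `χ` is a surface state, and outside the
far region `e^{-itH₀} φ` has left the slab `|⟨x, u⟩| ≤ n`, up to the small part of `φ` with momentum
`|⟨p, u⟩| ≤ 2m`. So the surface subspace is the orthogonal complement of `Ran Ω⁻`, which is closed
because `Ω⁻` is an isometry.
-/

noncomputable section

namespace SurfaceScattering

/-! ### One-parameter unitary groups -/

section Abstract

variable {𝓗 : Type*} [NormedAddCommGroup 𝓗] [InnerProductSpace ℂ 𝓗]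

/-- Product rule for a strongly continuous family of contractions applied to a moving vector. -/
theorem hasDerivAt_clm_apply_of_strong {T : ℝ → 𝓗 →L[ℂ] 𝓗} (hT : ∀ t x, ‖T t x‖ ≤ ‖x‖)
    {x : ℝ → 𝓗} {x' y : 𝓗} {t : ℝ} (h1 : HasDerivAt (fun s => T s (x t)) y t)
    (h2 : HasDerivAt x x' t) (h3 : ContinuousAt (fun s => T s x') t) :
    HasDerivAt (fun s => T s (x s)) (y + T t x') t := by
  have h4 : HasDerivAt (fun s => T s (x s - x t)) (T t x') t := by
    rw [hasDerivAt_iff_isLittleO] at h2 ⊢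
    have e : (fun s => T s (x s - x t) - T t (x t - x t) - (s - t) • T t x') =
        fun s => T s (x s - x t - (s - t) • x') + (s - t) • (T s x' - T t x') := by
      funext s
      rw [sub_self, map_zero, sub_zero, map_sub (T s) (x s - x t), smul_sub]
      rw [(T s).map_smul_of_tower]
      abel
    rw [e]
    refine Asymptotics.IsLittleO.add ?_ ?_
    · refine (Asymptotics.IsBigO.of_bound 1 (Eventually.of_forall fun s => ?_)).trans_isLittleO h2
      rw [one_mul]
      exact hT _ _
    · have h5 : Tendsto (fun s => T s x' - T t x') (𝓝 t) (𝓝 0) := by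
        simpa using (h3.tendsto.sub_const (T t x'))
      have h6 := (Asymptotics.isLittleO_one_iff ℝ).2 h5
      simpa using (Asymptotics.isBigO_refl (fun s : ℝ => s - t) (𝓝 t)).smul_isLittleO h6
  have := h1.add h4
  refine this.congr_of_eventuallyEq (Eventually.of_forall fun s => ?_)
  simp

theorem continuous_uncurry_of_strong {X : Type*} [TopologicalSpace X] {T : X → 𝓗 →L[ℂ] 𝓗} {M : ℝ}
    (hT : ∀ t x, ‖T t x‖ ≤ M * ‖x‖) (hc : ∀ x, Continuous fun t => T t x) :
    Continuous fun p : X × 𝓗 => T p.1 p.2 := by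
  rw [continuous_iff_continuousAt]
  rintro ⟨t, x⟩
  have h1 : Tendsto (fun p : X × 𝓗 => T p.1 (p.2 - x)) (𝓝 (t, x)) (𝓝 0) := by
    refine squeeze_zero_norm (fun p => hT p.1 (p.2 - x)) ?_
    have : Continuous fun p : X × 𝓗 => M * ‖p.2 - x‖ := by fun_prop
    simpa using this.tendsto (t, x)
  have h2 : Tendsto (fun p : X × 𝓗 => T p.1 x) (𝓝 (t, x)) (𝓝 (T t x)) :=
    ((hc x).comp continuous_fst).tendsto (t, x)
  have h3 := h1.add h2
  simp only [← map_add, sub_add_cancel, zero_add] at h3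
  exact h3

variable [CompleteSpace 𝓗]

namespace IsUnitaryGroupOf

variable {A A' : 𝓗 →ₗ.[ℂ] 𝓗} {U U' : ℝ → 𝓗 →L[ℂ] 𝓗}

theorem norm_apply (h : IsUnitaryGroupOf A U) (t : ℝ) (x : 𝓗) : ‖U t x‖ = ‖x‖ :=
  ContinuousLinearMap.norm_map_of_mem_unitary (h.unitary t) x

theorem apply_add (h : IsUnitaryGroupOf A U) (s t : ℝ) (x : 𝓗) : U (s + t) x = U s (U t x) := by
  rw [h.add]; rfl

theorem apply_zero (h : IsUnitaryGroupOf A U) (x : 𝓗) : U 0 x = x := by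
  rw [h.zero]; rfl

theorem apply_neg_self (h : IsUnitaryGroupOf A U) (t : ℝ) (x : 𝓗) : U t (U (-t) x) = x := by
  rw [← h.apply_add, add_neg_cancel, h.apply_zero]

theorem inner_map (h : IsUnitaryGroupOf A U) (t : ℝ) (x y : 𝓗) :
    inner ℂ (U t x) (U t y) = inner ℂ x y :=
  ContinuousLinearMap.inner_map_map_of_mem_unitary (h.unitary t) x y

theorem inner_left (h : IsUnitaryGroupOf A U) (t : ℝ) (x y : 𝓗) :
    inner ℂ (U t x) y = inner ℂ x (U (-t) y) := by
  rw [← h.inner_map t x (U (-t) y), h.apply_neg_self]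

theorem continuous_uncurry (h : IsUnitaryGroupOf A U) :
    Continuous fun p : ℝ × 𝓗 => U p.1 p.2 :=
  continuous_uncurry_of_strong (M := 1) (fun t x => by rw [h.norm_apply, one_mul]) h.continuous

theorem continuous_apply (h : IsUnitaryGroupOf A U) {X : Type*} [TopologicalSpace X] {f : X → ℝ}
    {g : X → 𝓗} (hf : Continuous f) (hg : Continuous g) : Continuous fun x => U (f x) (g x) :=
  h.continuous_uncurry.comp (hf.prodMk hg)

theorem hasDerivAt_zero (h : IsUnitaryGroupOf A U) {ψ φ : 𝓗} (hψ : (ψ, φ) ∈ A.graph) :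
    HasDerivAt (fun t => U t ψ) (-(Complex.I • φ)) 0 := by
  rw [h.generator]
  simpa [smul_smul] using hψ

theorem hasDerivAt (h : IsUnitaryGroupOf A U) {ψ φ : 𝓗} (hψ : (ψ, φ) ∈ A.graph) (t : ℝ) :
    HasDerivAt (fun t => U t ψ) (U t (-(Complex.I • φ))) t := by
  have h1 := h.hasDerivAt_zero hψ
  have h2 : HasDerivAt (fun s => U (s - t) ψ) (-(Complex.I • φ)) t := by
    exact HasDerivAt.comp_sub_const (f := fun s => U s ψ) t t (by rwa [sub_self])
  have h3 := ((U t).restrictScalars ℝ).hasFDerivAt.comp_hasDerivAt t h2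
  refine h3.congr_of_eventuallyEq (Eventually.of_forall fun s => ?_)
  simp only [ContinuousLinearMap.coe_restrictScalars', Function.comp_apply]
  rw [← h.apply_add, add_sub_cancel]

theorem graph_invariant (h : IsUnitaryGroupOf A U) {ψ φ : 𝓗} (hψ : (ψ, φ) ∈ A.graph) (t : ℝ) :
    (U t ψ, U t φ) ∈ A.graph := by
  have h1 := h.hasDerivAt hψ t
  have h2 : HasDerivAt (fun s => U s (U t ψ)) (U t (-(Complex.I • φ))) 0 := by
    have := HasDerivAt.comp_add_const (f := fun s => U s ψ) 0 t (by rwa [zero_add])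
    refine this.congr_of_eventuallyEq (Eventually.of_forall fun s => ?_)
    exact (h.apply_add s t ψ).symm
  rw [h.generator] at h2
  simpa [smul_smul] using h2

/-- The averages `∫₀ʰ U(s)ψ ds` lie in the domain of the generator, and `h⁻¹` times them tends to
`ψ`. -/
theorem dense_domain (h : IsUnitaryGroupOf A U) : Dense {ψ : 𝓗 | ∃ φ, (ψ, φ) ∈ A.graph} := by
  intro ψ
  have hc := h.continuous ψ
  have hD : ∀ r : ℝ, ∃ φ, ((∫ s in (0 : ℝ)..r, U s ψ), φ) ∈ A.graph := by
    intro r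
    have h1 : ∀ t, U t (∫ s in (0 : ℝ)..r, U s ψ) =
        (∫ s in (0 : ℝ)..(r + t), U s ψ) - ∫ s in (0 : ℝ)..t, U s ψ := by
      intro t
      rw [← ContinuousLinearMap.intervalIntegral_comp_comm _ (hc.intervalIntegrable _ _)]
      simp only [← h.apply_add]
      have := intervalIntegral.integral_comp_add_left (a := 0) (b := r) (fun s => U s ψ) t
      rw [this, add_zero, add_comm t r,
        intervalIntegral.integral_interval_sub_left (hc.intervalIntegrable _ _)
          (hc.intervalIntegrable _ _)]
    have h2 : HasDerivAt (fun t => U t (∫ s in (0 : ℝ)..r, U s ψ)) (U r ψ - U 0 ψ) 0 := by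
      simp only [h1]
      refine HasDerivAt.sub ?_ ?_
      · have := HasDerivAt.comp_const_add (f := fun t => ∫ s in (0 : ℝ)..t, U s ψ) r 0
          (f' := U r ψ) (by
            rw [add_zero]
            exact intervalIntegral.integral_hasDerivAt_right (hc.intervalIntegrable _ _)
              hc.stronglyMeasurable.stronglyMeasurableAtFilter hc.continuousAt)
        exact this
      · exact intervalIntegral.integral_hasDerivAt_right (hc.intervalIntegrable _ _)
              hc.stronglyMeasurable.stronglyMeasurableAtFilter hc.continuousAt
    exact ⟨_, (h.generator _ _).1 h2⟩
  have hlim : Tendsto (fun r : ℝ => r⁻¹ • ∫ s in (0 : ℝ)..r, U s ψ) (𝓝[≠] 0) (𝓝 ψ) := by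
    have h2 : HasDerivAt (fun t => ∫ s in (0 : ℝ)..t, U s ψ) (U 0 ψ) 0 :=
      intervalIntegral.integral_hasDerivAt_right (hc.intervalIntegrable _ _)
              hc.stronglyMeasurable.stronglyMeasurableAtFilter hc.continuousAt
    have h3 := h2.tendsto_slope_zero
    simpa [h.apply_zero] using h3
  refine mem_closure_of_tendsto hlim (Eventually.of_forall fun r => ?_)
  obtain ⟨φ, hφ⟩ := hD r
  refine ⟨((r⁻¹ : ℝ) : ℂ) • φ, ?_⟩
  have := A.graph.smul_mem ((r⁻¹ : ℝ) : ℂ) hφ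
  simpa only [Prod.smul_mk, Complex.coe_smul] using this

/-- Duhamel's formula `e^{itA'} e^{-itA} φ = φ + ∫₀ᵗ e^{isA'} iB e^{-isA} φ ds`, for
`A' = A + B` with `B` bounded. -/
theorem duhamel (h : IsUnitaryGroupOf A U) (h' : IsUnitaryGroupOf A' U') (B : 𝓗 →L[ℂ] 𝓗)
    (hB : ∀ ψ φ, (ψ, φ) ∈ A.graph → (ψ, φ + B ψ) ∈ A'.graph) (φ : 𝓗) (t : ℝ) :
    U' (-t) (U t φ) = φ + ∫ s in (0 : ℝ)..t, U' (-s) (Complex.I • B (U s φ)) := by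
  have hcont : Continuous fun p : 𝓗 × ℝ => U' (-p.2) (Complex.I • B (U p.2 p.1)) := by
    have h1 : Continuous fun p : 𝓗 × ℝ => U p.2 p.1 :=
      h.continuous_apply continuous_snd continuous_fst
    exact h'.continuous_apply continuous_snd.neg ((B.continuous.comp h1).const_smul _)
  have hclosed : IsClosed {φ : 𝓗 | U' (-t) (U t φ) =
      φ + ∫ s in (0 : ℝ)..t, U' (-s) (Complex.I • B (U s φ))} := by
    refine isClosed_eq ?_ ?_
    · exact (U' (-t)).continuous.comp (U t).continuous
    · refine continuous_id.add ?_
      exact intervalIntegral.continuous_parametric_intervalIntegral_of_continuous' hcont 0 t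
  refine closure_minimal ?_ hclosed (h.dense_domain φ)
  rintro ψ ⟨χ, hψ⟩
  have hderiv : ∀ s, HasDerivAt (fun s => U' (-s) (U s ψ)) (U' (-s) (Complex.I • B (U s ψ))) s := by
    intro s
    have h1 := h.graph_invariant hψ s
    have h2 := hB _ _ h1
    have h3 : HasDerivAt (fun r => U' (-r) (U s ψ))
        (-(U' (-s) (-(Complex.I • (U s χ + B (U s ψ)))))) s := by
      have := HasDerivAt.scomp s (h'.hasDerivAt h2 (-s)) (hasDerivAt_neg s)
      simpa [Function.comp_def, add_comm] using this
    have h4 := hasDerivAt_clm_apply_of_strong (T := fun r => U' (-r)) (x := fun r => U r ψ) (t := s)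
      (fun r x => (h'.norm_apply _ x).le) h3 (h.hasDerivAt hψ s)
      (h'.continuous_apply continuous_neg continuous_const).continuousAt
    convert! h4 using 1
    simp only [map_neg, map_smul, smul_add, map_add]
    abel
  have h5 := intervalIntegral.integral_eq_sub_of_hasDerivAt (fun s _ => hderiv s)
    ((hcont.comp (Continuous.prodMk_right ψ)).intervalIntegrable 0 t)
  change U' (-t) (U t ψ) = ψ + ∫ s in (0 : ℝ)..t, U' (-s) (Complex.I • B (U s ψ))
  have h6 : (∫ s in (0 : ℝ)..t, U' (-s) (Complex.I • B (U s ψ))) =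
      U' (-t) (U t ψ) - U' (-0) (U 0 ψ) := h5
  rw [h6, neg_zero, h'.apply_zero, h.apply_zero]
  abel

/-- A group is determined by its generator: Duhamel's formula with `B = 0`. -/
theorem unique (h : IsUnitaryGroupOf A U) (h' : IsUnitaryGroupOf A U') : U = U' := by
  funext t
  ext φ
  have := h.duhamel h' 0 (by intro ψ φ h; simpa using h) φ t
  simp only [zero_apply, smul_zero, map_zero, intervalIntegral.integral_zero,
    add_zero] at this
  rw [← this, h'.apply_neg_self, this]

end IsUnitaryGroupOf

theorem propagator_spec {A : 𝓗 →ₗ.[ℂ] 𝓗} (h : ∃ U, IsUnitaryGroupOf A U) :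
    IsUnitaryGroupOf A (propagator A) := by
  rw [propagator, dif_pos h]
  exact h.choose_spec

theorem propagator_eq {A : 𝓗 →ₗ.[ℂ] 𝓗} {U : ℝ → 𝓗 →L[ℂ] 𝓗} (h : IsUnitaryGroupOf A U) :
    propagator A = U :=
  (propagator_spec ⟨U, h⟩).unique h

end Abstract

/-! ### Bounded perturbations of generators -/

section Perturbation

variable {𝓗 : Type*} [NormedAddCommGroup 𝓗] [InnerProductSpace ℂ 𝓗]

/-- Solutions of `w' = K(t) w` with `K(t)` skew-adjoint have constant norm. -/
theorem norm_eq_of_skew_ode {K : ℝ → 𝓗 →L[ℂ] 𝓗} (hskew : ∀ t x, (inner ℂ x (K t x) : ℂ).re = 0)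
    {w : ℝ → 𝓗} (hw : ∀ t, HasDerivAt w (K t (w t)) t) (t : ℝ) : ‖w t‖ = ‖w 0‖ := by
  have h1 : ∀ t, HasDerivAt (fun s => (inner ℂ (w s) (w s) : ℂ))
      (inner ℂ (w t) (K t (w t)) + inner ℂ (K t (w t)) (w t)) t :=
    fun t => (hw t).inner ℂ (hw t)
  have h2 : ∀ t, (inner ℂ (w t) (K t (w t)) + inner ℂ (K t (w t)) (w t) : ℂ) = 0 := by
    intro t
    rw [← inner_conj_symm (K t (w t)) (w t), Complex.add_conj, hskew t (w t)]
    simp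
  have h3 := is_const_of_deriv_eq_zero (fun t => (h1 t).differentiableAt)
    (fun t => (h1 t).deriv.trans (h2 t)) t 0
  simp only [inner_self_eq_norm_sq_to_K] at h3
  have h4 : ‖w t‖ ^ 2 = ‖w 0‖ ^ 2 := by exact_mod_cast h3
  exact (sq_eq_sq₀ (norm_nonneg _) (norm_nonneg _)).1 h4

/-- The iterated integrals of the Dyson series of `w' = K(t) w`. -/
def dysonTerm (K : ℝ → 𝓗 →L[ℂ] 𝓗) (ψ : 𝓗) : ℕ → ℝ → 𝓗
  | 0 => fun _ => ψ
  | n + 1 => fun t => ∫ s in (0 : ℝ)..t, K s (dysonTerm K ψ n s)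

theorem norm_dysonTerm_le {K : ℝ → 𝓗 →L[ℂ] 𝓗} {M : ℝ} (hM : 0 ≤ M)
    (hK : ∀ t x, ‖K t x‖ ≤ M * ‖x‖) (ψ : 𝓗) (n : ℕ) :
    ∀ t, ‖dysonTerm K ψ n t‖ ≤ (M * |t|) ^ n / n.factorial * ‖ψ‖ := by
  induction n with
  | zero => intro t; simp [dysonTerm]
  | succ n ih =>
    have hpos : ∀ (L : ℝ → 𝓗), (∀ s, 0 ≤ s → ‖L s‖ ≤ M * ((M * s) ^ n / n.factorial * ‖ψ‖)) →
        ∀ t, 0 ≤ t → ‖∫ s in (0 : ℝ)..t, L s‖ ≤ (M * t) ^ (n + 1) / (n + 1).factorial * ‖ψ‖ := by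
      intro L hL t ht
      have h1 : ‖∫ s in (0 : ℝ)..t, L s‖ ≤
          ∫ s in (0 : ℝ)..t, M * ((M * s) ^ n / n.factorial * ‖ψ‖) := by
        refine intervalIntegral.norm_integral_le_of_norm_le ht
          (ae_of_all _ fun s hs => hL s hs.1.le) ?_
        exact Continuous.intervalIntegrable (by fun_prop) _ _
      refine h1.trans (le_of_eq ?_)
      have h2 : ∀ s : ℝ, M * ((M * s) ^ n / n.factorial * ‖ψ‖) =
          (M ^ (n + 1) / n.factorial * ‖ψ‖) * s ^ n := by
        intro s; rw [mul_pow]; ring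
      simp only [h2]
      rw [intervalIntegral.integral_const_mul, integral_pow, Nat.factorial_succ, mul_pow]
      push_cast
      have : (n.factorial : ℝ) ≠ 0 := by positivity
      field_simp
      simp
    intro t
    have hs : ∀ s, ‖K s (dysonTerm K ψ n s)‖ ≤ M * ((M * |s|) ^ n / n.factorial * ‖ψ‖) :=
      fun s => (hK s _).trans (mul_le_mul_of_nonneg_left (ih s) hM)
    rcases le_total 0 t with ht | ht
    · rw [abs_of_nonneg ht]
      refine hpos (fun s => K s (dysonTerm K ψ n s)) (fun s h0 => ?_) t ht
      simpa [abs_of_nonneg h0] using hs s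
    · rw [abs_of_nonpos ht]
      have := hpos (fun s => K (-s) (dysonTerm K ψ n (-s))) (fun s h0 => by
        simpa [abs_of_nonneg h0] using hs (-s)) (-t) (by linarith)
      rw [intervalIntegral.integral_comp_neg (fun s => K s (dysonTerm K ψ n s)), neg_neg, neg_zero,
        intervalIntegral.integral_symm, norm_neg] at this
      exact this

theorem continuous_dysonTerm {K : ℝ → 𝓗 →L[ℂ] 𝓗} (hcu : Continuous fun p : ℝ × 𝓗 => K p.1 p.2)
    (ψ : 𝓗) (n : ℕ) : Continuous (dysonTerm K ψ n) := by
  induction n with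
  | zero => exact continuous_const
  | succ n ih =>
    have : Continuous fun s => K s (dysonTerm K ψ n s) := hcu.comp (continuous_id.prodMk ih)
    exact intervalIntegral.continuous_primitive (fun a b => this.intervalIntegrable a b) 0

variable [CompleteSpace 𝓗]

theorem hasDerivAt_dysonTerm {K : ℝ → 𝓗 →L[ℂ] 𝓗} (hcu : Continuous fun p : ℝ × 𝓗 => K p.1 p.2)
    (ψ : 𝓗) (n : ℕ) (t : ℝ) :
    HasDerivAt (dysonTerm K ψ (n + 1)) (K t (dysonTerm K ψ n t)) t := by
  have : Continuous fun s => K s (dysonTerm K ψ n s) :=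
    hcu.comp (continuous_id.prodMk (continuous_dysonTerm hcu ψ n))
  exact intervalIntegral.integral_hasDerivAt_right (this.intervalIntegrable _ _)
    this.stronglyMeasurable.stronglyMeasurableAtFilter this.continuousAt

/-- Global solutions of `w' = K(t) w` for a bounded, strongly continuous family `K`, by summing the
Dyson series. -/
theorem exists_linear_ode_solution {K : ℝ → 𝓗 →L[ℂ] 𝓗} {M : ℝ} (hM : 0 ≤ M)
    (hK : ∀ t x, ‖K t x‖ ≤ M * ‖x‖) (hc : ∀ x, Continuous fun t => K t x) (ψ : 𝓗) :
    ∃ w : ℝ → 𝓗, w 0 = ψ ∧ ∀ t, HasDerivAt w (K t (w t)) t := by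
  have hcu := continuous_uncurry_of_strong hK hc
  have hder := hasDerivAt_dysonTerm hcu ψ
  have hbound := norm_dysonTerm_le hM hK ψ
  have hsum : ∀ t, Summable fun n => dysonTerm K ψ n t := fun t =>
    Summable.of_norm_bounded ((Real.summable_pow_div_factorial (M * |t|)).mul_right _)
      fun n => hbound n t
  refine ⟨fun t => ∑' n, dysonTerm K ψ n t, ?_, fun t => ?_⟩
  · change ∑' n, dysonTerm K ψ n 0 = ψ
    rw [tsum_eq_single 0]
    · rfl
    · intro n hn
      obtain ⟨m, rfl⟩ := Nat.exists_eq_succ_of_ne_zero hn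
      simp [dysonTerm]
  · have hder' : HasDerivAt (fun t => ∑' n, dysonTerm K ψ (n + 1) t)
        (∑' n, K t (dysonTerm K ψ n t)) t := by
      have hT : t ∈ Metric.ball (0 : ℝ) (|t| + 1) := by
        rw [mem_ball_zero_iff, Real.norm_eq_abs]; linarith
      have hu : Summable fun n : ℕ => M * ((M * (|t| + 1)) ^ n / n.factorial * ‖ψ‖) :=
        ((Real.summable_pow_div_factorial (M * (|t| + 1))).mul_right _).mul_left M
      have hb : ∀ (n : ℕ) (y : ℝ), y ∈ Metric.ball (0 : ℝ) (|t| + 1) →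
          ‖K y (dysonTerm K ψ n y)‖ ≤ M * ((M * (|t| + 1)) ^ n / n.factorial * ‖ψ‖) := by
        intro n y hy
        have hy' : |y| ≤ |t| + 1 := (mem_ball_zero_iff.1 hy).le
        refine (hK y _).trans (mul_le_mul_of_nonneg_left ((hbound n y).trans ?_) hM)
        gcongr
      exact hasDerivAt_tsum_of_isPreconnected (g := fun n t => dysonTerm K ψ (n + 1) t)
        (g' := fun n t => K t (dysonTerm K ψ n t)) hu Metric.isOpen_ball
        (convex_ball _ _).isPreconnected (fun n y _ => hder n y) hb hT
        ((summable_nat_add_iff 1).2 (hsum t)) hT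
    have h1 : ∀ s, ∑' n, dysonTerm K ψ n s = ψ + ∑' n, dysonTerm K ψ (n + 1) s := fun s => by
      rw [(hsum s).tsum_eq_zero_add]; rfl
    have h2 : ∑' n, K t (dysonTerm K ψ n t) = K t (∑' n, dysonTerm K ψ n t) :=
      ((K t).map_tsum (hsum t)).symm
    rw [← h2]
    simp only [h1]
    exact hder'.const_add ψ

/-- A bounded symmetric perturbation of the generator of a unitary group generates a unitary group.
In the interaction picture `w(t) = e^{itA} e^{-itA'} ψ` solves `w' = -i e^{itA} B e^{-itA} w`, an
equation with bounded skew-adjoint coefficients. -/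
theorem IsUnitaryGroupOf.exists_perturbation {A A' : 𝓗 →ₗ.[ℂ] 𝓗} {U : ℝ → 𝓗 →L[ℂ] 𝓗}
    (h : IsUnitaryGroupOf A U) (B : 𝓗 →L[ℂ] 𝓗)
    (hsymm : ∀ x y, inner ℂ (B x) y = (inner ℂ x (B y) : ℂ))
    (hA' : ∀ ψ φ, (ψ, φ) ∈ A'.graph ↔ (ψ, φ - B ψ) ∈ A.graph) :
    ∃ U', IsUnitaryGroupOf A' U' := by
  let K : ℝ → 𝓗 →L[ℂ] 𝓗 := fun t => (-Complex.I) • (U (-t) ∘L B ∘L U t)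
  have hKapp : ∀ t x, K t x = (-Complex.I) • U (-t) (B (U t x)) := fun _ _ => rfl
  have hK : ∀ t x, ‖K t x‖ ≤ ‖B‖ * ‖x‖ := by
    intro t x
    rw [hKapp, norm_smul, h.norm_apply]
    simpa [h.norm_apply] using B.le_opNorm (U t x)
  have hKc : ∀ x, Continuous fun t => K t x := fun x =>
    (h.continuous_apply continuous_neg (B.continuous.comp (h.continuous x))).const_smul _
  have hskew : ∀ t x, (inner ℂ x (K t x) : ℂ).re = 0 := by
    intro t x
    have h2 : (inner ℂ x (U (-t) (B (U t x))) : ℂ) = inner ℂ (U t x) (B (U t x)) := by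
      rw [h.inner_left]
    have h3 : (starRingEnd ℂ) (inner ℂ (U t x) (B (U t x)) : ℂ) = inner ℂ (U t x) (B (U t x)) := by
      rw [inner_conj_symm, hsymm]
    rw [hKapp, inner_smul_right, h2]
    have h4 := Complex.conj_eq_iff_im.1 h3
    simp [h4]
  choose w hw0 hw using fun ψ => exists_linear_ode_solution (norm_nonneg B) hK hKc ψ
  have huniq : ∀ v : ℝ → 𝓗, (∀ t, HasDerivAt v (K t (v t)) t) → ∀ t, v t = w (v 0) t := by
    intro v hv t
    have h1 := norm_eq_of_skew_ode hskew (w := fun t => v t - w (v 0) t)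
      (fun t => by rw [map_sub]; exact (hv t).sub (hw (v 0) t)) t
    rw [hw0, sub_self, norm_zero, norm_eq_zero, sub_eq_zero] at h1
    exact h1
  have hnorm : ∀ ψ t, ‖w ψ t‖ = ‖ψ‖ := fun ψ t => by
    rw [norm_eq_of_skew_ode hskew (hw ψ), hw0]
  let W : ℝ → 𝓗 →ₗᵢ[ℂ] 𝓗 := fun t =>
    { toFun := fun ψ => w ψ t
      map_add' := by
        intro a b
        have := huniq (fun t => w a t + w b t) (fun t => by
          rw [map_add]; exact (hw a t).add (hw b t)) t
        simpa only [hw0] using this.symm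
      map_smul' := by
        intro c a
        have := huniq (fun t => c • w a t) (fun t => by
          rw [map_smul]; exact (hw a t).const_smul c) t
        simpa only [hw0, RingHom.id_apply] using this.symm
      norm_map' := fun ψ => hnorm ψ t }
  let U' : ℝ → 𝓗 →L[ℂ] 𝓗 := fun t => U t ∘L (W t).toContinuousLinearMap
  have hU' : ∀ t ψ, U' t ψ = U t (w ψ t) := fun _ _ => rfl
  have hwc : ∀ ψ, Continuous (w ψ) := fun ψ =>
    continuous_iff_continuousAt.2 fun t => (hw ψ t).continuousAt
  have hzero : ∀ ψ, U' 0 ψ = ψ := fun ψ => by rw [hU', hw0, h.apply_zero]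
  have hadd : ∀ s t ψ, U' (s + t) ψ = U' s (U' t ψ) := by
    intro s t ψ
    have h1 : ∀ r, HasDerivAt (fun r => U t (w ψ (r + t))) (K r (U t (w ψ (r + t)))) r := by
      intro r
      have h2 : HasDerivAt (fun r => w ψ (r + t)) (K (r + t) (w ψ (r + t))) r :=
        HasDerivAt.comp_add_const (f := w ψ) r t (hw ψ (r + t))
      have h3 := ((U t).restrictScalars ℝ).hasFDerivAt.comp_hasDerivAt r h2
      convert! h3 using 1
      simp only [hKapp, ContinuousLinearMap.coe_restrictScalars', map_smul, ← h.apply_add]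
      rw [neg_add_rev, add_neg_cancel_left]
    have h4 := huniq _ h1 s
    simp only [zero_add] at h4
    rw [hU', h.apply_add s t, h4, ← hU' t ψ, ← hU' s]
  have hnorm' : ∀ t ψ, ‖U' t ψ‖ = ‖ψ‖ := fun t ψ => by rw [hU', h.norm_apply, hnorm]
  refine ⟨U', ?_, ?_, ?_, ?_, ?_⟩
  · intro t
    have hneg : ∀ t, U' (-t) * U' t = 1 := fun t => by
      ext ψ
      change U' (-t) (U' t ψ) = ψ
      rw [← hadd, neg_add_cancel, hzero]
    have h1 : star (U' t) * U' t = 1 :=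
      (ContinuousLinearMap.norm_map_iff_adjoint_comp_self (U' t)).1 (hnorm' t)
    have h2 : U' t * U' (-t) = 1 := by simpa using hneg (-t)
    have h3 : star (U' t) = U' (-t) := by
      calc star (U' t) = star (U' t) * (U' t * U' (-t)) := by rw [h2, mul_one]
        _ = U' (-t) := by rw [← mul_assoc, h1, one_mul]
    exact Unitary.mem_iff.2 ⟨h1, by rw [h3, h2]⟩
  · ext ψ; exact hzero ψ
  · intro s t; ext ψ; exact hadd s t ψ
  · intro ψ
    exact h.continuous_apply continuous_id (hwc ψ)
  · intro ψ φ
    -- the difference of the two orbits is differentiable at `0`, with derivative `-iBψ`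
    have hdiff : HasDerivAt (fun t => U t (w ψ t - ψ)) ((-Complex.I) • B ψ) 0 := by
      have h1 : HasDerivAt (fun t => w ψ t - ψ) (K 0 (w ψ 0)) 0 := (hw ψ 0).sub_const ψ
      have h2 := hasDerivAt_clm_apply_of_strong (T := U) (t := 0) (x := fun t => w ψ t - ψ) (y := 0)
        (fun t x => (h.norm_apply t x).le) (by simpa [hw0] using hasDerivAt_const (0 : ℝ) (0 : 𝓗))
        h1 (h.continuous _).continuousAt
      simpa [hKapp, hw0, h.apply_zero] using h2
    have h1 : HasDerivAt (fun t => U' t ψ) φ 0 ↔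
        HasDerivAt (fun t => U t ψ) (φ + Complex.I • B ψ) 0 := by
      constructor
      · intro h3
        have h4 := h3.sub hdiff
        convert! h4 using 1
        · funext t; simp [hU']
        · simp
      · intro h3
        have h4 := h3.add hdiff
        convert! h4 using 1
        · funext t; simp [hU']
        · simp
    rw [h1, h.generator, hA']
    have h2 : Complex.I • (φ + Complex.I • B ψ) = Complex.I • φ - B ψ := by
      rw [smul_add, smul_smul, Complex.I_mul_I, neg_one_smul, sub_eq_add_neg]
    rw [h2]

end Perturbation

/-! ### Multiplication operators on `L²` -/

section MulOp

variable {α : Type*} {m0 : MeasurableSpace α} {μ : Measure α}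

theorem norm_sq_eq_integral (f : Lp ℂ 2 μ) : ‖f‖ ^ 2 = ∫ x, ‖f x‖ ^ 2 ∂μ := by
  have h := (inner_self_eq_norm_sq_to_K (𝕜 := ℂ) f).symm
  rw [L2.inner_def] at h
  have h2 : ∀ x, (inner ℂ (f x) (f x) : ℂ) = ((‖f x‖ ^ 2 : ℝ) : ℂ) := fun x => by
    rw [inner_self_eq_norm_sq_to_K]; push_cast; rfl
  simp only [h2] at h
  rw [integral_complex_ofReal] at h
  exact Complex.ofReal_injective (by rw [← h]; norm_cast)

/-- Dominated convergence in `L²`. -/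
theorem tendsto_zero_of_dominated {ι : Type*} {l : Filter ι} [l.IsCountablyGenerated]
    (f : ι → Lp ℂ 2 μ) (h : ι → α → ℂ) (g : α → ℝ) (hfh : ∀ i, f i =ᵐ[μ] h i)
    (hg : MemLp g 2 μ) (hb : ∀ᶠ i in l, ∀ᵐ x ∂μ, ‖h i x‖ ≤ g x)
    (hlim : ∀ᵐ x ∂μ, Tendsto (fun i => h i x) l (𝓝 0)) : Tendsto f l (𝓝 0) := by
  rw [tendsto_zero_iff_norm_tendsto_zero]
  have h1 : Tendsto (fun i => ∫ x, ‖h i x‖ ^ 2 ∂μ) l (𝓝 (∫ _, (0 : ℝ) ∂μ)) := by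
    refine tendsto_integral_filter_of_dominated_convergence (fun x => g x ^ 2)
      (Eventually.of_forall fun i => ?_) ?_ hg.integrable_sq ?_
    · exact (((Lp.aestronglyMeasurable (f i)).congr (hfh i)).norm.pow 2)
    · filter_upwards [hb] with i hi
      filter_upwards [hi] with x hx
      rw [norm_pow, norm_norm]
      exact pow_le_pow_left₀ (norm_nonneg _) hx 2
    · filter_upwards [hlim] with x hx
      simpa using (hx.norm.pow 2)
  have h2 : ∀ i, ‖f i‖ = √(∫ x, ‖h i x‖ ^ 2 ∂μ) := fun i => by
    rw [eq_comm, Real.sqrt_eq_iff_eq_sq (integral_nonneg fun x => by positivity) (norm_nonneg _),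
      norm_sq_eq_integral]
    refine integral_congr_ae ?_
    filter_upwards [hfh i] with x hx
    rw [hx]
  simp only [h2]
  simpa using h1.sqrt

/-- Multiplication by an essentially bounded function, as a bounded operator on `L²`. -/
def mulLp (g : α → ℂ) (hg : MemLp g ∞ μ) : Lp ℂ 2 μ →L[ℂ] Lp ℂ 2 μ :=
  (ContinuousLinearMap.mul ℂ ℂ).holderL μ ∞ 2 2 (hg.toLp g)

theorem coeFn_mulLp (g : α → ℂ) (hg : MemLp g ∞ μ) (f : Lp ℂ 2 μ) :
    mulLp g hg f =ᵐ[μ] fun x => g x * f x := by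
  have h1 := (ContinuousLinearMap.mul ℂ ℂ).coeFn_holder (r := 2) (hg.toLp g) f
  filter_upwards [h1, hg.coeFn_toLp] with x hx hgx
  rw [← hgx]
  exact hx

theorem norm_mulLp_le {g : α → ℂ} (hg : MemLp g ∞ μ) {C : ℝ} (hC : ∀ᵐ x ∂μ, ‖g x‖ ≤ C)
    (f : Lp ℂ 2 μ) : ‖mulLp g hg f‖ ≤ C * ‖f‖ := by
  refine Lp.norm_le_mul_norm_of_ae_le_mul ?_
  filter_upwards [coeFn_mulLp g hg f, hC] with x hx hgx
  rw [hx, norm_mul]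
  gcongr

theorem norm_mulLp_eq {g : α → ℂ} (hg : MemLp g ∞ μ) (h1 : ∀ x, ‖g x‖ = 1)
    (f : Lp ℂ 2 μ) : ‖mulLp g hg f‖ = ‖f‖ := by
  have h : ∀ᵐ x ∂μ, ‖mulLp g hg f x‖ = ‖f x‖ := by
    filter_upwards [coeFn_mulLp g hg f] with x hx
    rw [hx, norm_mul, h1, one_mul]
  refine le_antisymm (Lp.norm_le_norm_of_ae_le ?_) (Lp.norm_le_norm_of_ae_le ?_)
  · filter_upwards [h] with x hx using hx.le
  · filter_upwards [h] with x hx using hx.ge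

theorem mulLp_mulLp {g₁ g₂ g : α → ℂ} (h₁ : MemLp g₁ ∞ μ) (h₂ : MemLp g₂ ∞ μ) (h : MemLp g ∞ μ)
    (he : ∀ x, g x = g₁ x * g₂ x) (f : Lp ℂ 2 μ) : mulLp g₁ h₁ (mulLp g₂ h₂ f) = mulLp g h f := by
  refine Lp.ext ?_
  filter_upwards [coeFn_mulLp g₁ h₁ (mulLp g₂ h₂ f), coeFn_mulLp g₂ h₂ f, coeFn_mulLp g h f]
    with x e1 e2 e3
  rw [e1, e2, e3, he, mul_assoc]

theorem inner_mulLp_real {g : α → ℂ} (hg : MemLp g ∞ μ) (hr : ∀ x, (starRingEnd ℂ) (g x) = g x)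
    (φ ψ : Lp ℂ 2 μ) : inner ℂ (mulLp g hg φ) ψ = (inner ℂ φ (mulLp g hg ψ) : ℂ) := by
  rw [L2.inner_def, L2.inner_def]
  refine integral_congr_ae ?_
  filter_upwards [coeFn_mulLp g hg φ, coeFn_mulLp g hg ψ] with x h1 h2
  rw [h1, h2]
  simp only [RCLike.inner_apply, map_mul, hr]
  ring

theorem memLp_top_phase {a : α → ℝ} (ha : Measurable a) :
    MemLp (fun x => Complex.exp (-Complex.I * a x)) ∞ μ := by
  refine memLp_top_of_bound (C := 1) (by fun_prop) (ae_of_all _ fun x => ?_)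
  have : -Complex.I * (a x : ℂ) = ((-a x : ℝ) : ℂ) * Complex.I := by push_cast; ring
  rw [this, Complex.norm_exp_ofReal_mul_I]

theorem norm_phase (a : ℝ) : ‖Complex.exp (-Complex.I * a)‖ = 1 := by
  have : -Complex.I * (a : ℂ) = ((-a : ℝ) : ℂ) * Complex.I := by push_cast; ring
  rw [this, Complex.norm_exp_ofReal_mul_I]

/-- The unitary group `e^{-ita}` of multiplication operators. -/
def phaseGroup {a : α → ℝ} (ha : Measurable a) (t : ℝ) : Lp ℂ 2 μ →L[ℂ] Lp ℂ 2 μ :=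
  mulLp (fun x => Complex.exp (-Complex.I * (t * a x : ℝ))) (memLp_top_phase (ha.const_mul t))

variable {a : α → ℝ} (ha : Measurable a)

theorem coeFn_phaseGroup (t : ℝ) (f : Lp ℂ 2 μ) :
    phaseGroup ha t f =ᵐ[μ] fun x => Complex.exp (-Complex.I * (t * a x : ℝ)) * f x :=
  coeFn_mulLp _ _ f

theorem norm_phaseGroup (t : ℝ) (f : Lp ℂ 2 μ) : ‖phaseGroup ha t f‖ = ‖f‖ :=
  norm_mulLp_eq _ (fun _ => norm_phase _) f

theorem phaseGroup_zero (f : Lp ℂ 2 μ) : phaseGroup ha 0 f = f := by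
  refine Lp.ext ?_
  filter_upwards [coeFn_phaseGroup ha 0 f] with x hx
  rw [hx]; simp

theorem phaseGroup_add (s t : ℝ) (f : Lp ℂ 2 μ) :
    phaseGroup ha (s + t) f = phaseGroup ha s (phaseGroup ha t f) := by
  refine (mulLp_mulLp _ _ _ (fun x => ?_) f).symm
  rw [← Complex.exp_add]
  congr 1
  push_cast
  ring

theorem tendsto_phaseGroup_zero (f : Lp ℂ 2 μ) :
    Tendsto (fun t => phaseGroup ha t f) (𝓝 0) (𝓝 f) := by
  rw [← tendsto_sub_nhds_zero_iff]
  refine tendsto_zero_of_dominated _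
    (fun t x => Complex.exp (-Complex.I * (t * a x : ℝ)) * f x - f x) (fun x => 2 * ‖f x‖)
    (fun t => ?_) ((Lp.memLp f).norm.const_mul 2) (Eventually.of_forall fun t => ?_) ?_
  · filter_upwards [coeFn_phaseGroup ha t f, Lp.coeFn_sub (phaseGroup ha t f) f] with x h1 h2
    rw [h2, Pi.sub_apply, h1]
  · refine ae_of_all _ fun x => (norm_sub_le _ _).trans ?_
    rw [norm_mul, norm_phase]; linarith
  · refine ae_of_all _ fun x => ?_
    have : Continuous fun t : ℝ => Complex.exp (-Complex.I * (t * a x : ℝ)) * f x - f x := by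
      fun_prop
    simpa using this.tendsto 0

theorem continuous_phaseGroup (f : Lp ℂ 2 μ) : Continuous fun t => phaseGroup ha t f := by
  rw [continuous_iff_continuousAt]
  intro t
  have h1 := ((phaseGroup (μ := μ) ha t).continuous.tendsto f).comp (tendsto_phaseGroup_zero ha f)
  have h2 : Tendsto (fun s : ℝ => s - t) (𝓝 t) (𝓝 0) := by
    simpa using (continuous_id.sub continuous_const).tendsto (X := ℝ) (Y := ℝ) (f := fun s => s - t) t
  refine (h1.comp h2).congr fun s => ?_
  simp only [Function.comp_apply]
  rw [← phaseGroup_add, add_sub_cancel]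

theorem norm_exp_sub_one_le (x : ℝ) : ‖Complex.exp (-Complex.I * x) - 1‖ ≤ |x| := by
  have := Real.norm_exp_I_mul_ofReal_sub_one_le (x := -x)
  simpa using this

theorem hasDerivAt_phaseGroup_of_eq {ψ φ : Lp ℂ 2 μ}
    (h : ∀ᵐ x ∂μ, φ x = -Complex.I * (a x * ψ x)) :
    HasDerivAt (fun t => phaseGroup ha t ψ) φ 0 := by
  rw [hasDerivAt_iff_tendsto_slope_zero, ← tendsto_sub_nhds_zero_iff]
  simp only [zero_add, phaseGroup_zero]
  refine tendsto_zero_of_dominated _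
    (fun t x => ((t⁻¹ : ℝ) : ℂ) * (Complex.exp (-Complex.I * (t * a x : ℝ)) * ψ x - ψ x) - φ x)
    (fun x => 2 * ‖φ x‖) (fun t => ?_) ((Lp.memLp φ).norm.const_mul 2) ?_ ?_
  · filter_upwards [coeFn_phaseGroup ha t ψ, Lp.coeFn_sub (phaseGroup ha t ψ) ψ,
      Lp.coeFn_sub (t⁻¹ • (phaseGroup ha t ψ - ψ)) φ,
      Lp.coeFn_smul t⁻¹ (phaseGroup ha t ψ - ψ)] with x h1 h2 h3 h4
    rw [h3, Pi.sub_apply, h4, Pi.smul_apply, h2, Pi.sub_apply, h1]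
    simp
  · filter_upwards [self_mem_nhdsWithin] with t ht
    filter_upwards [h] with x hx
    refine (norm_sub_le _ _).trans ?_
    have e : Complex.exp (-Complex.I * (t * a x : ℝ)) * ψ x - ψ x =
        (Complex.exp (-Complex.I * (t * a x : ℝ)) - 1) * ψ x := by ring
    have h1 : ‖((t⁻¹ : ℝ) : ℂ) * (Complex.exp (-Complex.I * (t * a x : ℝ)) * ψ x - ψ x)‖ ≤ ‖φ x‖ := by
      rw [e, hx, norm_mul, norm_mul, Complex.norm_real, norm_mul, norm_mul, norm_neg,
        Complex.norm_I, one_mul, Complex.norm_real, norm_inv]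
      have h2 := norm_exp_sub_one_le (t * a x)
      have h3 : ‖t‖ ≠ 0 := norm_ne_zero_iff.2 ht
      calc ‖t‖⁻¹ * (‖Complex.exp (-Complex.I * (t * a x : ℝ)) - 1‖ * ‖ψ x‖)
          ≤ ‖t‖⁻¹ * (|t * a x| * ‖ψ x‖) := by gcongr
        _ = ‖a x‖ * ‖ψ x‖ := by
          rw [abs_mul, ← Real.norm_eq_abs, ← Real.norm_eq_abs]; field_simp
    linarith
  · filter_upwards [h] with x hx
    have h1 : HasDerivAt (fun t : ℝ => Complex.exp (-Complex.I * (t * a x : ℝ)) * ψ x) (φ x) 0 := by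
      have h2 : HasDerivAt (fun t : ℝ => -Complex.I * ((t * a x : ℝ) : ℂ)) (-Complex.I * a x) 0 := by
        have h3 : HasDerivAt (fun t : ℝ => t * a x) (1 * a x) 0 := (hasDerivAt_id 0).mul_const _
        simpa using (h3.ofReal_comp.const_mul (-Complex.I))
      have h3 := (h2.cexp.mul_const (ψ x))
      convert! h3 using 1
      rw [hx]; simp; ring
    rw [hasDerivAt_iff_tendsto_slope_zero] at h1
    have h2 := h1.sub_const (φ x)
    simpa using h2

/-- The generator of the group `e^{-ita}` is `-ia`, with its maximal domain. For the converse
direction, cut off to the sets `{|a| ≤ N}`, where `a` acts boundedly. -/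
theorem hasDerivAt_phaseGroup_iff {ψ φ : Lp ℂ 2 μ} :
    HasDerivAt (fun t => phaseGroup ha t ψ) φ 0 ↔ ∀ᵐ x ∂μ, φ x = -Complex.I * (a x * ψ x) := by
  refine ⟨fun h => ?_, hasDerivAt_phaseGroup_of_eq ha⟩
  have key : ∀ N : ℕ, ∀ᵐ x ∂μ, |a x| ≤ N → φ x = -Complex.I * (a x * ψ x) := by
    intro N
    have hS : MeasurableSet {x | |a x| ≤ N} := measurableSet_le ha.abs measurable_const
    let χ : α → ℂ := Set.indicator {x | |a x| ≤ N} 1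
    have hχ : MemLp χ ∞ μ := memLp_top_of_bound (C := 1)
      ((stronglyMeasurable_one.indicator hS).aestronglyMeasurable) (ae_of_all _ fun x => by
        refine (norm_indicator_le_norm_self _ _).trans ?_; simp)
    have haχ : MemLp (fun x => -Complex.I * (a x * χ x)) ∞ μ := by
      refine memLp_top_of_bound (C := N) ?_ (ae_of_all _ fun x => ?_)
      · exact (Measurable.aestronglyMeasurable (by
          have : Measurable χ := measurable_one.indicator hS
          fun_prop))
      · by_cases hx : |a x| ≤ N
        · have : χ x = 1 := Set.indicator_of_mem (s := {x | |a x| ≤ (N : ℝ)}) hx _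
          simpa [this] using hx
        · have : χ x = 0 := Set.indicator_of_notMem (s := {x | |a x| ≤ (N : ℝ)}) hx _
          simp [this]
    have h1 : HasDerivAt (fun t => mulLp χ hχ (phaseGroup ha t ψ)) (mulLp χ hχ φ) 0 :=
      ((mulLp χ hχ).restrictScalars ℝ).hasFDerivAt.comp_hasDerivAt 0 h
    have h2 : HasDerivAt (fun t => phaseGroup ha t (mulLp χ hχ ψ))
        (mulLp (fun x => -Complex.I * (a x * χ x)) haχ ψ) 0 := by
      refine hasDerivAt_phaseGroup_of_eq ha ?_
      filter_upwards [coeFn_mulLp χ hχ ψ, coeFn_mulLp _ haχ ψ] with x e1 e2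
      rw [e1, e2]; ring
    have h3 : (fun t => mulLp χ hχ (phaseGroup ha t ψ)) =
        fun t => phaseGroup ha t (mulLp χ hχ ψ) := by
      funext t
      refine Lp.ext ?_
      filter_upwards [coeFn_mulLp χ hχ ψ, coeFn_mulLp χ hχ (phaseGroup ha t ψ),
        coeFn_phaseGroup ha t ψ, coeFn_phaseGroup ha t (mulLp χ hχ ψ)] with x e1 e2 e3 e4
      rw [e2, e3, e4, e1]; ring
    rw [h3] at h1
    have h4 := h1.unique h2
    have h5 : (mulLp χ hχ φ : α → ℂ) =ᵐ[μ] mulLp (fun x => -Complex.I * (a x * χ x)) haχ ψ := by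
      rw [h4]
    filter_upwards [h5, coeFn_mulLp χ hχ φ, coeFn_mulLp _ haχ ψ] with x e1 e2 e3 hx
    have : χ x = 1 := Set.indicator_of_mem (s := {x | |a x| ≤ (N : ℝ)}) hx _
    rw [e2, e3, this] at e1
    simpa [mul_assoc] using e1
  filter_upwards [ae_all_iff.2 key] with x hx
  obtain ⟨N, hN⟩ := exists_nat_ge |a x|
  exact hx N hN

end MulOp

/-! ### The free group and the perturbed group -/

section Free

open FourierTransform

variable {d : ℕ}

/-- The symbol `4π²|ξ|²` of `-Δ`, for the Fourier transform with kernel `e^{-2πi⟨x, ξ⟩}`. -/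
def symbol (d : ℕ) (ξ : E d) : ℝ := (2 * Real.pi) ^ 2 * ‖ξ‖ ^ 2

theorem measurable_symbol : Measurable (symbol d) := by unfold symbol; fun_prop

/-- The `L²` Fourier transform as a linear isometric equivalence. -/
abbrev fourierL2 (d : ℕ) : L2 d ≃ₗᵢ[ℂ] L2 d := Lp.fourierTransformₗᵢ (E d) ℂ

/-- The Fourier multiplier by an essentially bounded function. -/
def fourierMul (g : E d → ℂ) (hg : MemLp g ∞ volume) : L2 d →L[ℂ] L2 d :=
  (fourierL2 d).symm.toContinuousLinearEquiv.toContinuousLinearMap ∘L mulLp g hg ∘L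
    (fourierL2 d).toContinuousLinearEquiv.toContinuousLinearMap

theorem fourierL2_fourierMul (g : E d → ℂ) (hg : MemLp g ∞ volume) (f : L2 d) :
    fourierL2 d (fourierMul g hg f) = mulLp g hg (fourierL2 d f) := by
  simp [fourierMul]

/-- The free evolution `e^{itΔ}`, as the Fourier multiplier `e^{-4π²it|ξ|²}`. -/
def freeGroup (d : ℕ) (t : ℝ) : L2 d →L[ℂ] L2 d :=
  (fourierL2 d).symm.toContinuousLinearEquiv.toContinuousLinearMap ∘L
    phaseGroup measurable_symbol t ∘L
    (fourierL2 d).toContinuousLinearEquiv.toContinuousLinearMap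

theorem freeGroup_apply (t : ℝ) (f : L2 d) :
    freeGroup d t f = (fourierL2 d).symm (phaseGroup measurable_symbol t (fourierL2 d f)) := rfl

theorem fourierL2_freeGroup (t : ℝ) (f : L2 d) :
    fourierL2 d (freeGroup d t f) = phaseGroup measurable_symbol t (fourierL2 d f) := by
  rw [freeGroup_apply, LinearIsometryEquiv.apply_symm_apply]

theorem norm_freeGroup (t : ℝ) (f : L2 d) : ‖freeGroup d t f‖ = ‖f‖ := by
  rw [← (fourierL2 d).norm_map, fourierL2_freeGroup, norm_phaseGroup, (fourierL2 d).norm_map]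

theorem ae_eq_of_integral_schwartz_eq {f g : E d → ℂ} (hf : LocallyIntegrable f)
    (hg : LocallyIntegrable g)
    (h : ∀ u : 𝓢(E d, ℂ), ∫ x, u x * f x = ∫ x, u x * g x) : f =ᵐ[volume] g := by
  have h0 : ∀ᵐ x, f x - g x = 0 := by
    refine ae_eq_zero_of_integral_contDiff_smul_eq_zero (hf.sub hg) ?_
    intro u hu huc
    have hu1 : HasCompactSupport (Complex.ofRealCLM ∘ u) := huc.comp_left rfl
    have hu2 : ContDiff ℝ ((⊤ : ℕ∞) : WithTop ℕ∞) (Complex.ofRealCLM ∘ u) := by fun_prop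
    have h1 := h (hu1.toSchwartzMap hu2)
    have h2 : ∀ x, (hu1.toSchwartzMap hu2) x = ((u x : ℝ) : ℂ) := fun x => by simp
    simp only [h2] at h1
    have hI : ∀ f : E d → ℂ, LocallyIntegrable f → Integrable fun x => ((u x : ℝ) : ℂ) * f x := by
      intro f hf
      have := hf.integrable_smul_left_of_hasCompactSupport hu.continuous huc
      simpa using this
    calc ∫ x, u x • (f - g) x = ∫ x, (((u x : ℝ) : ℂ) * f x - ((u x : ℝ) : ℂ) * g x) := by
          refine integral_congr_ae (ae_of_all _ fun x => ?_)
          simp [mul_sub]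
      _ = 0 := by rw [integral_sub (hI f hf) (hI g hg), h1, sub_self]
  filter_upwards [h0] with x hx using sub_eq_zero.1 hx

/-- On the Fourier side `-Δ` is multiplication by its symbol, on the maximal domain. -/
theorem mem_freeGraph_iff (ψ φ : L2 d) : (ψ, φ) ∈ freeGraph d ↔
    ∀ᵐ ξ, fourierL2 d φ ξ = (symbol d ξ : ℂ) * fourierL2 d ψ ξ := by
  have h1 : (ψ, φ) ∈ freeGraph d ↔ -(Δ (ψ : 𝓢'(E d, ℂ))) = (φ : 𝓢'(E d, ℂ)) := Iff.rfl
  have hinj : Function.Injective (𝓕 : 𝓢'(E d, ℂ) → 𝓢'(E d, ℂ)) := fun a b hab => by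
    simpa using congrArg (𝓕⁻ : 𝓢'(E d, ℂ) → 𝓢'(E d, ℂ)) hab
  have htg : (fun x : E d => Complex.ofReal (‖x‖ ^ 2)).HasTemperateGrowth := by fun_prop
  have h2 : 𝓕 (-(Δ (ψ : 𝓢'(E d, ℂ)))) = ((2 * Real.pi) ^ 2) •
      TemperedDistribution.smulLeftCLM ℂ (fun x : E d => Complex.ofReal (‖x‖ ^ 2))
        ((fourierL2 d ψ : L2 d) : 𝓢'(E d, ℂ)) := by
    rw [TemperedDistribution.laplacian_eq_fourierMultiplierCLM, ← neg_smul, neg_neg,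
      TemperedDistribution.fourierMultiplierCLM_apply]
    rw [Lp.fourier_toTemperedDistribution_eq]
    rw [← Complex.coe_smul, FourierTransform.fourier_smul, FourierTransform.fourier_fourierInv_eq,
      Complex.coe_smul]
    rfl
  have h3 : 𝓕 (φ : 𝓢'(E d, ℂ)) = ((fourierL2 d φ : L2 d) : 𝓢'(E d, ℂ)) :=
    Lp.fourier_toTemperedDistribution_eq φ
  rw [h1, ← hinj.eq_iff, h2, h3]
  have h4 : ∀ u : 𝓢(E d, ℂ), (((2 * Real.pi) ^ 2) •
      TemperedDistribution.smulLeftCLM ℂ (fun x : E d => Complex.ofReal (‖x‖ ^ 2))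
        ((fourierL2 d ψ : L2 d) : 𝓢'(E d, ℂ))) u =
      ∫ x, u x * ((symbol d x : ℂ) * fourierL2 d ψ x) := by
    intro u
    have : (((2 * Real.pi) ^ 2) •
      TemperedDistribution.smulLeftCLM ℂ (fun x : E d => Complex.ofReal (‖x‖ ^ 2))
        ((fourierL2 d ψ : L2 d) : 𝓢'(E d, ℂ))) u = ((2 * Real.pi) ^ 2) •
        (TemperedDistribution.smulLeftCLM ℂ (fun x : E d => Complex.ofReal (‖x‖ ^ 2))
        ((fourierL2 d ψ : L2 d) : 𝓢'(E d, ℂ)) u) := rfl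
    rw [this, TemperedDistribution.smulLeftCLM_apply_apply, Lp.toTemperedDistribution_apply,
      ← integral_smul]
    refine integral_congr_ae (ae_of_all _ fun x => ?_)
    simp only [SchwartzMap.smulLeftCLM_apply_apply htg, symbol, smul_eq_mul, Complex.real_smul]
    push_cast
    ring
  have hLψ : LocallyIntegrable (fun x => (symbol d x : ℂ) * fourierL2 d ψ x) := by
    have h5 : LocallyIntegrable (fourierL2 d ψ) volume :=
      (Lp.memLp (fourierL2 d ψ)).locallyIntegrable (by norm_num)
    have h6 : Continuous fun x => (symbol d x : ℂ) := by unfold symbol; fun_prop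
    rw [← locallyIntegrableOn_univ] at h5 ⊢
    exact h5.continuousOn_mul h6.continuousOn isOpen_univ.isLocallyClosed
  have hLφ : LocallyIntegrable (fourierL2 d φ) volume :=
      (Lp.memLp (fourierL2 d φ)).locallyIntegrable (by norm_num)
  constructor
  · intro h
    refine ae_eq_of_integral_schwartz_eq hLφ hLψ fun u => ?_
    rw [← h4 u, h, Lp.toTemperedDistribution_apply]
    rfl
  · intro h
    ext u
    rw [h4, Lp.toTemperedDistribution_apply]
    refine integral_congr_ae ?_
    filter_upwards [h] with x hx
    rw [hx, smul_eq_mul]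

theorem mem_freeHamiltonian_graph (ψ φ : L2 d) : (ψ, φ) ∈ (freeHamiltonian d).graph ↔
    ∀ᵐ ξ, fourierL2 d φ ξ = (symbol d ξ : ℂ) * fourierL2 d ψ ξ := by
  rw [freeHamiltonian, Submodule.toLinearPMap_graph_eq _ freeGraph_functional, mem_freeGraph_iff]

theorem isUnitaryGroupOf_freeGroup : IsUnitaryGroupOf (freeHamiltonian d) (freeGroup d) := by
  have hadd : ∀ s t f, freeGroup d (s + t) f = freeGroup d s (freeGroup d t f) := fun s t f => by
    rw [freeGroup_apply, freeGroup_apply, fourierL2_freeGroup, phaseGroup_add]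
  have hzero : ∀ f, freeGroup d 0 f = f := fun f => by
    rw [freeGroup_apply, phaseGroup_zero, LinearIsometryEquiv.symm_apply_apply]
  refine ⟨?_, ?_, ?_, ?_, ?_⟩
  · intro t
    have hneg : ∀ t, freeGroup d (-t) * freeGroup d t = 1 := fun t => by
      ext1 ψ
      change freeGroup d (-t) (freeGroup d t ψ) = ψ
      rw [← hadd, neg_add_cancel, hzero]
    have h1 : star (freeGroup d t) * freeGroup d t = 1 :=
      (ContinuousLinearMap.norm_map_iff_adjoint_comp_self (freeGroup d t)).1 (norm_freeGroup t)
    have h2 : freeGroup d t * freeGroup d (-t) = 1 := by simpa using hneg (-t)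
    have h3 : star (freeGroup d t) = freeGroup d (-t) := by
      calc star (freeGroup d t) = star (freeGroup d t) * (freeGroup d t * freeGroup d (-t)) := by
            rw [h2, mul_one]
        _ = freeGroup d (-t) := by rw [← mul_assoc, h1, one_mul]
    exact Unitary.mem_iff.2 ⟨h1, by rw [h3, h2]⟩
  · ext1 ψ; exact hzero ψ
  · intro s t; ext1 ψ; exact hadd s t ψ
  · intro ψ
    exact (fourierL2 d).symm.continuous.comp (continuous_phaseGroup measurable_symbol _)
  · intro ψ φ
    have h1 : HasDerivAt (fun t => freeGroup d t ψ) φ 0 ↔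
        HasDerivAt (fun t => phaseGroup measurable_symbol t (fourierL2 d ψ)) (fourierL2 d φ) 0 := by
      constructor
      · intro h
        have h2 := (((fourierL2 d).toContinuousLinearEquiv.toContinuousLinearMap).restrictScalars
          ℝ).hasFDerivAt.comp_hasDerivAt 0 h
        refine h2.congr_of_eventuallyEq (Eventually.of_forall fun t => ?_)
        exact (fourierL2_freeGroup t ψ).symm
      · intro h
        have h2 := (((fourierL2 d).symm.toContinuousLinearEquiv.toContinuousLinearMap).restrictScalars
          ℝ).hasFDerivAt.comp_hasDerivAt 0 h
        have h3 : ((fourierL2 d).symm.toContinuousLinearEquiv.toContinuousLinearMap).restrictScalars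
          ℝ (fourierL2 d φ) = φ := (fourierL2 d).symm_apply_apply φ
        rw [h3] at h2
        exact h2
    refine Iff.trans h1 ?_
    rw [hasDerivAt_phaseGroup_iff, mem_freeHamiltonian_graph]
    refine eventually_congr ?_
    have h4 : fourierL2 d (Complex.I • φ) =ᵐ[volume] Complex.I • (fourierL2 d φ : E d → ℂ) := by
      rw [(fourierL2 d).map_smul]
      exact Lp.coeFn_smul _ _
    filter_upwards [h4] with x hx
    rw [hx, Pi.smul_apply, smul_eq_mul]
    constructor
    · intro h
      rw [h, ← mul_assoc, mul_neg, Complex.I_mul_I, neg_neg, one_mul]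
    · intro h
      rw [← h, ← mul_assoc, neg_mul, Complex.I_mul_I, neg_neg, one_mul]

theorem propagator_freeHamiltonian : propagator (freeHamiltonian d) = freeGroup d :=
  propagator_eq isUnitaryGroupOf_freeGroup

variable {V : E d → ℝ} {M : ℝ}

theorem memLp_top_potential (hVm : AEStronglyMeasurable V volume) (hVM : ∀ x, |V x| ≤ M) :
    MemLp (fun x => (V x : ℂ)) ∞ volume :=
  memLp_top_of_bound (C := M) (Complex.continuous_ofReal.comp_aestronglyMeasurable hVm)
    (ae_of_all _ fun x => by simpa using hVM x)

theorem mem_hamiltonian_graph (hV : MemLp (fun x => (V x : ℂ)) ∞ volume) (ψ φ : L2 d) :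
    (ψ, φ) ∈ (hamiltonian V).graph ↔
      (ψ, φ - mulLp (fun x => (V x : ℂ)) hV ψ) ∈ (freeHamiltonian d).graph := by
  have hmem : ∀ ψ : L2 d, (ψ, mulLp (fun x => (V x : ℂ)) hV ψ) ∈ (multOp V).graph := by
    intro ψ
    rw [multOp, Submodule.toLinearPMap_graph_eq _ (multGraph_functional V)]
    exact coeFn_mulLp _ hV ψ
  have hdom : ∀ ψ, ψ ∈ (multOp V).domain := fun ψ => LinearPMap.mem_domain_of_mem_graph (hmem ψ)
  have hval : ∀ (ψ : L2 d) (h : ψ ∈ (multOp V).domain),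
      multOp V ⟨ψ, h⟩ = mulLp (fun x => (V x : ℂ)) hV ψ := fun ψ h =>
    LinearPMap.mem_graph_snd_inj (multOp V) ((multOp V).mem_graph ⟨ψ, h⟩) (hmem ψ) rfl
  rw [LinearPMap.mem_graph_iff, LinearPMap.mem_graph_iff]
  constructor
  · rintro ⟨⟨y, hy⟩, h1, h2⟩
    change y = ψ at h1
    subst h1
    refine ⟨⟨y, hy.1⟩, rfl, ?_⟩
    change _ = φ - _
    rw [eq_sub_iff_add_eq, ← hval y hy.2]
    exact h2
  · rintro ⟨⟨y, hy⟩, h1, h2⟩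
    change y = ψ at h1
    subst h1
    refine ⟨⟨y, hy, hdom y⟩, rfl, ?_⟩
    change _ = φ - _ at h2
    rw [eq_sub_iff_add_eq, ← hval y (hdom y)] at h2
    exact h2

/-- `H` generates a unitary group, so `propagator` does not take its default value here. -/
theorem isUnitaryGroupOf_hamiltonian (hV : MemLp (fun x => (V x : ℂ)) ∞ volume) :
    IsUnitaryGroupOf (hamiltonian V) (propagator (hamiltonian V)) := by
  refine propagator_spec (isUnitaryGroupOf_freeGroup.exists_perturbation
    (mulLp (fun x => (V x : ℂ)) hV) ?_ (mem_hamiltonian_graph hV))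
  exact fun x y => inner_mulLp_real hV (fun x => Complex.conj_ofReal _) x y

end Free

/-! ### Plancherel's theorem for integrable square-integrable functions -/

section Plancherel

open FourierTransform

variable {d : ℕ}

theorem enorm_toLp_sq {α : Type*} {m0 : MeasurableSpace α} {μ : Measure α} {f : α → ℂ}
    (hf : MemLp f 2 μ) : ‖hf.toLp f‖ₑ ^ 2 = ∫⁻ x, ‖f x‖ₑ ^ 2 ∂μ := by
  rw [Lp.enorm_toLp]
  have := eLpNorm_nnreal_pow_eq_lintegral (f := f) (μ := μ) (p := 2) two_ne_zero
  simpa using this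

theorem enorm_Lp_sq {α : Type*} {m0 : MeasurableSpace α} {μ : Measure α} (f : Lp ℂ 2 μ) :
    ‖f‖ₑ ^ 2 = ∫⁻ x, ‖f x‖ₑ ^ 2 ∂μ := by
  conv_lhs => rw [← Lp.toLp_coeFn f (Lp.memLp f)]
  exact enorm_toLp_sq _

theorem memLp_two_of_lintegral {α : Type*} {m0 : MeasurableSpace α} {μ : Measure α} {f : α → ℂ}
    (hf : AEStronglyMeasurable f μ) (h : ∫⁻ x, ‖f x‖ₑ ^ 2 ∂μ < ∞) : MemLp f 2 μ := by
  refine ⟨hf, ?_⟩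
  have := eLpNorm_nnreal_pow_eq_lintegral (f := f) (μ := μ) (p := 2) two_ne_zero
  have h2 : eLpNorm f 2 μ ^ 2 < ∞ := by
    refine lt_of_eq_of_lt ?_ h
    simpa using this
  exact (ENNReal.pow_lt_top_iff.1 h2).resolve_right two_ne_zero

theorem continuous_fourier {f : E d → ℂ} (hf : Integrable f) : Continuous (𝓕 f) :=
  VectorFourier.fourierIntegral_continuous Real.continuous_fourierChar continuous_inner hf

/-- The `L²` Fourier transform of an integrable function is its Fourier integral. -/
theorem fourierL2_toLp {f : E d → ℂ} (h1 : Integrable f) (h2 : MemLp f 2 volume) :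
    fourierL2 d (h2.toLp f) =ᵐ[volume] 𝓕 f := by
  refine ae_eq_of_integral_schwartz_eq
    ((Lp.memLp (fourierL2 d (h2.toLp f))).locallyIntegrable (by norm_num))
    (continuous_fourier h1).locallyIntegrable fun u => ?_
  have e1 : ∫ x, u x * fourierL2 d (h2.toLp f) x =
      ((fourierL2 d (h2.toLp f) : L2 d) : 𝓢'(E d, ℂ)) u := by
    rw [Lp.toTemperedDistribution_apply]; rfl
  have e2 : ((fourierL2 d (h2.toLp f) : L2 d) : 𝓢'(E d, ℂ)) =
      𝓕 ((h2.toLp f : L2 d) : 𝓢'(E d, ℂ)) := (Lp.fourier_toTemperedDistribution_eq _).symm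
  have e3 : ∫ ξ, (𝓕 (u : E d → ℂ)) ξ • f ξ = ∫ x, u x • (𝓕 f) x := by
    have := VectorFourier.integral_fourierIntegral_smul_eq_flip (μ := volume) (ν := volume)
      (L := innerₗ (E d)) (f := u) (g := f) Real.continuous_fourierChar continuous_inner u.integrable h1
    rw [flip_innerₗ] at this
    exact this
  rw [e1, e2, TemperedDistribution.fourier_apply, Lp.toTemperedDistribution_apply]
  refine Eq.trans ?_ e3
  refine integral_congr_ae ?_
  filter_upwards [h2.coeFn_toLp] with x hx
  rw [hx]
  rfl

theorem lintegral_fourier_sq {f : E d → ℂ} (h1 : Integrable f) (h2 : MemLp f 2 volume) :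
    ∫⁻ ξ, ‖𝓕 f ξ‖ₑ ^ 2 = ∫⁻ x, ‖f x‖ₑ ^ 2 := by
  rw [← enorm_toLp_sq h2, ← (fourierL2 d).enorm_map, enorm_Lp_sq]
  refine lintegral_congr_ae ?_
  filter_upwards [fourierL2_toLp h1 h2] with x hx
  rw [hx]

theorem lintegral_comp_inv_smul {r : ℝ} (hr : 0 < r) (F : E d → ℝ≥0∞) :
    ∫⁻ p, F (r⁻¹ • p) = ENNReal.ofReal (r ^ d) * ∫⁻ p, F p := by
  have hr' : r⁻¹ ≠ 0 := inv_ne_zero hr.ne'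
  have h := (Homeomorph.smulOfNeZero (α := E d) r⁻¹ hr').measurableEmbedding.lintegral_map
    (μ := volume) F
  have h2 : Measure.map (Homeomorph.smulOfNeZero (α := E d) r⁻¹ hr') volume =
      ENNReal.ofReal (r ^ d) • (volume : Measure (E d)) := by
    have := Measure.map_addHaar_smul (volume : Measure (E d)) hr'
    rw [finrank_euclideanSpace_fin, inv_pow, inv_inv, abs_of_pos (pow_pos hr d)] at this
    exact this
  rw [h2, lintegral_smul_measure, smul_eq_mul] at h
  exact h.symm

end Plancherel

/-! ### Coherent state coefficients -/

section Coefficients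

open FourierTransform

variable {d : ℕ}

/-- The coefficient `∫ conj (e^{i⟨p, y - x⟩} h(y - x)) g(y) dy` of `g` against the phase space
translate of a window `h`, at the phase space point `z = (x, p)`. -/
def windowCoeff (h g : E d → ℂ) (z : E d × E d) : ℂ :=
  ∫ y, (starRingEnd ℂ) (Complex.exp (Complex.I * (inner ℝ z.2 (y - z.1) : ℝ)) * h (y - z.1)) * g y

/-- The integrand of `windowCoeff` without the oscillating factor. -/
def windowProd (h g : E d → ℂ) (x y : E d) : ℂ := (starRingEnd ℂ) (h (y - x)) * g y

theorem enorm_windowCoeff (h g : E d → ℂ) (x p : E d) :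
    ‖windowCoeff h g (x, p)‖ₑ = ‖𝓕 (windowProd h g x) ((2 * Real.pi)⁻¹ • p)‖ₑ := by
  have h1 : windowCoeff h g (x, p) = Complex.exp ((inner ℝ p x : ℝ) * Complex.I) *
      𝓕 (windowProd h g x) ((2 * Real.pi)⁻¹ • p) := by
    rw [Real.fourier_eq', ← integral_const_mul, windowCoeff]
    refine integral_congr_ae (ae_of_all _ fun y => ?_)
    simp only [windowProd, map_mul, smul_eq_mul]
    rw [← Complex.exp_conj, ← mul_assoc, ← mul_assoc, ← Complex.exp_add]
    congr 3
    simp only [map_mul, Complex.conj_I, Complex.conj_ofReal, inner_sub_right, inner_smul_right,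
      real_inner_comm p y]
    have hpi : (Real.pi : ℂ) ≠ 0 := by exact_mod_cast Real.pi_ne_zero
    push_cast
    field_simp
    ring
  rw [h1, enorm_mul, ← ofReal_norm, Complex.norm_exp_ofReal_mul_I]
  simp

variable {h g : E d → ℂ}

theorem measurable_windowCoeff (hm : Measurable h) (gm : Measurable g) :
    StronglyMeasurable (windowCoeff h g) := by
  have : StronglyMeasurable fun q : (E d × E d) × E d =>
      (starRingEnd ℂ) (Complex.exp (Complex.I * (inner ℝ q.1.2 (q.2 - q.1.1) : ℝ)) *
        h (q.2 - q.1.1)) * g q.2 := by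
    refine Measurable.stronglyMeasurable ?_
    refine Measurable.mul ?_ (by fun_prop)
    exact Complex.continuous_conj.measurable.comp (by fun_prop)
  exact this.integral_prod_right'

theorem measurable_windowProd (hm : Measurable h) (gm : Measurable g) (x : E d) :
    Measurable (windowProd h g x) := by
  refine Measurable.mul ?_ gm
  exact Complex.continuous_conj.measurable.comp (by fun_prop)

theorem memLp_shift (hh : MemLp h 2 volume) (x : E d) :
    MemLp (fun y => (starRingEnd ℂ) (h (y - x))) 2 volume := by
  have h1 : MemLp (fun y => h (y - x)) 2 volume :=
    hh.comp_measurePreserving (measurePreserving_sub_right volume x)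
  exact h1.star

theorem integrable_windowProd (hh : MemLp h 2 volume) (hg : MemLp g 2 volume) (x : E d) :
    Integrable (windowProd h g x) :=
  (memLp_shift hh x).integrable_mul hg

theorem enorm_windowProd_sq (x y : E d) :
    ‖windowProd h g x y‖ₑ ^ 2 = ‖h (y - x)‖ₑ ^ 2 * ‖g y‖ₑ ^ 2 := by
  rw [windowProd, enorm_mul, RCLike.enorm_conj, mul_pow]

theorem lintegral_windowProd (hm : Measurable h) (gm : Measurable g) (X : Set (E d)) :
    ∫⁻ x in X, ∫⁻ y, ‖windowProd h g x y‖ₑ ^ 2 =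
      ∫⁻ y, (∫⁻ x in X, ‖h (y - x)‖ₑ ^ 2) * ‖g y‖ₑ ^ 2 := by
  simp only [enorm_windowProd_sq]
  rw [lintegral_lintegral_swap]
  · refine lintegral_congr fun y => ?_
    rw [lintegral_mul_const]
    fun_prop
  · exact Measurable.aemeasurable (by fun_prop)

theorem lintegral_windowProd_univ (hm : Measurable h) (gm : Measurable g) :
    ∫⁻ x, ∫⁻ y, ‖windowProd h g x y‖ₑ ^ 2 = (∫⁻ x, ‖h x‖ₑ ^ 2) * ∫⁻ y, ‖g y‖ₑ ^ 2 := by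
  have := lintegral_windowProd (h := h) (g := g) hm gm Set.univ
  simp only [Measure.restrict_univ] at this
  rw [this, ← lintegral_const_mul _ (by fun_prop)]
  refine lintegral_congr fun y => ?_
  rw [lintegral_sub_left_eq_self (fun x => ‖h x‖ₑ ^ 2) y]

/-- Plancherel's theorem in the momentum variable: the coherent state coefficients over positions
in `X` see `|g|²` smeared out by `|h|²`. -/
theorem lintegral_windowCoeff (hm : Measurable h) (gm : Measurable g) (hh : MemLp h 2 volume)
    (hg : MemLp g 2 volume) (X : Set (E d)) :
    ∫⁻ z in X ×ˢ Set.univ, ‖windowCoeff h g z‖ₑ ^ 2 = ENNReal.ofReal ((2 * Real.pi) ^ d) *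
      ∫⁻ y, (∫⁻ x in X, ‖h (y - x)‖ₑ ^ 2) * ‖g y‖ₑ ^ 2 := by
  have hmeas : Measurable fun z => ‖windowCoeff h g z‖ₑ ^ 2 :=
    (measurable_windowCoeff hm gm).measurable.enorm.pow_const 2
  have hfin : ∀ᵐ x, ∫⁻ y, ‖windowProd h g x y‖ₑ ^ 2 < ∞ := by
    refine ae_lt_top ?_ ?_
    · have : Measurable fun q : E d × E d => ‖windowProd h g q.1 q.2‖ₑ ^ 2 := by
        simp only [enorm_windowProd_sq]; fun_prop
      exact this.lintegral_prod_right'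
    · rw [lintegral_windowProd_univ hm gm, ← enorm_toLp_sq hh, ← enorm_toLp_sq hg]
      finiteness
  rw [Measure.volume_eq_prod, ← Measure.prod_restrict, Measure.restrict_univ,
    lintegral_prod _ hmeas.aemeasurable, ← lintegral_windowProd hm gm,
    ← lintegral_const_mul']
  · refine lintegral_congr_ae ?_
    filter_upwards [ae_restrict_of_ae hfin] with x hx
    simp only [enorm_windowCoeff]
    rw [lintegral_comp_inv_smul Real.two_pi_pos (fun p => ‖𝓕 (windowProd h g x) p‖ₑ ^ 2),
      lintegral_fourier_sq (integrable_windowProd hh hg x)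
        (memLp_two_of_lintegral (measurable_windowProd hm gm x).aestronglyMeasurable hx)]
  · exact ENNReal.ofReal_ne_top

theorem lintegral_windowCoeff_univ (hm : Measurable h) (gm : Measurable g) (hh : MemLp h 2 volume)
    (hg : MemLp g 2 volume) :
    ∫⁻ z, ‖windowCoeff h g z‖ₑ ^ 2 = ENNReal.ofReal ((2 * Real.pi) ^ d) *
      ((∫⁻ x, ‖h x‖ₑ ^ 2) * ∫⁻ y, ‖g y‖ₑ ^ 2) := by
  have := lintegral_windowCoeff hm gm hh hg Set.univ
  rw [Set.univ_prod_univ, Measure.restrict_univ, ← lintegral_windowProd hm gm,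
    Measure.restrict_univ, lintegral_windowProd_univ hm gm] at this
  exact this

theorem windowCoeff_congr_ae {g' : E d → ℂ} (hg : g =ᵐ[volume] g') (z : E d × E d) :
    windowCoeff h g z = windowCoeff h g' z := by
  refine integral_congr_ae ?_
  filter_upwards [hg] with y hy
  rw [hy]

theorem integrable_windowCoeff_integrand (hh : MemLp h 2 volume)
    (hg : MemLp g 2 volume) (z : E d × E d) :
    Integrable fun y => (starRingEnd ℂ)
      (Complex.exp (Complex.I * (inner ℝ z.2 (y - z.1) : ℝ)) * h (y - z.1)) * g y := by
  have h1 := (integrable_windowProd hh hg z.1).bdd_mul (c := 1)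
    (f := fun y => (starRingEnd ℂ) (Complex.exp (Complex.I * (inner ℝ z.2 (y - z.1) : ℝ))))
    (Continuous.aestronglyMeasurable (Complex.continuous_conj.comp (by fun_prop)))
    (ae_of_all _ fun y => by
      rw [RCLike.norm_conj, mul_comm, Complex.norm_exp_ofReal_mul_I])
  refine h1.congr (ae_of_all _ fun y => ?_)
  simp only [windowProd, map_mul, mul_assoc]

theorem windowCoeff_add {g' : E d → ℂ} (hh : MemLp h 2 volume)
    (hg : MemLp g 2 volume) (hg' : MemLp g' 2 volume) (z : E d × E d) :
    windowCoeff h (g + g') z = windowCoeff h g z + windowCoeff h g' z := by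
  rw [windowCoeff, windowCoeff, windowCoeff, ← integral_add
    (integrable_windowCoeff_integrand hh hg z) (integrable_windowCoeff_integrand hh hg' z)]
  simp only [Pi.add_apply, mul_add]

theorem windowCoeff_smul (c : ℂ) (z : E d × E d) :
    windowCoeff h (c • g) z = c * windowCoeff h g z := by
  rw [windowCoeff, windowCoeff, ← integral_const_mul]
  simp only [Pi.smul_apply, smul_eq_mul, mul_left_comm]

end Coefficients

/-! ### The coefficient operator -/

section CoeffOp

variable {d : ℕ} {h : E d → ℂ}

theorem lintegral_const_windowCoeff (S : Set (E d × E d)) (g : E d → ℂ) :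
    ∫⁻ z in S, ‖(((2 * Real.pi) ^ (-(d : ℝ) / 2) : ℝ) : ℂ) * windowCoeff h g z‖ₑ ^ 2 =
      ENNReal.ofReal ((2 * Real.pi) ^ (-(d : ℝ))) * ∫⁻ z in S, ‖windowCoeff h g z‖ₑ ^ 2 := by
  rw [← lintegral_const_mul' _ _ ENNReal.ofReal_ne_top]
  refine lintegral_congr fun z => ?_
  have hpos := Real.two_pi_pos
  rw [enorm_mul, mul_pow, ← ofReal_norm, Complex.norm_real, Real.norm_of_nonneg (by positivity),
    ← ENNReal.ofReal_pow (by positivity), ← Real.rpow_natCast, ← Real.rpow_mul hpos.le]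
  congr 3
  push_cast
  ring

theorem ofReal_two_pi_rpow_mul :
    ENNReal.ofReal ((2 * Real.pi) ^ (-(d : ℝ))) * ENNReal.ofReal ((2 * Real.pi) ^ d) = 1 := by
  have hpos := Real.two_pi_pos
  rw [← ENNReal.ofReal_mul (by positivity), Real.rpow_neg hpos.le, Real.rpow_natCast,
    inv_mul_cancel₀ (by positivity), ENNReal.ofReal_one]

theorem memLp_coeff (hm : Measurable h) (hh : MemLp h 2 volume) (S : Set (E d × E d)) (g : L2 d) :
    MemLp (fun z => (((2 * Real.pi) ^ (-(d : ℝ) / 2) : ℝ) : ℂ) * windowCoeff h g z) 2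
      (volume.restrict S) := by
  have gm : Measurable g := (Lp.stronglyMeasurable g).measurable
  refine memLp_two_of_lintegral
    ((measurable_windowCoeff hm gm).measurable.const_mul _).aestronglyMeasurable ?_
  rw [lintegral_const_windowCoeff]
  refine ENNReal.mul_lt_top ENNReal.ofReal_lt_top
    (lt_of_le_of_lt (setLIntegral_le_lintegral S _) ?_)
  rw [lintegral_windowCoeff_univ hm gm hh (Lp.memLp g), ← enorm_toLp_sq hh,
    ← enorm_Lp_sq g]
  finiteness

theorem enorm_coeff_toLp_sq (hm : Measurable h) (hh : MemLp h 2 volume) (S : Set (E d × E d))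
    (g : L2 d) : ‖(memLp_coeff hm hh S g).toLp _‖ₑ ^ 2 =
      ENNReal.ofReal ((2 * Real.pi) ^ (-(d : ℝ))) * ∫⁻ z in S, ‖windowCoeff h g z‖ₑ ^ 2 := by
  rw [enorm_toLp_sq, lintegral_const_windowCoeff]

theorem norm_le_of_enorm_sq_le {F : Type*} [SeminormedAddCommGroup F] {a : F} {b : ℝ} (hb : 0 ≤ b)
    (h : ‖a‖ₑ ^ 2 ≤ ENNReal.ofReal (b ^ 2)) : ‖a‖ ≤ b := by
  rw [ENNReal.ofReal_pow hb] at h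
  have h2 := (ENNReal.pow_le_pow_left_iff two_ne_zero).1 h
  rw [← ofReal_norm] at h2
  exact (ENNReal.ofReal_le_ofReal_iff hb).1 h2

theorem ofReal_norm_sq {F : Type*} [SeminormedAddCommGroup F] (a : F) :
    ENNReal.ofReal (‖a‖ ^ 2) = ‖a‖ₑ ^ 2 := by
  rw [ENNReal.ofReal_pow (norm_nonneg _), ofReal_norm]

theorem norm_coeff_toLp_le (hm : Measurable h) (hh : MemLp h 2 volume) (S : Set (E d × E d))
    (g : L2 d) : ‖(memLp_coeff hm hh S g).toLp _‖ ≤ ‖hh.toLp h‖ * ‖g‖ := by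
  have gm : Measurable g := (Lp.stronglyMeasurable g).measurable
  have h1 : ‖(memLp_coeff hm hh S g).toLp _‖ₑ ^ 2 ≤ (‖hh.toLp h‖ₑ * ‖g‖ₑ) ^ 2 := by
    rw [enorm_coeff_toLp_sq hm hh S g, mul_pow, enorm_toLp_sq hh, enorm_Lp_sq g]
    calc _ ≤ ENNReal.ofReal ((2 * Real.pi) ^ (-(d : ℝ))) * ∫⁻ z, ‖windowCoeff h g z‖ₑ ^ 2 := by
          gcongr; exact Measure.restrict_le_self
      _ = _ := by
          rw [lintegral_windowCoeff_univ hm gm hh (Lp.memLp g), ← mul_assoc,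
            ofReal_two_pi_rpow_mul, one_mul]
  refine norm_le_of_enorm_sq_le (by positivity) (h1.trans_eq ?_)
  rw [mul_pow, mul_pow, ENNReal.ofReal_mul (by positivity), ofReal_norm_sq, ofReal_norm_sq]

/-- The operator `g ↦ (2π)^{-d/2} ⟨h_{x,p}, g⟩` from `L²(ℝᵈ)` to `L²(S)`, for a set `S` of phase
space points `(x, p)`. -/
def coeffOp (hm : Measurable h) (hh : MemLp h 2 volume) (S : Set (E d × E d)) :
    L2 d →L[ℂ] Lp ℂ 2 (volume.restrict S) :=
  LinearMap.mkContinuous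
    { toFun := fun g => (memLp_coeff hm hh S g).toLp _
      map_add' := by
        intro g g'
        rw [← MemLp.toLp_add]
        refine MemLp.toLp_congr _ _ (ae_of_all _ fun z => ?_)
        simp only [Pi.add_apply]
        rw [← mul_add, ← windowCoeff_add hh (Lp.memLp g) (Lp.memLp g'),
          windowCoeff_congr_ae (Lp.coeFn_add g g')]
      map_smul' := by
        intro c g
        rw [← MemLp.toLp_const_smul]
        refine MemLp.toLp_congr _ _ (ae_of_all _ fun z => ?_)
        simp only [RingHom.id_apply, Pi.smul_apply, smul_eq_mul]
        rw [windowCoeff_congr_ae (Lp.coeFn_smul c g), windowCoeff_smul]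
        ring }
    ‖hh.toLp h‖ (norm_coeff_toLp_le hm hh S)

variable (hm : Measurable h) (hh : MemLp h 2 volume)

theorem coeFn_coeffOp (S : Set (E d × E d)) (g : L2 d) :
    coeffOp hm hh S g =ᵐ[volume.restrict S]
      fun z => (((2 * Real.pi) ^ (-(d : ℝ) / 2) : ℝ) : ℂ) * windowCoeff h g z :=
  (memLp_coeff hm hh S g).coeFn_toLp

theorem enorm_coeffOp_sq (S : Set (E d × E d)) (g : L2 d) : ‖coeffOp hm hh S g‖ₑ ^ 2 =
      ENNReal.ofReal ((2 * Real.pi) ^ (-(d : ℝ))) * ∫⁻ z in S, ‖windowCoeff h g z‖ₑ ^ 2 :=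
  enorm_coeff_toLp_sq hm hh S g

theorem norm_coeffOp_le (S : Set (E d × E d)) (g : L2 d) :
    ‖coeffOp hm hh S g‖ ≤ ‖hh.toLp h‖ * ‖g‖ :=
  norm_coeff_toLp_le hm hh S g

/-- Moyal's identity. -/
theorem norm_coeffOp_univ (g : L2 d) : ‖coeffOp hm hh Set.univ g‖ = ‖hh.toLp h‖ * ‖g‖ := by
  have gm : Measurable g := (Lp.stronglyMeasurable g).measurable
  have h1 : ‖coeffOp hm hh Set.univ g‖ₑ ^ 2 = (‖hh.toLp h‖ₑ * ‖g‖ₑ) ^ 2 := by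
    rw [enorm_coeffOp_sq, mul_pow, enorm_toLp_sq hh, enorm_Lp_sq g, Measure.restrict_univ,
      lintegral_windowCoeff_univ hm gm hh (Lp.memLp g), ← mul_assoc,
            ofReal_two_pi_rpow_mul, one_mul]
  refine le_antisymm (norm_coeffOp_le hm hh _ g) ?_
  rw [← ofReal_norm_sq, ← ofReal_norm, ← ofReal_norm, ← ENNReal.ofReal_mul (norm_nonneg _),
    ← ENNReal.ofReal_pow (by positivity)] at h1
  rw [ENNReal.ofReal_eq_ofReal_iff (by positivity) (by positivity)] at h1
  exact ((sq_eq_sq₀ (by positivity) (by positivity)).1 h1).ge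

theorem inner_coeffOp (S : Set (E d × E d)) (φ ψ : L2 d) :
    inner ℂ (coeffOp hm hh S φ) (coeffOp hm hh S ψ) =
      (((2 * Real.pi) ^ (-(d : ℝ)) : ℝ) : ℂ) *
        ∫ z in S, (starRingEnd ℂ) (windowCoeff h φ z) * windowCoeff h ψ z := by
  rw [L2.inner_def, ← integral_const_mul]
  refine integral_congr_ae ?_
  filter_upwards [coeFn_coeffOp hm hh S φ, coeFn_coeffOp hm hh S ψ] with z h1 h2
  rw [h1, h2, RCLike.inner_apply, map_mul, Complex.conj_ofReal]
  have hpos := Real.two_pi_pos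
  have : (2 * Real.pi) ^ (-(d : ℝ)) =
      (2 * Real.pi) ^ (-(d : ℝ) / 2) * (2 * Real.pi) ^ (-(d : ℝ) / 2) := by
    rw [← Real.rpow_add hpos]; congr 1; ring
  rw [this]
  push_cast
  ring

theorem integrableOn_conj_windowCoeff_mul (hm : Measurable h) (hh : MemLp h 2 volume)
    (S : Set (E d × E d)) (φ ψ : L2 d) :
    IntegrableOn (fun z => (starRingEnd ℂ) (windowCoeff h φ z) * windowCoeff h ψ z) S := by
  have key : ∀ g : L2 d, MemLp (windowCoeff h g) 2 (volume.restrict S) := by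
    intro g
    have h1 := (memLp_coeff hm hh S g).const_mul ((((2 * Real.pi) ^ (-(d : ℝ) / 2) : ℝ) : ℂ)⁻¹)
    refine h1.ae_eq (ae_of_all _ fun z => ?_)
    have hpos := Real.two_pi_pos
    have : (((2 * Real.pi) ^ (-(d : ℝ) / 2) : ℝ) : ℂ) ≠ 0 := by
      exact_mod_cast (Real.rpow_pos_of_pos hpos _).ne'
    exact inv_mul_cancel_left₀ this _
  exact ((key φ).star).integrable_mul (key ψ)

theorem inner_coeffOp_add_compl {S : Set (E d × E d)} (hS : MeasurableSet S) (φ ψ : L2 d) :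
    inner ℂ (coeffOp hm hh S φ) (coeffOp hm hh S ψ) +
      inner ℂ (coeffOp hm hh Sᶜ φ) (coeffOp hm hh Sᶜ ψ) =
      (inner ℂ (coeffOp hm hh Set.univ φ) (coeffOp hm hh Set.univ ψ) : ℂ) := by
  simp only [inner_coeffOp]
  rw [← mul_add, integral_add_compl hS, Measure.restrict_univ]
  have := integrableOn_conj_windowCoeff_mul hm hh Set.univ φ ψ
  rwa [integrableOn_univ] at this

theorem norm_coeffOp_mono {S T : Set (E d × E d)} (hST : S ⊆ T) (g : L2 d) :
    ‖coeffOp hm hh S g‖ ≤ ‖coeffOp hm hh T g‖ := by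
  refine norm_le_of_enorm_sq_le (norm_nonneg _) ?_
  rw [ofReal_norm_sq, enorm_coeffOp_sq, enorm_coeffOp_sq]
  gcongr

theorem enorm_coeffOp_union_sq_le (S T : Set (E d × E d)) (g : L2 d) :
    ‖coeffOp hm hh (S ∪ T) g‖ₑ ^ 2 ≤ ‖coeffOp hm hh S g‖ₑ ^ 2 + ‖coeffOp hm hh T g‖ₑ ^ 2 := by
  simp only [enorm_coeffOp_sq]
  rw [← mul_add]
  gcongr
  exact lintegral_union_le _ _ _

theorem norm_coeffOp_union_le (S T : Set (E d × E d)) (g : L2 d) :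
    ‖coeffOp hm hh (S ∪ T) g‖ ≤ ‖coeffOp hm hh S g‖ + ‖coeffOp hm hh T g‖ := by
  refine norm_le_of_enorm_sq_le (by positivity) ((enorm_coeffOp_union_sq_le hm hh S T g).trans ?_)
  rw [← ofReal_norm_sq, ← ofReal_norm_sq, ← ENNReal.ofReal_add (by positivity) (by positivity)]
  refine ENNReal.ofReal_le_ofReal ?_
  nlinarith [mul_nonneg (norm_nonneg (coeffOp hm hh S g)) (norm_nonneg (coeffOp hm hh T g))]

theorem norm_coeffOp_iUnion_le {ι : Type*} (s : Finset ι) (S : ι → Set (E d × E d)) (g : L2 d) :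
    ‖coeffOp hm hh (⋃ i ∈ s, S i) g‖ ≤ ∑ i ∈ s, ‖coeffOp hm hh (S i) g‖ := by
  classical
  induction s using Finset.induction_on with
  | empty =>
    refine norm_le_of_enorm_sq_le (by simp) ?_
    rw [enorm_coeffOp_sq]
    simp
  | insert i s hi ih =>
    rw [Finset.set_biUnion_insert, Finset.sum_insert hi]
    exact (norm_coeffOp_union_le hm hh _ _ g).trans (add_le_add le_rfl ih)

/-! ### The observables -/

section Observable

variable {η : E d → ℂ} {δ : ℝ}

/-- The observable `P_δ(S)` is `L_S† L_S`. -/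
theorem inner_observable (hm : Measurable (rescale η δ))
    (hh : MemLp (rescale η δ) 2 volume) (S : Set (E d × E d)) (φ ψ : L2 d) :
    inner ℂ φ (observable η δ S ψ) = (inner ℂ (coeffOp hm hh S φ) (coeffOp hm hh S ψ) : ℂ) := by
  have hex : ∃ T, IsObservable η δ S T := by
    refine ⟨ContinuousLinearMap.adjoint (coeffOp hm hh S) ∘L coeffOp hm hh S, fun φ ψ => ⟨?_, ?_⟩⟩
    · exact integrableOn_conj_windowCoeff_mul hm hh S φ ψ
    · rw [ContinuousLinearMap.comp_apply, ContinuousLinearMap.adjoint_inner_right, inner_coeffOp]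
      rfl
  have h1 : IsObservable η δ S (observable η δ S) := by
    rw [observable, dif_pos hex]
    exact hex.choose_spec
  rw [(h1 φ ψ).2, inner_coeffOp]
  rfl

theorem norm_observable_le (hm : Measurable (rescale η δ))
    (hh : MemLp (rescale η δ) 2 volume) (h1 : ‖hh.toLp (rescale η δ)‖ ≤ 1)
    (S : Set (E d × E d)) (ψ : L2 d) :
    ‖observable η δ S ψ‖ ≤ ‖coeffOp hm hh S ψ‖ := by
  set φ := observable η δ S ψ with hφ
  have h2 : ‖φ‖ * ‖φ‖ ≤ ‖φ‖ * ‖coeffOp hm hh S ψ‖ := by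
    calc ‖φ‖ * ‖φ‖ = ‖(inner ℂ φ φ : ℂ)‖ := by
          rw [inner_self_eq_norm_sq_to_K]; simp [sq]
      _ = ‖(inner ℂ (coeffOp hm hh S φ) (coeffOp hm hh S ψ) : ℂ)‖ := by
          conv_lhs => rw [hφ]
          rw [← hφ, inner_observable hm hh]
      _ ≤ ‖coeffOp hm hh S φ‖ * ‖coeffOp hm hh S ψ‖ := norm_inner_le_norm _ _
      _ ≤ ‖φ‖ * ‖coeffOp hm hh S ψ‖ := by
          gcongr
          refine (norm_coeffOp_le hm hh S φ).trans ?_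
          exact mul_le_of_le_one_left (norm_nonneg _) h1
  rcases (norm_nonneg φ).eq_or_lt with h0 | h0
  · rw [← h0]; exact norm_nonneg _
  · exact le_of_mul_le_mul_left h2 h0

end Observable

end CoeffOp

/-! ### Non-stationary phase for the free evolution -/

section Decay

open FourierTransform LineDeriv

variable {d : ℕ}

/-- The free evolution at time `τ` of the function with Fourier transform `F`. -/
def freeWave (τ : ℝ) (F : E d → ℂ) : E d → ℂ :=
  𝓕⁻ fun ξ => Complex.exp (-Complex.I * (τ * symbol d ξ : ℝ)) * F ξ

/-- `F` is smooth and compactly supported in the band `|2π⟨ξ, u⟩| ≤ κ/2`. -/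
structure IsBand (u : E d) (κ : ℝ) (F : E d → ℂ) : Prop where
  contDiff : ContDiff ℝ ((⊤ : ℕ∞) : WithTop ℕ∞) F
  compact : HasCompactSupport F
  supp : tsupport F ⊆ {ξ | |2 * Real.pi * inner ℝ ξ u| ≤ κ / 2}

/-- `(2π⟨ξ, u⟩/κ)ʲ F(ξ)`: the normalized momentum operator in the direction `u`, applied `j` times
on the Fourier side. -/
def momPow (u : E d) (κ : ℝ) (F : E d → ℂ) (j : ℕ) (ξ : E d) : ℂ :=
  ((2 * Real.pi * inner ℝ ξ u / κ : ℝ) : ℂ) ^ j * F ξ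

/-- The position operator `⟨y, u⟩` on the Fourier side, where it is `(i/2π) ∂_u`. -/
def posOp (u : E d) (F : E d → ℂ) (ξ : E d) : ℂ := Complex.I / (2 * Real.pi) * fderiv ℝ F ξ u

variable {u : E d} {κ : ℝ} {F : E d → ℂ}

theorem IsBand.isBand_momPow (h : IsBand u κ F) (j : ℕ) : IsBand u κ (momPow u κ F j) := by
  have hts : tsupport (momPow u κ F j) ⊆ tsupport F := tsupport_mul_subset_right
  refine ⟨?_, h.compact.mono' (subset_trans subset_closure hts), hts.trans h.supp⟩
  have h1 : ContDiff ℝ ((⊤ : ℕ∞) : WithTop ℕ∞)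
      fun ξ : E d => ((2 * Real.pi * inner ℝ ξ u / κ : ℝ) : ℂ) :=
    Complex.ofRealCLM.contDiff.comp
      ((contDiff_const.mul (contDiff_id.inner ℝ contDiff_const)).div_const κ)
  exact (h1.pow j).mul h.contDiff

theorem IsBand.isBand_posOp (h : IsBand u κ F) : IsBand u κ (posOp u F) := by
  have hts : tsupport (posOp u F) ⊆ tsupport F :=
    tsupport_mul_subset_right.trans (tsupport_fderiv_apply_subset ℝ u)
  refine ⟨?_, h.compact.mono' (subset_trans subset_closure hts), hts.trans h.supp⟩
  have h1 : ContDiff ℝ ((⊤ : ℕ∞) : WithTop ℕ∞) (fderiv ℝ F) :=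
    h.contDiff.fderiv_right (by simp)
  exact contDiff_const.mul (h1.clm_apply contDiff_const)

theorem contDiff_phase (τ : ℝ) : ContDiff ℝ ((⊤ : ℕ∞) : WithTop ℕ∞)
    fun ξ : E d => Complex.exp (-Complex.I * (τ * symbol d ξ : ℝ)) := by
  have h1 : ContDiff ℝ ((⊤ : ℕ∞) : WithTop ℕ∞) fun ξ : E d => τ * symbol d ξ := by
    unfold symbol
    exact contDiff_const.mul (contDiff_const.mul (contDiff_norm_sq ℝ))
  have h2 : ContDiff ℝ ((⊤ : ℕ∞) : WithTop ℕ∞)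
      fun ξ : E d => Complex.ofRealCLM (τ * symbol d ξ) := Complex.ofRealCLM.contDiff.comp h1
  exact (contDiff_const.mul h2).cexp

theorem IsBand.phase_contDiff (h : IsBand u κ F) (τ : ℝ) : ContDiff ℝ ((⊤ : ℕ∞) : WithTop ℕ∞)
    fun ξ : E d => Complex.exp (-Complex.I * (τ * symbol d ξ : ℝ)) * F ξ :=
  (contDiff_phase τ).mul h.contDiff

theorem IsBand.phase_compact (h : IsBand u κ F) (τ : ℝ) : HasCompactSupport
    fun ξ : E d => Complex.exp (-Complex.I * (τ * symbol d ξ : ℝ)) * F ξ :=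
  h.compact.mul_left

theorem IsBand.phase_integrable (h : IsBand u κ F) (τ : ℝ) : Integrable
    fun ξ : E d => Complex.exp (-Complex.I * (τ * symbol d ξ : ℝ)) * F ξ :=
  (h.phase_contDiff τ).continuous.integrable_of_hasCompactSupport (h.phase_compact τ)

theorem IsBand.memLp (h : IsBand u κ F) : MemLp F 2 volume :=
  h.contDiff.continuous.memLp_of_hasCompactSupport h.compact

theorem IsBand.phase_memLp (h : IsBand u κ F) (τ : ℝ) : MemLp
    (fun ξ : E d => Complex.exp (-Complex.I * (τ * symbol d ξ : ℝ)) * F ξ) 2 volume :=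
  (h.phase_contDiff τ).continuous.memLp_of_hasCompactSupport (h.phase_compact τ)

theorem IsBand.continuous_freeWave (h : IsBand u κ F) (τ : ℝ) : Continuous (freeWave τ F) := by
  have h1 := continuous_fourier (h.phase_integrable τ)
  have h2 : freeWave τ F = fun y => 𝓕 (fun ξ : E d =>
      Complex.exp (-Complex.I * (τ * symbol d ξ : ℝ)) * F ξ) (-y) := by
    funext y
    exact Real.fourierInv_eq_fourier_neg _ y
  rw [h2]
  exact h1.comp continuous_neg

theorem IsBand.lintegral_freeWave (h : IsBand u κ F) (τ : ℝ) :
    ∫⁻ y, ‖freeWave τ F y‖ₑ ^ 2 = ∫⁻ ξ, ‖F ξ‖ₑ ^ 2 := by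
  have h1 := lintegral_fourier_sq (h.phase_integrable τ) (h.phase_memLp τ)
  have h2 : ∀ y, freeWave τ F y = 𝓕 (fun ξ : E d =>
      Complex.exp (-Complex.I * (τ * symbol d ξ : ℝ)) * F ξ) (-y) := fun y =>
    Real.fourierInv_eq_fourier_neg _ y
  simp only [h2]
  rw [lintegral_neg_eq_self (fun y => ‖𝓕 (fun ξ : E d =>
      Complex.exp (-Complex.I * (τ * symbol d ξ : ℝ)) * F ξ) y‖ₑ ^ 2), h1]
  refine lintegral_congr fun ξ => ?_
  rw [enorm_mul, ← ofReal_norm (Complex.exp _), norm_phase]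
  simp

theorem IsBand.eLpNorm_freeWave (h : IsBand u κ F) (τ : ℝ) :
    eLpNorm (freeWave τ F) 2 volume = eLpNorm F 2 volume := by
  have e1 := eLpNorm_nnreal_pow_eq_lintegral (f := freeWave τ F) (μ := volume) (p := 2) two_ne_zero
  have e2 := eLpNorm_nnreal_pow_eq_lintegral (f := F) (μ := volume) (p := 2) two_ne_zero
  have h3 : eLpNorm (freeWave τ F) 2 volume ^ 2 = eLpNorm F 2 volume ^ 2 := by
    have := h.lintegral_freeWave τ
    calc _ = ∫⁻ y, ‖freeWave τ F y‖ₑ ^ 2 := by simpa using e1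
      _ = _ := this
      _ = _ := by simpa using e2.symm
  exact (ENNReal.pow_right_strictMono two_ne_zero).injective h3

theorem freeWave_const_mul (τ : ℝ) (c : ℂ) (F : E d → ℂ) (y : E d) :
    freeWave τ (fun ξ => c * F ξ) y = c * freeWave τ F y := by
  simp only [freeWave, Real.fourierInv_eq', smul_eq_mul]
  rw [← integral_const_mul]
  refine integral_congr_ae (ae_of_all _ fun ξ => ?_)
  simp only
  ring

theorem IsBand.freeWave_add {G : E d → ℂ} (h : IsBand u κ F) (hG : IsBand u κ G) (τ : ℝ)
    (y : E d) : freeWave τ (fun ξ => F ξ + G ξ) y = freeWave τ F y + freeWave τ G y := by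
  have key : ∀ F, IsBand u κ F → Integrable fun ξ : E d =>
      Complex.exp (↑(2 * Real.pi * inner ℝ ξ y) * Complex.I) *
        (Complex.exp (-Complex.I * (τ * symbol d ξ : ℝ)) * F ξ) := by
    intro F h
    have h1 := (h.phase_integrable τ).bdd_mul (c := 1)
      (f := fun ξ => Complex.exp (↑(2 * Real.pi * inner ℝ ξ y) * Complex.I))
      (Continuous.aestronglyMeasurable (by fun_prop))
      (ae_of_all _ fun ξ => by rw [Complex.norm_exp_ofReal_mul_I])
    exact h1
  simp only [freeWave, Real.fourierInv_eq', smul_eq_mul]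
  rw [← integral_add (key F h) (key G hG)]
  refine integral_congr_ae (ae_of_all _ fun ξ => ?_)
  simp only
  ring

theorem hasFDerivAt_symbol (ξ : E d) :
    HasFDerivAt (symbol d) ((2 * Real.pi) ^ 2 • (2 • innerSL ℝ ξ)) ξ := by
  have := (hasStrictFDerivAt_norm_sq ξ).hasFDerivAt.const_mul ((2 * Real.pi) ^ 2)
  exact this

/-- The commutation relation `A e^{-iτH₀} = e^{-iτH₀} (A + 2τB)` between position `A` and momentum
`B` in the direction `u`, on the Fourier side. -/
theorem IsBand.inner_mul_freeWave (h : IsBand u κ F) (τ : ℝ) (y : E d) :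
    ((inner ℝ y u : ℝ) : ℂ) * freeWave τ F y =
      2 * τ * freeWave τ (fun ξ => ((2 * Real.pi * inner ℝ ξ u : ℝ) : ℂ) * F ξ) y +
        freeWave τ (posOp u F) y := by
  have hbF : IsBand u κ (fun ξ => ((2 * Real.pi * inner ℝ ξ u : ℝ) : ℂ) * F ξ) := by
    have hts : tsupport (fun ξ => ((2 * Real.pi * inner ℝ ξ u : ℝ) : ℂ) * F ξ) ⊆ tsupport F :=
      tsupport_mul_subset_right
    refine ⟨?_, h.compact.mono' (subset_trans subset_closure hts), hts.trans h.supp⟩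
    have h1 : ContDiff ℝ ((⊤ : ℕ∞) : WithTop ℕ∞)
        fun ξ : E d => ((2 * Real.pi * inner ℝ ξ u : ℝ) : ℂ) :=
      Complex.ofRealCLM.contDiff.comp (contDiff_const.mul (contDiff_id.inner ℝ contDiff_const))
    exact h1.mul h.contDiff
  have h2bF : IsBand u κ (fun ξ => (2 * τ : ℂ) * (((2 * Real.pi * inner ℝ ξ u : ℝ) : ℂ) * F ξ)) :=
    ⟨contDiff_const.mul hbF.contDiff, hbF.compact.mul_left,
      tsupport_mul_subset_right.trans hbF.supp⟩
  rw [← freeWave_const_mul τ (2 * τ : ℂ), ← h2bF.freeWave_add h.isBand_posOp]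
  let G : 𝓢(E d, ℂ) := (h.phase_compact τ).toSchwartzMap (h.phase_contDiff τ)
  have hG : ∀ ξ, G ξ = Complex.exp (-Complex.I * (τ * symbol d ξ : ℝ)) * F ξ := fun ξ => rfl
  have hder : ∀ ξ, (∂_{u} G) ξ = -(2 * Real.pi * Complex.I) *
      (Complex.exp (-Complex.I * (τ * symbol d ξ : ℝ)) *
        ((2 * τ : ℂ) * (((2 * Real.pi * inner ℝ ξ u : ℝ) : ℂ) * F ξ) + posOp u F ξ)) := by
    intro ξ
    rw [SchwartzMap.lineDerivOp_apply_eq_fderiv]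
    have e1 : HasFDerivAt F (fderiv ℝ F ξ) ξ :=
      (h.contDiff.differentiable (by simp)).differentiableAt.hasFDerivAt
    have e2 : HasFDerivAt (fun ξ : E d => -Complex.I * ((τ * symbol d ξ : ℝ) : ℂ))
        (-Complex.I • (Complex.ofRealCLM ∘L (τ • ((2 * Real.pi) ^ 2 • (2 • innerSL ℝ ξ))))) ξ :=
      ((Complex.ofRealCLM.hasFDerivAt (x := τ * symbol d ξ)).comp ξ
        ((hasFDerivAt_symbol ξ).const_mul τ)).const_mul (-Complex.I)
    have e3 := (e2.cexp.mul e1).fderiv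
    have e4 : fderiv ℝ (G : E d → ℂ) ξ = fderiv ℝ (fun ξ : E d =>
      Complex.exp (-Complex.I * (τ * symbol d ξ : ℝ)) * F ξ) ξ := rfl
    rw [e4]
    refine (congrArg (fun L : E d →L[ℝ] ℂ => L u) e3).trans ?_
    simp only [add_apply, smul_apply,
      ContinuousLinearMap.comp_apply, innerSL_apply_apply, Complex.ofRealCLM_apply, posOp,
      smul_eq_mul]
    have hpi : (Real.pi : ℂ) ≠ 0 := by exact_mod_cast Real.pi_ne_zero
    have hI : Complex.I ^ 2 = -1 := Complex.I_sq
    push_cast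
    field_simp
    simp only [nsmul_eq_mul]
    push_cast
    ring_nf
    simp only [hI]
    ring
  have hinv := SchwartzMap.fourierInv_lineDerivOp_eq G u
  have hinv' := congrArg (fun f : 𝓢(E d, ℂ) => f y) hinv
  have htg : (fun x : E d => inner ℝ x u).HasTemperateGrowth := by fun_prop
  have e5 : (𝓕⁻ (∂_{u} G)) y = -(2 * Real.pi * Complex.I) * freeWave τ (fun ξ =>
        ((2 * τ : ℂ) * (((2 * Real.pi * inner ℝ ξ u : ℝ) : ℂ) * F ξ) + posOp u F ξ)) y := by
    rw [SchwartzMap.fourierInv_coe, ← freeWave_const_mul τ]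
    unfold freeWave
    refine congrArg (fun f : E d → ℂ => 𝓕⁻ f y) (funext fun ξ => ?_)
    rw [hder]
    ring
  have e6 : (𝓕⁻ G) y = freeWave τ F y := by
    rw [SchwartzMap.fourierInv_coe]; rfl
  have hpi : (2 * Real.pi * Complex.I : ℂ) ≠ 0 := Complex.two_pi_I_ne_zero
  rw [e5] at hinv'
  have e7 : (-(2 * Real.pi * Complex.I) • SchwartzMap.smulLeftCLM ℂ (fun x : E d => inner ℝ x u) (𝓕⁻ G)) y
      = -(2 * Real.pi * Complex.I) * (((inner ℝ y u : ℝ) : ℂ) * freeWave τ F y) := by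
    rw [smul_apply, SchwartzMap.smulLeftCLM_apply_apply htg, e6, smul_eq_mul,
      Complex.real_smul]
  rw [e7] at hinv'
  exact (mul_left_cancel₀ (neg_ne_zero.2 hpi) hinv').symm

end Decay

section Decay

open FourierTransform

variable {d : ℕ} {u : E d} {κ : ℝ} {F : E d → ℂ}

/-- The region that a wave packet with momentum in the band `|2π⟨ξ, u⟩| ≤ κ/2` cannot classically
reach by time `τ`, from near the origin. -/
def forbidden (u : E d) (κ ρ τ : ℝ) : Set (E d) := {y | ρ + 2 * κ * |τ| ≤ |inner ℝ y u|}

theorem momPow_zero : momPow u κ F 0 = F := by funext ξ; simp [momPow]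

theorem momPow_momPow_one (j : ℕ) : momPow u κ (momPow u κ F j) 1 = momPow u κ F (j + 1) := by
  funext ξ
  simp only [momPow, pow_succ, pow_zero, one_mul]
  ring

/-- The commutator of position with a power of momentum. -/
theorem IsBand.posOp_momPow (h : IsBand u κ F) (j : ℕ) (ξ : E d) :
    posOp u (momPow u κ F j) ξ = momPow u κ (posOp u F) j ξ +
      (j * (Complex.I * ((‖u‖ ^ 2 / κ : ℝ) : ℂ))) * momPow u κ F (j - 1) ξ := by
  have e1 : HasFDerivAt F (fderiv ℝ F ξ) ξ :=
    (h.contDiff.differentiable (by simp)).differentiableAt.hasFDerivAt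
  have e2 : HasFDerivAt (fun ξ : E d => ((2 * Real.pi / κ * inner ℝ u ξ : ℝ) : ℂ))
      (Complex.ofRealCLM ∘L ((2 * Real.pi / κ) • innerSL ℝ u)) ξ :=
    (Complex.ofRealCLM.hasFDerivAt (x := 2 * Real.pi / κ * inner ℝ u ξ)).comp ξ
      ((innerSL ℝ u).hasFDerivAt.const_mul (2 * Real.pi / κ))
  have e3 := ((e2.pow j).mul e1).fderiv
  have e4 : momPow u κ F j = fun ξ => ((2 * Real.pi / κ * inner ℝ u ξ : ℝ) : ℂ) ^ j * F ξ := by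
    funext ξ
    rw [momPow, real_inner_comm]
    congr 3
    ring
  rw [posOp, e4]
  have e5 := congrArg (fun L : E d →L[ℝ] ℂ => L u) e3
  have e6 : (fderiv ℝ (fun ξ => ((2 * Real.pi / κ * inner ℝ u ξ : ℝ) : ℂ) ^ j * F ξ) ξ) u = _ := e5
  rw [e6]
  have hpi : (Real.pi : ℂ) ≠ 0 := by exact_mod_cast Real.pi_ne_zero
  have e7 : (2 * Real.pi * inner ℝ ξ u / κ : ℝ) = 2 * Real.pi / κ * inner ℝ u ξ := by
    rw [real_inner_comm]; ring
  simp only [add_apply, smul_apply, ContinuousLinearMap.comp_apply, innerSL_apply_apply,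
    Complex.ofRealCLM_apply, posOp, smul_eq_mul, momPow, e7, real_inner_self_eq_norm_sq,
    nsmul_eq_mul]
  push_cast
  field_simp

/-- In the forbidden region the commutation relation bounds a wave packet by its product with the
normalized momentum, which is at most `1/2`, up to a term with a factor of decay. -/
theorem norm_freeWave_le_of_mem_forbidden (h : IsBand u κ F) (hκ : 0 < κ) {ρ : ℝ} (hρ : 0 < ρ)
    (τ : ℝ) {y : E d} (hy : y ∈ forbidden u κ ρ τ) :
    ‖freeWave τ F y‖ ≤ ‖freeWave τ (momPow u κ F 1) y‖ +
      (ρ + 2 * κ * |τ|)⁻¹ * ‖freeWave τ (posOp u F) y‖ := by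
  have hR : 0 < ρ + 2 * κ * |τ| := by positivity
  have hy' : ρ + 2 * κ * |τ| ≤ |inner ℝ y u| := hy
  have h1 := h.inner_mul_freeWave τ y
  have h2 : freeWave τ (fun ξ => ((2 * Real.pi * inner ℝ ξ u : ℝ) : ℂ) * F ξ) y =
      κ * freeWave τ (momPow u κ F 1) y := by
    rw [← freeWave_const_mul]
    congr 1
    funext ξ
    have : (κ : ℂ) ≠ 0 := by exact_mod_cast hκ.ne'
    simp only [momPow, pow_one]
    push_cast
    field_simp
  rw [h2] at h1
  have h3 : |inner ℝ y u| * ‖freeWave τ F y‖ ≤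
      2 * |τ| * κ * ‖freeWave τ (momPow u κ F 1) y‖ + ‖freeWave τ (posOp u F) y‖ := by
    calc |inner ℝ y u| * ‖freeWave τ F y‖ = ‖((inner ℝ y u : ℝ) : ℂ) * freeWave τ F y‖ := by
          rw [norm_mul, Complex.norm_real, Real.norm_eq_abs]
      _ ≤ ‖2 * (τ : ℂ) * (κ * freeWave τ (momPow u κ F 1) y)‖ + ‖freeWave τ (posOp u F) y‖ := by
          rw [h1]; exact norm_add_le _ _
      _ = _ := by
          simp only [norm_mul, Complex.norm_real, Real.norm_eq_abs, abs_of_pos hκ]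
          norm_num
          ring
  have h4 : (ρ + 2 * κ * |τ|) * ‖freeWave τ F y‖ ≤
      (ρ + 2 * κ * |τ|) * ‖freeWave τ (momPow u κ F 1) y‖ + ‖freeWave τ (posOp u F) y‖ := by
    refine (mul_le_mul_of_nonneg_right hy' (norm_nonneg _)).trans (h3.trans ?_)
    gcongr
    nlinarith [abs_nonneg τ]
  rw [← mul_le_mul_iff_of_pos_left hR]
  refine h4.trans (le_of_eq ?_)
  field_simp

theorem eLpNorm_freeWave_le (h : IsBand u κ F) (hκ : 0 < κ) {ρ : ℝ} (hρ : 0 < ρ) (τ : ℝ) :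
    eLpNorm (freeWave τ F) 2 (volume.restrict (forbidden u κ ρ τ)) ≤
      eLpNorm (freeWave τ (momPow u κ F 1)) 2 (volume.restrict (forbidden u κ ρ τ)) +
      ENNReal.ofReal (ρ + 2 * κ * |τ|)⁻¹ *
        eLpNorm (freeWave τ (posOp u F)) 2 (volume.restrict (forbidden u κ ρ τ)) := by
  have hR : 0 < ρ + 2 * κ * |τ| := by positivity
  have hS : MeasurableSet (forbidden u κ ρ τ) :=
    measurableSet_le measurable_const (by fun_prop)
  have c1 := (h.isBand_momPow 1).continuous_freeWave τ
  have c2 := h.isBand_posOp.continuous_freeWave τ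
  calc eLpNorm (freeWave τ F) 2 (volume.restrict (forbidden u κ ρ τ))
      ≤ eLpNorm (fun y => ‖freeWave τ (momPow u κ F 1) y‖ +
          ‖(((ρ + 2 * κ * |τ|)⁻¹ : ℝ) • freeWave τ (posOp u F)) y‖) 2
          (volume.restrict (forbidden u κ ρ τ)) := by
        refine eLpNorm_mono_ae_real ?_
        filter_upwards [ae_restrict_mem hS] with y hy
        refine (norm_freeWave_le_of_mem_forbidden h hκ hρ τ hy).trans (le_of_eq ?_)
        rw [Pi.smul_apply, norm_smul, Real.norm_of_nonneg (by positivity)]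
    _ ≤ _ := by
        refine (eLpNorm_add_le (f := fun y => ‖freeWave τ (momPow u κ F 1) y‖) (g := fun y =>
          ‖(((ρ + 2 * κ * |τ|)⁻¹ : ℝ) • freeWave τ (posOp u F)) y‖)
          c1.norm.aestronglyMeasurable ?_ (by norm_num)).trans (le_of_eq ?_)
        · exact (c2.const_smul _).norm.aestronglyMeasurable
        · rw [eLpNorm_norm, eLpNorm_norm, eLpNorm_const_smul]
          congr 2
          rw [Real.enorm_eq_ofReal (by positivity)]

theorem IsBand.eLpNorm_momPow_le (h : IsBand u κ F) (hκ : 0 < κ) (j : ℕ) :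
    eLpNorm (momPow u κ F j) 2 volume ≤ ENNReal.ofReal ((1 / 2) ^ j) * eLpNorm F 2 volume := by
  refine eLpNorm_le_mul_eLpNorm_of_ae_le_mul (ae_of_all _ fun ξ => ?_) 2
  by_cases hξ : ξ ∈ tsupport F
  · have h1 : |2 * Real.pi * inner ℝ ξ u| ≤ κ / 2 := h.supp hξ
    rw [momPow, norm_mul, norm_pow, Complex.norm_real, Real.norm_eq_abs, abs_div, abs_of_pos hκ]
    refine mul_le_mul_of_nonneg_right (pow_le_pow_left₀ (by positivity) ?_ j) (norm_nonneg _)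
    rw [div_le_iff₀ hκ]
    linarith
  · simp [momPow, image_eq_zero_of_notMem_tsupport hξ]

theorem exists_bound_mul_pow {θ θ' : ℝ} (h0 : 0 < θ) (h1 : θ < θ') :
    ∃ K : ℝ, 0 ≤ K ∧ ∀ j : ℕ, j * θ ^ (j - 1) ≤ K * θ' ^ j := by
  have h2 : 0 < θ' := h0.trans h1
  have hlim := tendsto_pow_const_mul_const_pow_of_abs_lt_one 1 (r := θ / θ')
    (by rw [abs_of_pos (by positivity), div_lt_one h2]; exact h1)
  obtain ⟨K, hK⟩ := hlim.bddAbove_range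
  refine ⟨max K 0 / θ, by positivity, fun j => ?_⟩
  have h3 : (j : ℝ) * (θ / θ') ^ j ≤ max K 0 := by
    refine le_trans ?_ (le_max_left _ _)
    have := hK (Set.mem_range_self j)
    simpa using this
  rcases j with _ | j
  · simp; positivity
  · have h4 : ((j + 1 : ℕ) : ℝ) * θ ^ (j + 1 - 1) =
        (((j + 1 : ℕ) : ℝ) * (θ / θ') ^ (j + 1)) * (θ' ^ (j + 1) / θ) := by
      rw [div_pow, Nat.add_sub_cancel, pow_succ θ j]
      field_simp
    rw [h4, div_mul_eq_mul_div, mul_div_assoc]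
    gcongr

/-- Iterating the contraction `eLpNorm_freeWave_le` gives arbitrarily many powers of decay. The
momentum powers are carried along because they absorb the commutators: their norms decay
geometrically, and each commutator costs a factor linear in the exponent. -/
theorem IsBand.exists_decay_momPow (hκ : 0 < κ) (k : ℕ) : ∀ {F : E d → ℂ}, IsBand u κ F →
    ∃ C θ : ℝ, 0 ≤ C ∧ 0 < θ ∧ θ < 1 ∧ ∀ (j : ℕ) (ρ τ : ℝ), 0 < ρ →
      eLpNorm (freeWave τ (momPow u κ F j)) 2 (volume.restrict (forbidden u κ ρ τ)) ≤
        ENNReal.ofReal (C * θ ^ j * (ρ + 2 * κ * |τ|)⁻¹ ^ k) := by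
  have base : ∀ {F : E d → ℂ}, IsBand u κ F → ∀ (j : ℕ) (ρ τ : ℝ),
      eLpNorm (freeWave τ (momPow u κ F j)) 2 (volume.restrict (forbidden u κ ρ τ)) ≤
        ENNReal.ofReal ((eLpNorm F 2 volume).toReal * (1 / 2) ^ j) := by
    intro F h j ρ τ
    refine (eLpNorm_mono_measure _ Measure.restrict_le_self).trans ?_
    rw [(h.isBand_momPow j).eLpNorm_freeWave, ENNReal.ofReal_mul ENNReal.toReal_nonneg,
      ENNReal.ofReal_toReal h.memLp.2.ne, mul_comm]
    exact h.eLpNorm_momPow_le hκ j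
  induction k with
  | zero =>
    intro F h
    refine ⟨(eLpNorm F 2 volume).toReal, 1 / 2, ENNReal.toReal_nonneg, by norm_num,
      by norm_num, fun j ρ τ _ => ?_⟩
    rw [pow_zero, mul_one]
    exact base h j ρ τ
  | succ k ih =>
    intro F h
    obtain ⟨C₁, θ₁, hC₁, hθ₁, hθ₁', H₁⟩ := ih h.isBand_posOp
    obtain ⟨C₂, θ₂, hC₂, hθ₂, hθ₂', H₂⟩ := ih h
    set θ := max θ₁ θ₂ with hθdef
    have hθ : 0 < θ := lt_max_of_lt_left hθ₁
    have hθ1 : θ < 1 := max_lt hθ₁' hθ₂'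
    obtain ⟨θ', hθθ', hθ'1⟩ := exists_between hθ1
    have hθ' : 0 < θ' := hθ.trans hθθ'
    obtain ⟨K, hK, hKj⟩ := exists_bound_mul_pow hθ hθθ'
    set a := ‖u‖ ^ 2 / κ with ha
    have ha0 : 0 ≤ a := by positivity
    set C₃ := C₁ + a * C₂ * K with hC₃
    have hC₃0 : 0 ≤ C₃ := by positivity
    -- the position operator applied to the `j`-th momentum power
    have hA : ∀ (j : ℕ) (ρ τ : ℝ), 0 < ρ →
        eLpNorm (freeWave τ (posOp u (momPow u κ F j))) 2 (volume.restrict (forbidden u κ ρ τ)) ≤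
          ENNReal.ofReal (C₃ * θ' ^ j * (ρ + 2 * κ * |τ|)⁻¹ ^ k) := by
      intro j ρ τ hρ
      have hl : 0 < ρ + 2 * κ * |τ| := by positivity
      set c : ℂ := j * (Complex.I * ((a : ℝ) : ℂ)) with hc
      have hb1 := h.isBand_posOp.isBand_momPow j
      have hb2 : IsBand u κ (fun ξ => c * momPow u κ F (j - 1) ξ) :=
        ⟨contDiff_const.mul (h.isBand_momPow _).contDiff, (h.isBand_momPow _).compact.mul_left,
          tsupport_mul_subset_right.trans (h.isBand_momPow _).supp⟩
      have e1 : freeWave τ (posOp u (momPow u κ F j)) =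
          freeWave τ (momPow u κ (posOp u F) j) + c • freeWave τ (momPow u κ F (j - 1)) := by
        funext y
        rw [Pi.add_apply, Pi.smul_apply, smul_eq_mul, ← freeWave_const_mul, ← hb1.freeWave_add hb2]
        congr 1
        funext ξ
        exact h.posOp_momPow j ξ
      have hcn : ‖c‖ₑ = ENNReal.ofReal (j * a) := by
        rw [← ofReal_norm, hc, norm_mul, norm_mul, Complex.norm_I, one_mul, Complex.norm_real,
          Complex.norm_natCast, Real.norm_of_nonneg ha0]
      rw [e1]
      refine (eLpNorm_add_le (hb1.continuous_freeWave τ).aestronglyMeasurable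
        (((h.isBand_momPow _).continuous_freeWave τ).const_smul c).aestronglyMeasurable
        (by norm_num)).trans ?_
      rw [eLpNorm_const_smul, hcn]
      refine (add_le_add (H₁ j ρ τ hρ) (mul_le_mul_right (H₂ (j - 1) ρ τ hρ) _)).trans ?_
      rw [← ENNReal.ofReal_mul (by positivity), ← ENNReal.ofReal_add (by positivity) (by positivity)]
      refine ENNReal.ofReal_le_ofReal ?_
      have s1 : θ₁ ^ j ≤ θ' ^ j := pow_le_pow_left₀ hθ₁.le ((le_max_left _ _).trans hθθ'.le) j
      have s2 : θ₂ ^ (j - 1) ≤ θ ^ (j - 1) := pow_le_pow_left₀ hθ₂.le (le_max_right _ _) _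
      have s3 : j * θ₂ ^ (j - 1) ≤ K * θ' ^ j :=
        (mul_le_mul_of_nonneg_left s2 (Nat.cast_nonneg j)).trans (hKj j)
      have s4 : (0 : ℝ) ≤ (ρ + 2 * κ * |τ|)⁻¹ ^ k := by positivity
      calc C₁ * θ₁ ^ j * (ρ + 2 * κ * |τ|)⁻¹ ^ k +
            j * a * (C₂ * θ₂ ^ (j - 1) * (ρ + 2 * κ * |τ|)⁻¹ ^ k)
          = (C₁ * θ₁ ^ j + a * C₂ * (j * θ₂ ^ (j - 1))) * (ρ + 2 * κ * |τ|)⁻¹ ^ k := by ring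
        _ ≤ (C₁ * θ' ^ j + a * C₂ * (K * θ' ^ j)) * (ρ + 2 * κ * |τ|)⁻¹ ^ k := by gcongr
        _ = C₃ * θ' ^ j * (ρ + 2 * κ * |τ|)⁻¹ ^ k := by rw [hC₃]; ring
    refine ⟨C₃ / (1 - θ'), θ', div_nonneg hC₃0 (by linarith), hθ', hθ'1, fun j ρ τ hρ => ?_⟩
    have hl : 0 < ρ + 2 * κ * |τ| := by positivity
    set lam := (ρ + 2 * κ * |τ|)⁻¹ with hlam
    have hlam0 : 0 ≤ lam := by positivity
    -- sum the contraction inequality over `j, …, j + n - 1`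
    have hiter : ∀ n : ℕ,
        eLpNorm (freeWave τ (momPow u κ F j)) 2 (volume.restrict (forbidden u κ ρ τ)) ≤
        eLpNorm (freeWave τ (momPow u κ F (j + n))) 2 (volume.restrict (forbidden u κ ρ τ)) +
          ENNReal.ofReal (C₃ * lam ^ (k + 1) * ∑ i ∈ Finset.range n, θ' ^ (j + i)) := by
      intro n
      induction n with
      | zero => simp
      | succ n ihn =>
        refine ihn.trans ?_
        have h1 := eLpNorm_freeWave_le (h.isBand_momPow (j + n)) hκ hρ τ
        rw [momPow_momPow_one] at h1
        have h2 : ENNReal.ofReal (ρ + 2 * κ * |τ|)⁻¹ * eLpNorm (freeWave τ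
            (posOp u (momPow u κ F (j + n)))) 2 (volume.restrict (forbidden u κ ρ τ)) ≤
            ENNReal.ofReal (C₃ * lam ^ (k + 1) * θ' ^ (j + n)) := by
          refine (mul_le_mul_right (hA (j + n) ρ τ hρ) _).trans ?_
          rw [← ENNReal.ofReal_mul (by positivity)]
          refine ENNReal.ofReal_le_ofReal (le_of_eq ?_)
          rw [← hlam]; ring
        refine (add_le_add_left (h1.trans (add_le_add_right h2 _)) _).trans ?_
        rw [add_assoc, ← ENNReal.ofReal_add (by positivity) (by positivity), ← mul_add,
          Finset.sum_range_succ, add_comm (θ' ^ (j + n)), ← add_assoc j n 1]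
    have hgeom : ∀ n, ∑ i ∈ Finset.range n, θ' ^ (j + i) ≤ θ' ^ j * (1 - θ')⁻¹ := by
      intro n
      simp only [pow_add]
      rw [← Finset.mul_sum]
      gcongr
      rw [← tsum_geometric_of_lt_one hθ'.le hθ'1]
      exact (summable_geometric_of_lt_one hθ'.le hθ'1).sum_le_tsum _ (fun i _ => by positivity)
    have hbound : ∀ n : ℕ,
        eLpNorm (freeWave τ (momPow u κ F j)) 2 (volume.restrict (forbidden u κ ρ τ)) ≤
        ENNReal.ofReal ((eLpNorm F 2 volume).toReal * (1 / 2) ^ (j + n)) +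
          ENNReal.ofReal (C₃ / (1 - θ') * θ' ^ j * lam ^ (k + 1)) := by
      intro n
      refine (hiter n).trans (add_le_add (base h _ ρ τ) (ENNReal.ofReal_le_ofReal ?_))
      calc C₃ * lam ^ (k + 1) * ∑ i ∈ Finset.range n, θ' ^ (j + i)
          ≤ C₃ * lam ^ (k + 1) * (θ' ^ j * (1 - θ')⁻¹) := by gcongr; exact hgeom n
        _ = _ := by rw [div_eq_mul_inv]; ring
    have hlim : Tendsto (fun n : ℕ => ENNReal.ofReal ((eLpNorm F 2 volume).toReal * (1 / 2) ^ (j + n)) +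
          ENNReal.ofReal (C₃ / (1 - θ') * θ' ^ j * lam ^ (k + 1))) atTop
        (𝓝 (ENNReal.ofReal ((eLpNorm F 2 volume).toReal * 0) +
          ENNReal.ofReal (C₃ / (1 - θ') * θ' ^ j * lam ^ (k + 1)))) := by
      refine Tendsto.add ?_ tendsto_const_nhds
      refine ENNReal.tendsto_ofReal (Tendsto.const_mul _ ?_)
      have := (tendsto_pow_atTop_nhds_zero_of_lt_one (r := (1 / 2 : ℝ)) (by norm_num)
        (by norm_num)).comp (tendsto_add_atTop_nat j)
      refine this.congr fun n => ?_
      simp [add_comm]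
    have := ge_of_tendsto' hlim hbound
    simpa using this

/-- Non-stationary phase: a wave packet with momentum in the band `|2π⟨ξ, u⟩| ≤ κ/2` decays
quadratically in the classically forbidden region. -/
theorem IsBand.exists_decay (h : IsBand u κ F) (hκ : 0 < κ) : ∃ C : ℝ, 0 ≤ C ∧
    ∀ ρ τ : ℝ, 0 < ρ → eLpNorm (freeWave τ F) 2 (volume.restrict (forbidden u κ ρ τ)) ≤
      ENNReal.ofReal (C / (ρ + 2 * κ * |τ|) ^ 2) := by
  obtain ⟨C, θ, hC, -, -, H⟩ := IsBand.exists_decay_momPow hκ 2 h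
  refine ⟨C, hC, fun ρ τ hρ => ?_⟩
  have := H 0 ρ τ hρ
  rwa [momPow_zero, pow_zero, mul_one, inv_pow, ← div_eq_mul_inv] at this

end Decay

/-! ### Phase space translates of wave packets -/

section Covariance

open FourierTransform

variable {d : ℕ} {u : E d} {κ : ℝ} {F : E d → ℂ}

/-- Parseval's identity for the coefficients against the phase space translates of a wave packet. -/
theorem IsBand.windowCoeff_freeWave (h : IsBand u κ F) (τ : ℝ) (g : L2 d) (x p : E d) :
    windowCoeff (freeWave τ F) g (x, p) =
      ∫ ξ, (starRingEnd ℂ) (Complex.exp (-Complex.I * (2 * Real.pi * inner ℝ x ξ : ℝ)) *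
        (Complex.exp (-Complex.I * (τ * symbol d (ξ - (2 * Real.pi)⁻¹ • p) : ℝ)) *
          F (ξ - (2 * Real.pi)⁻¹ • p))) * fourierL2 d g ξ := by
  set q := (2 * Real.pi)⁻¹ • p with hq
  have hpi : (Real.pi : ℂ) ≠ 0 := by exact_mod_cast Real.pi_ne_zero
  let K : E d → ℂ := fun ξ => Complex.exp (-Complex.I * (τ * symbol d ξ : ℝ)) * F ξ
  let G : E d → ℂ := fun ξ => Complex.exp (-Complex.I * (2 * Real.pi * inner ℝ x ξ : ℝ)) * K (ξ - q)
  have hG1 : ContDiff ℝ ((⊤ : ℕ∞) : WithTop ℕ∞) G := by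
    have h1 : ContDiff ℝ ((⊤ : ℕ∞) : WithTop ℕ∞) fun ξ : E d => 2 * Real.pi * inner ℝ x ξ := by
      exact contDiff_const.mul (contDiff_const.inner ℝ contDiff_id)
    have h2 : ContDiff ℝ ((⊤ : ℕ∞) : WithTop ℕ∞)
        fun ξ : E d => Complex.ofRealCLM (2 * Real.pi * inner ℝ x ξ) :=
      Complex.ofRealCLM.contDiff.comp h1
    exact (contDiff_const.mul h2).cexp.mul ((h.phase_contDiff τ).comp (contDiff_id.sub contDiff_const))
  have hG2 : HasCompactSupport G :=
    HasCompactSupport.mul_left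
      ((h.phase_compact τ).comp_homeomorph (Homeomorph.subRight q))
  let Gs : 𝓢(E d, ℂ) := hG2.toSchwartzMap hG1
  have hGs : ∀ ξ, Gs ξ = G ξ := fun ξ => rfl
  have hinv : ∀ y, (𝓕⁻ Gs) y =
      Complex.exp (Complex.I * (inner ℝ p (y - x) : ℝ)) * freeWave τ F (y - x) := by
    intro y
    rw [SchwartzMap.fourierInv_coe, Real.fourierInv_eq', freeWave, Real.fourierInv_eq',
      ← integral_const_mul]
    refine Eq.trans ?_ (integral_sub_right_eq_self (fun ζ => _) q)
    refine integral_congr_ae (ae_of_all _ fun ξ => ?_)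
    simp only [hGs, G, K, smul_eq_mul, ← mul_assoc]
    congr 2
    rw [← Complex.exp_add, ← Complex.exp_add]
    congr 1
    simp only [hq, inner_sub_left, inner_sub_right, inner_smul_left, real_inner_comm x ξ]
    simp
    field_simp
    ring
  have e1 : windowCoeff (freeWave τ F) g (x, p) = inner ℂ ((𝓕⁻ Gs).toLp 2) g := by
    rw [L2.inner_def, windowCoeff]
    refine integral_congr_ae ?_
    filter_upwards [SchwartzMap.coeFn_toLp (𝓕⁻ Gs) 2 volume] with y hy
    rw [hy, RCLike.inner_apply, mul_comm, hinv]
  rw [e1, ← SchwartzMap.toLp_fourierInv_eq, ← (fourierL2 d).inner_map_map]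
  have e2 : fourierL2 d (𝓕⁻ (Gs.toLp 2) : L2 d) = Gs.toLp 2 :=
    (fourierL2 d).apply_symm_apply _
  rw [e2, L2.inner_def]
  refine integral_congr_ae ?_
  filter_upwards [SchwartzMap.coeFn_toLp Gs 2 volume] with ξ hξ
  rw [hξ, RCLike.inner_apply, mul_comm]
  rfl

/-- Covariance: the free evolution moves the phase space translate at `(x, p)` to
`(x + 2τp, p)`, up to the spreading of the wave packet and a phase. -/
theorem IsBand.windowCoeff_freeGroup (h : IsBand u κ F) (τ : ℝ) (g : L2 d) (x p : E d) :
    windowCoeff (freeWave 0 F) (freeGroup d (-τ) g) (x, p) =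
      Complex.exp (-Complex.I * (τ * ‖p‖ ^ 2 : ℝ)) *
        windowCoeff (freeWave τ F) g (x + (2 * τ) • p, p) := by
  rw [h.windowCoeff_freeWave, h.windowCoeff_freeWave, fourierL2_freeGroup, ← integral_const_mul]
  refine integral_congr_ae ?_
  filter_upwards [coeFn_phaseGroup measurable_symbol (-τ) (fourierL2 d g)] with ξ hξ
  rw [hξ]
  simp only [map_mul, zero_mul, Complex.ofReal_zero, mul_zero, Complex.exp_zero, one_mul,
    ← Complex.exp_conj, map_neg, Complex.conj_I, Complex.conj_ofReal]
  have : ∀ a b c a' b' c' F g : ℂ, a + b = c + (a' + b') →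
      Complex.exp a * F * (Complex.exp b * g) =
        Complex.exp c * (Complex.exp a' * (Complex.exp b' * F) * g) := by
    intro a b c a' b' c' F g habc
    have := congrArg Complex.exp habc
    rw [Complex.exp_add, Complex.exp_add, Complex.exp_add] at this
    linear_combination F * g * this
  refine this _ _ _ _ _ 0 _ _ ?_
  have hpi : (Real.pi : ℂ) ≠ 0 := by exact_mod_cast Real.pi_ne_zero
  have h2 : symbol d (ξ - (2 * Real.pi)⁻¹ • p) =
      symbol d ξ - 4 * Real.pi * inner ℝ p ξ + ‖p‖ ^ 2 := by
    unfold symbol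
    have hpi' := Real.pi_ne_zero
    rw [norm_sub_sq_real, norm_smul, inner_smul_right, real_inner_comm p ξ, norm_inv,
      Real.norm_of_nonneg Real.two_pi_pos.le]
    field_simp
    ring
  rw [h2, inner_add_left, inner_smul_left]
  simp
  ring

/-- The coefficient at momentum `p` only sees the part of `ψ` with momentum near `p`. -/
theorem IsBand.windowCoeff_fourierMul (h : IsBand u κ F) {χ : E d → ℂ} (hχ : MemLp χ ∞ volume)
    {x p : E d} (hp : ∀ ξ, F (ξ - (2 * Real.pi)⁻¹ • p) ≠ 0 → χ ξ = 1) (ψ : L2 d) :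
    windowCoeff (freeWave 0 F) (fourierMul χ hχ ψ) (x, p) =
      windowCoeff (freeWave 0 F) ψ (x, p) := by
  rw [h.windowCoeff_freeWave, h.windowCoeff_freeWave, fourierL2_fourierMul]
  refine integral_congr_ae ?_
  filter_upwards [coeFn_mulLp χ hχ (fourierL2 d ψ)] with ξ hξ
  rw [hξ]
  by_cases h0 : F (ξ - (2 * Real.pi)⁻¹ • p) = 0
  · simp only [h0, mul_zero, map_zero, zero_mul]
  · rw [hp ξ h0, one_mul]

theorem lintegral_shear (τ : ℝ) {f : E d × E d → ℝ≥0∞} (hf : Measurable f) :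
    ∫⁻ z : E d × E d, f (z.1 + (2 * τ) • z.2, z.2) = ∫⁻ z, f z := by
  rw [Measure.volume_eq_prod, lintegral_prod_symm' _ (by fun_prop), lintegral_prod_symm' _ hf]
  refine lintegral_congr fun p => ?_
  exact lintegral_add_right_eq_self (μ := volume) (fun x : E d => f (x, p)) ((2 * τ) • p)

/-- Propagation estimate: if `g` is localized in `⟨y, u⟩ ≤ R`, then `e^{iτH₀} g` is small at the
phase space points `(x, p)` whose classical position `x + 2τp` at time `τ` is far beyond `R` in the
direction `u`. -/
theorem IsBand.norm_coeffOp_freeGroup_le (h : IsBand u κ F) (hm : Measurable (freeWave 0 F))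
    (hh : MemLp (freeWave 0 F) 2 volume) {C n R : ℝ} (hC : 0 ≤ C)
    (τ : ℝ) (hdecay : eLpNorm (freeWave τ F) 2
      (volume.restrict (forbidden u κ (n - R) τ)) ≤
        ENNReal.ofReal (C / (n - R + 2 * κ * |τ|) ^ 2)) {S : Set (E d × E d)}
    (hS : MeasurableSet S) (hxp : ∀ z ∈ S,
      n + 2 * κ * |τ| ≤ inner ℝ z.1 u + 2 * τ * inner ℝ z.2 u) (g : L2 d)
    (hg : ∀ᵐ y, g y ≠ 0 → inner ℝ y u ≤ R) :
    ‖coeffOp hm hh S (freeGroup d (-τ) g)‖ ≤ C / (n - R + 2 * κ * |τ|) ^ 2 * ‖g‖ := by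
  classical
  -- where `g` does not vanish, the window at a point of `S` is evaluated in the forbidden region
  set A := forbidden u κ (n - R) τ with hA
  have hAm : MeasurableSet A := measurableSet_le measurable_const (by fun_prop)
  set cut : E d → ℂ := A.indicator (freeWave τ F) with hcut
  have hcm : Measurable cut := (h.continuous_freeWave τ).measurable.indicator hAm
  have hcut2 : eLpNorm cut 2 volume ≤ ENNReal.ofReal (C / (n - R + 2 * κ * |τ|) ^ 2) := by
    rw [hcut, eLpNorm_indicator_eq_eLpNorm_restrict hAm]; exact hdecay
  have hch : MemLp cut 2 volume :=
    ⟨hcm.aestronglyMeasurable, hcut2.trans_lt ENNReal.ofReal_lt_top⟩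
  have gm : Measurable g := (Lp.stronglyMeasurable g).measurable
  have hcutnorm : ‖hch.toLp cut‖ ≤ C / (n - R + 2 * κ * |τ|) ^ 2 := by
    rw [Lp.norm_toLp]
    exact ENNReal.toReal_le_of_le_ofReal (by positivity) hcut2
  refine le_trans ?_ (mul_le_mul_of_nonneg_right hcutnorm (norm_nonneg g))
  rw [← norm_coeffOp_univ hcm hch g]
  refine norm_le_of_enorm_sq_le (norm_nonneg _) ?_
  rw [ofReal_norm_sq, enorm_coeffOp_sq, enorm_coeffOp_sq, Measure.restrict_univ]
  refine mul_le_mul_right ?_ _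
  have hmeas : Measurable fun z => ‖windowCoeff cut g z‖ₑ ^ 2 :=
    (measurable_windowCoeff hcm gm).measurable.enorm.pow_const 2
  rw [← lintegral_shear τ hmeas]
  refine (setLIntegral_mono' hS ?_).trans (setLIntegral_le_lintegral S _)
  rintro ⟨x, p⟩ hz
  have hz' : n + 2 * κ * |τ| ≤ inner ℝ x u + 2 * τ * inner ℝ p u := hxp _ hz
  rw [h.windowCoeff_freeGroup, enorm_mul, ← ofReal_norm (Complex.exp _), norm_phase,
    ENNReal.ofReal_one, one_mul]
  refine le_of_eq (congrArg (fun c : ℂ => ‖c‖ₑ ^ 2) ?_)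
  refine integral_congr_ae ?_
  filter_upwards [hg] with y hy
  by_cases hgy : g y = 0
  · simp [hgy]
  · have hmem : y - (x + (2 * τ) • p) ∈ A := by
      have h1 := hy hgy
      change n - R + 2 * κ * |τ| ≤ |inner ℝ (y - (x + (2 * τ) • p)) u|
      rw [inner_sub_left, inner_add_left, inner_smul_left]
      simp only [conj_trivial]
      refine le_trans ?_ (neg_le_abs _)
      linarith
    simp only [hcut, Set.indicator_of_mem hmem]

end Covariance

/-! ### Rescaled windows -/

section Windows

open FourierTransform

variable {d : ℕ} {η : 𝓢(E d, ℂ)} {δ : ℝ}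

/-- The Fourier transform of `rescale η δ`. -/
def windowHat (η : 𝓢(E d, ℂ)) (δ : ℝ) (ξ : E d) : ℂ :=
  ((δ ^ (-(d : ℝ) / 2) : ℝ) : ℂ) * 𝓕 η (δ⁻¹ • ξ)

theorem freeWave_zero_windowHat (hδ : 0 < δ) : freeWave 0 (windowHat η δ) = rescale η δ := by
  funext y
  have h1 : freeWave 0 (windowHat η δ) y = ∫ ξ : E d, ((δ ^ (-(d : ℝ) / 2) : ℝ) : ℂ) *
      (fun ζ : E d => Complex.exp (↑(2 * Real.pi * inner ℝ ζ (δ • y)) * Complex.I) • 𝓕 η ζ)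
        (δ⁻¹ • ξ) := by
    rw [freeWave, Real.fourierInv_eq']
    refine integral_congr_ae (ae_of_all _ fun ξ => ?_)
    have h2 : inner ℝ (δ⁻¹ • ξ) (δ • y) = inner ℝ ξ y := by
      rw [inner_smul_left, inner_smul_right]
      simp only [conj_trivial]
      field_simp
    simp only [zero_mul, Complex.ofReal_zero, mul_zero, Complex.exp_zero, one_mul, windowHat,
      smul_eq_mul, h2]
    ring
  have h3 : (𝓕⁻ (𝓕 η)) (δ • y) = η (δ • y) := by
    rw [FourierTransform.fourierInv_fourier_eq]
  rw [h1, integral_const_mul, Measure.integral_comp_inv_smul_of_nonneg volume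
      (fun ζ : E d => Complex.exp (↑(2 * Real.pi * inner ℝ ζ (δ • y)) * Complex.I) • 𝓕 η ζ) hδ.le,
    ← Real.fourierInv_eq', ← SchwartzMap.fourierInv_coe, h3, rescale, finrank_euclideanSpace_fin,
    Complex.real_smul, ← mul_assoc, ← Complex.ofReal_mul, ← Real.rpow_natCast,
    ← Real.rpow_add hδ]
  congr 3
  ring

theorem tsupport_windowHat (hη : tsupport (fourierU η) ⊆ Metric.closedBall 0 1) (hδ : 0 < δ) :
    tsupport (windowHat η δ) ⊆ Metric.closedBall 0 (δ / (2 * Real.pi)) := by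
  refine closure_minimal (fun ξ hξ => ?_) Metric.isClosed_closedBall
  have hpi := Real.two_pi_pos
  have hpi' : (Real.pi : ℂ) ≠ 0 := by exact_mod_cast Real.pi_ne_zero
  have h1 : 𝓕 η (δ⁻¹ • ξ) ≠ 0 := right_ne_zero_of_mul hξ
  have h2 : fourierU η ((2 * Real.pi) • (δ⁻¹ • ξ)) =
      (((2 * Real.pi) ^ (-(d : ℝ) / 2) : ℝ) : ℂ) * 𝓕 η (δ⁻¹ • ξ) := by
    rw [fourierU, SchwartzMap.fourier_coe, Real.fourier_eq']
    congr 1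
    refine integral_congr_ae (ae_of_all _ fun x => ?_)
    simp only [smul_eq_mul, inner_smul_right]
    rw [mul_comm]
    congr 2
    push_cast
    ring
  have h3 : fourierU η ((2 * Real.pi) • (δ⁻¹ • ξ)) ≠ 0 := by
    rw [h2]
    refine mul_ne_zero ?_ h1
    exact_mod_cast (Real.rpow_pos_of_pos hpi _).ne'
  have h4 := hη (subset_tsupport _ h3)
  rw [mem_closedBall_zero_iff, norm_smul, norm_smul, Real.norm_of_nonneg hpi.le,
    Real.norm_of_nonneg (by positivity)] at h4
  rw [mem_closedBall_zero_iff, le_div_iff₀ hpi]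
  calc ‖ξ‖ * (2 * Real.pi) = δ * (2 * Real.pi * (δ⁻¹ * ‖ξ‖)) := by field_simp
    _ ≤ δ * 1 := by gcongr
    _ = δ := mul_one δ

theorem isBand_windowHat (hη : tsupport (fourierU η) ⊆ Metric.closedBall 0 1) (hδ : 0 < δ)
    {u : E d} {κ : ℝ} (hu : δ * ‖u‖ ≤ κ / 2) : IsBand u κ (windowHat η δ) := by
  have hpi := Real.two_pi_pos
  refine ⟨?_, ?_, fun ξ hξ => ?_⟩
  · have h1 : ContDiff ℝ ((⊤ : ℕ∞) : WithTop ℕ∞) (𝓕 η : 𝓢(E d, ℂ)) :=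
      (𝓕 η).smooth _
    exact contDiff_const.mul (h1.comp (contDiff_const_smul δ⁻¹))
  · exact (isCompact_closedBall _ _).of_isClosed_subset (isClosed_tsupport _)
      (tsupport_windowHat hη hδ)
  · have h1 := tsupport_windowHat hη hδ hξ
    rw [mem_closedBall_zero_iff, le_div_iff₀ hpi] at h1
    change |2 * Real.pi * inner ℝ ξ u| ≤ κ / 2
    rw [abs_mul, abs_of_pos hpi]
    calc 2 * Real.pi * |inner ℝ ξ u| ≤ 2 * Real.pi * (‖ξ‖ * ‖u‖) := by
          gcongr; exact abs_real_inner_le_norm ξ u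
      _ = (‖ξ‖ * (2 * Real.pi)) * ‖u‖ := by ring
      _ ≤ δ * ‖u‖ := by gcongr
      _ ≤ κ / 2 := hu

theorem measurable_rescale (η : 𝓢(E d, ℂ)) (δ : ℝ) : Measurable (rescale η δ) := by
  have : Continuous (rescale η δ) := by
    unfold rescale
    have := η.continuous
    fun_prop
  exact this.measurable

theorem lintegral_rescale (hη : ∫ x, ‖η x‖ ^ 2 = 1) (hδ : 0 < δ) :
    ∫⁻ y, ‖rescale η δ y‖ₑ ^ 2 = 1 := by
  have h0 : ∫⁻ y, ‖η y‖ₑ ^ 2 = 1 := by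
    have hi : Integrable fun x => ‖η x‖ ^ 2 := (η.memLp 2).integrable_norm_pow two_ne_zero
    have h1 := ofReal_integral_eq_lintegral_ofReal hi (ae_of_all _ fun x => by positivity)
    rw [hη, ENNReal.ofReal_one] at h1
    rw [h1]
    refine lintegral_congr fun x => ?_
    rw [ofReal_norm_sq]
  have h1 : ∀ y, ‖rescale η δ y‖ₑ ^ 2 = ENNReal.ofReal (δ ^ d) *
      (fun x => ‖η x‖ₑ ^ 2) ((δ⁻¹)⁻¹ • y) := by
    intro y
    rw [rescale, enorm_mul, mul_pow, ← ofReal_norm (Complex.ofReal _), Complex.norm_real,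
      Real.norm_of_nonneg (by positivity), ← ENNReal.ofReal_pow (by positivity),
      ← Real.rpow_natCast, ← Real.rpow_mul hδ.le, inv_inv]
    congr 2
    rw [← Real.rpow_natCast]
    congr 1
    push_cast
    ring
  simp only [h1]
  rw [lintegral_const_mul' _ _ ENNReal.ofReal_ne_top,
    lintegral_comp_inv_smul (inv_pos.2 hδ) (fun y => ‖η y‖ₑ ^ 2), h0, mul_one,
    ← ENNReal.ofReal_mul (by positivity), inv_pow, mul_inv_cancel₀ (by positivity),
    ENNReal.ofReal_one]

theorem memLp_rescale (hη : ∫ x, ‖η x‖ ^ 2 = 1) (hδ : 0 < δ) : MemLp (rescale η δ) 2 volume :=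
  memLp_two_of_lintegral (measurable_rescale η δ).aestronglyMeasurable (by
    rw [lintegral_rescale hη hδ]; exact ENNReal.one_lt_top)

theorem norm_toLp_rescale (hη : ∫ x, ‖η x‖ ^ 2 = 1) (hδ : 0 < δ)
    (hh : MemLp (rescale η δ) 2 volume) : ‖hh.toLp (rescale η δ)‖ = 1 := by
  have h1 := enorm_toLp_sq hh
  rw [lintegral_rescale hη hδ, ← ofReal_norm_sq, ENNReal.ofReal_eq_one] at h1
  exact (pow_eq_one_iff_of_nonneg (norm_nonneg _) two_ne_zero).1 h1

/-- The propagation estimate for coherent states, with the non-stationary phase bound inserted. -/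
theorem exists_norm_coeffOp_freeGroup_le (hη : tsupport (fourierU η) ⊆ Metric.closedBall 0 1)
    (hδ : 0 < δ) (hm : Measurable (rescale η δ)) (hh : MemLp (rescale η δ) 2 volume)
    {u : E d} {m : ℝ} (hm0 : 0 < m) (hu : δ * ‖u‖ ≤ m / 2) : ∃ C : ℝ, 0 ≤ C ∧
      ∀ (τ n R : ℝ) (S : Set (E d × E d)) (g : L2 d), R < n → MeasurableSet S →
      (∀ z ∈ S, n + 2 * m * |τ| ≤ inner ℝ z.1 u + 2 * τ * inner ℝ z.2 u) →
      (∀ᵐ y, g y ≠ 0 → inner ℝ y u ≤ R) →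
      ‖coeffOp hm hh S (freeGroup d (-τ) g)‖ ≤ C / (n - R + 2 * m * |τ|) ^ 2 * ‖g‖ := by
  have hb := isBand_windowHat hη hδ hu
  obtain ⟨C, hC, H⟩ := hb.exists_decay hm0
  refine ⟨C, hC, fun τ n R S g hRn hS hxp hg => ?_⟩
  have key : ∀ (h : E d → ℂ) (hm : Measurable h) (hh : MemLp h 2 volume),
      freeWave 0 (windowHat η δ) = h →
      ‖coeffOp hm hh S (freeGroup d (-τ) g)‖ ≤ C / (n - R + 2 * m * |τ|) ^ 2 * ‖g‖ := by
    rintro h hm hh rfl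
    exact hb.norm_coeffOp_freeGroup_le hm hh hC τ (H _ τ (sub_pos.2 hRn)) hS hxp g hg
  exact key _ hm hh (freeWave_zero_windowHat hδ)

/-! ### Low momentum -/

/-- The band `|2π⟨ξ, u⟩| ≤ a` of frequencies. -/
def band (u : E d) (a : ℝ) : Set (E d) := {ξ | |2 * Real.pi * inner ℝ ξ u| ≤ a}

theorem measurableSet_band (u : E d) (a : ℝ) : MeasurableSet (band u a) :=
  measurableSet_le (by fun_prop) measurable_const

theorem memLp_top_indicator_one {A : Set (E d)} (hA : MeasurableSet A) :
    MemLp (A.indicator (fun _ => (1 : ℂ))) ∞ volume :=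
  memLp_top_of_bound (C := 1) ((stronglyMeasurable_const.indicator hA).aestronglyMeasurable)
    (ae_of_all _ fun x => by
      refine (norm_indicator_le_norm_self _ _).trans ?_; simp)

/-- The spectral projection onto momenta `p` with `|⟨p, u⟩| ≤ a`. -/
def bandProj (u : E d) (a : ℝ) : L2 d →L[ℂ] L2 d :=
  fourierMul _ (memLp_top_indicator_one (measurableSet_band u a))

theorem norm_coeffOp_le_bandProj (hη : tsupport (fourierU η) ⊆ Metric.closedBall 0 1)
    (hη1 : ∫ x, ‖η x‖ ^ 2 = 1) (hδ : 0 < δ) (hm : Measurable (rescale η δ))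
    (hh : MemLp (rescale η δ) 2 volume) {u : E d} {m a : ℝ} (ha : m + δ * ‖u‖ ≤ a) {S : Set (E d × E d)}
    (hS : MeasurableSet S) (hp : ∀ z ∈ S, |inner ℝ z.2 u| ≤ m) (ψ : L2 d) :
    ‖coeffOp hm hh S ψ‖ ≤ ‖bandProj u a ψ‖ := by
  have hpi := Real.two_pi_pos
  -- the window has momenta `|⟨p, u⟩| ≤ δ‖u‖`, so at momentum `p` it only sees the band around `p`
  have hb := isBand_windowHat (u := u) (κ := 2 * (δ * ‖u‖)) hη hδ (by linarith)
  have h1 : ‖coeffOp hm hh S ψ‖ ≤ ‖coeffOp hm hh S (bandProj u a ψ)‖ := by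
    refine norm_le_of_enorm_sq_le (norm_nonneg _) ?_
    rw [ofReal_norm_sq, enorm_coeffOp_sq, enorm_coeffOp_sq]
    refine mul_le_mul_right ?_ _
    refine setLIntegral_mono' hS ?_
    rintro ⟨x, p⟩ hz
    refine le_of_eq (congrArg (fun c : ℂ => ‖c‖ₑ ^ 2) ?_)
    rw [← freeWave_zero_windowHat hδ]
    refine (hb.windowCoeff_fourierMul _ (fun ξ hξ => ?_) ψ).symm
    refine Set.indicator_of_mem ?_ _
    have h2 := hb.supp (subset_tsupport _ hξ)
    have h3 : |inner ℝ p u| ≤ m := hp _ hz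
    change |2 * Real.pi * inner ℝ (ξ - (2 * Real.pi)⁻¹ • p) u| ≤ 2 * (δ * ‖u‖) / 2 at h2
    change |2 * Real.pi * inner ℝ ξ u| ≤ a
    rw [inner_sub_left, inner_smul_left, mul_sub, conj_trivial, ← mul_assoc,
      mul_inv_cancel₀ hpi.ne', one_mul] at h2
    have h4 := abs_sub_abs_le_abs_sub (2 * Real.pi * inner ℝ ξ u) (inner ℝ p u)
    linarith
  refine h1.trans ((norm_coeffOp_le hm hh S _).trans ?_)
  rw [norm_toLp_rescale hη1 hδ, one_mul]

theorem norm_bandProj_freeGroup (u : E d) (a t : ℝ) (ψ : L2 d) :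
    ‖bandProj u a (freeGroup d t ψ)‖ = ‖bandProj u a ψ‖ := by
  have h : bandProj u a (freeGroup d t ψ) = freeGroup d t (bandProj u a ψ) := by
    apply (fourierL2 d).injective
    rw [bandProj, fourierL2_fourierMul, fourierL2_freeGroup, fourierL2_freeGroup,
      fourierL2_fourierMul]
    refine Lp.ext ?_
    filter_upwards [coeFn_mulLp _ (memLp_top_indicator_one (measurableSet_band u a))
        (phaseGroup measurable_symbol t (fourierL2 d ψ)),
      coeFn_phaseGroup measurable_symbol t (fourierL2 d ψ),
      coeFn_phaseGroup measurable_symbol t (mulLp _ (memLp_top_indicator_one (measurableSet_band u a))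
        (fourierL2 d ψ)),
      coeFn_mulLp _ (memLp_top_indicator_one (measurableSet_band u a)) (fourierL2 d ψ)]
      with ξ h1 h2 h3 h4
    rw [h1, h2, h3, h4, mul_left_comm]
  rw [h, norm_freeGroup]

theorem volume_inner_eq_zero {u : E d} (hu : u ≠ 0) :
    volume {ξ : E d | inner ℝ ξ u = 0} = 0 := by
  have h := Measure.addHaar_submodule (volume : Measure (E d)) (LinearMap.ker (innerₗ (E d) u)) ?_
  · convert h using 2
    ext ξ
    simp [real_inner_comm]
  · intro htop
    have h1 : u ∈ LinearMap.ker (innerₗ (E d) u) := by rw [htop]; trivial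
    rw [LinearMap.mem_ker, innerₗ_apply_apply, inner_self_eq_zero] at h1
    exact hu h1

/-- There is no state with momentum exactly orthogonal to `u`. -/
theorem tendsto_bandProj {u : E d} (hu : u ≠ 0) (ψ : L2 d) :
    Tendsto (fun a => ‖bandProj u a ψ‖) (𝓝[>] 0) (𝓝 0) := by
  have h1 : Tendsto (fun a => fourierL2 d (bandProj u a ψ)) (𝓝[>] 0) (𝓝 0) := by
    refine tendsto_zero_of_dominated _
      (fun a ξ => (band u a).indicator (fun _ => (1 : ℂ)) ξ * fourierL2 d ψ ξ)
      (fun ξ => ‖fourierL2 d ψ ξ‖) (fun a => ?_) (Lp.memLp _).norm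
      (Eventually.of_forall fun a => ae_of_all _ fun ξ => ?_) ?_
    · rw [bandProj, fourierL2_fourierMul]
      exact coeFn_mulLp _ _ _
    · rw [norm_mul]
      refine mul_le_of_le_one_left (norm_nonneg _) ?_
      refine (norm_indicator_le_norm_self _ _).trans ?_
      simp
    · have h2 : ∀ᵐ ξ : E d, inner ℝ ξ u ≠ 0 := by
        simpa [ae_iff] using volume_inner_eq_zero hu
      filter_upwards [h2] with ξ hξ
      refine tendsto_const_nhds.congr' ?_
      have h3 : 0 < |2 * Real.pi * inner ℝ ξ u| :=
        abs_pos.2 (mul_ne_zero Real.two_pi_pos.ne' hξ)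
      filter_upwards [nhdsWithin_le_nhds (Iio_mem_nhds h3)] with a ha
      rw [Set.indicator_of_notMem (fun hmem => absurd (Set.mem_ofPred_eq ▸ hmem) (not_le.2 ha)),
        zero_mul]
  have h2 := h1.norm
  simp only [LinearIsometryEquiv.norm_map, norm_zero] at h2
  exact h2

end Windows

/-! ### Cook's method -/

section Cook

theorem integrableOn_inv_sq {a b C : ℝ} (ha : 0 < a) (hb : 0 < b) (hC : 0 ≤ C) :
    IntegrableOn (fun s : ℝ => C / (a + b * s) ^ 2) (Set.Ioi 0) ∧
      ∫ s in Set.Ioi (0 : ℝ), C / (a + b * s) ^ 2 = C / (a * b) := by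
  have hd : ∀ s ∈ Set.Ici (0 : ℝ),
      HasDerivAt (fun s : ℝ => -(C / b) * (a + b * s)⁻¹) (C / (a + b * s) ^ 2) s := by
    intro s hs
    have hs' : 0 ≤ s := hs
    have hpos : 0 < a + b * s := by positivity
    have h1 : HasDerivAt (fun s : ℝ => a + b * s) b s := by
      simpa using ((hasDerivAt_id s).const_mul b).const_add a
    refine ((h1.inv hpos.ne').const_mul (-(C / b))).congr_deriv ?_
    field_simp
  have hpos : ∀ s ∈ Set.Ioi (0 : ℝ), 0 ≤ C / (a + b * s) ^ 2 := fun s _ => by positivity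
  have hlim : Tendsto (fun s : ℝ => -(C / b) * (a + b * s)⁻¹) atTop (𝓝 (-(C / b) * 0)) := by
    refine Tendsto.const_mul _ (tendsto_inv_atTop_zero.comp ?_)
    exact tendsto_atTop_add_const_left _ _ (tendsto_id.const_mul_atTop hb)
  refine ⟨integrableOn_Ioi_deriv_of_nonneg' hd hpos hlim, ?_⟩
  rw [integral_Ioi_of_hasDerivAt_of_nonneg' hd hpos hlim]
  field_simp
  ring

theorem intervalIntegral_inv_sq_le {a b C t : ℝ} (ha : 0 < a) (hb : 0 < b) (hC : 0 ≤ C)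
    (ht : 0 ≤ t) : ∫ s in (0 : ℝ)..t, C / (a + b * s) ^ 2 ≤ C / (a * b) := by
  obtain ⟨h1, h2⟩ := integrableOn_inv_sq ha hb hC
  rw [intervalIntegral.integral_of_le ht, ← h2]
  refine setIntegral_mono_set h1 (ae_of_all _ fun s => ?_)
    (LE.le.eventuallyLE Set.Ioc_subset_Ioi_self)
  change 0 ≤ C / (a + b * s) ^ 2
  positivity

variable {𝓗 : Type*} [NormedAddCommGroup 𝓗] [InnerProductSpace ℂ 𝓗] [CompleteSpace 𝓗]
  {A A' : 𝓗 →ₗ.[ℂ] 𝓗} {U U' : ℝ → 𝓗 →L[ℂ] 𝓗}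

/-- Cook's method, with an explicit rate. -/
theorem IsUnitaryGroupOf.cook (h : IsUnitaryGroupOf A U) (h' : IsUnitaryGroupOf A' U')
    (B : 𝓗 →L[ℂ] 𝓗) (hB : ∀ ψ φ, (ψ, φ) ∈ A.graph → (ψ, φ + B ψ) ∈ A'.graph) {a b C : ℝ}
    (ha : 0 < a) (hb : 0 < b) (hC : 0 ≤ C) (f : 𝓗)
    (hbd : ∀ s, 0 ≤ s → ‖B (U s f)‖ ≤ C / (a + b * s) ^ 2) :
    ∃ ψ, Tendsto (fun t => U' (-t) (U t f)) atTop (𝓝 ψ) ∧ ‖ψ - f‖ ≤ C / (a * b) := by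
  set G : ℝ → 𝓗 := fun s => U' (-s) (Complex.I • B (U s f)) with hG
  have hGc : Continuous G :=
    h'.continuous_apply continuous_neg ((B.continuous.comp (h.continuous f)).const_smul _)
  obtain ⟨h1, h2⟩ := integrableOn_inv_sq ha hb hC
  have hGb : ∀ s ∈ Set.Ioi (0 : ℝ), ‖G s‖ ≤ C / (a + b * s) ^ 2 := by
    intro s hs
    rw [hG]
    simp only
    rw [h'.norm_apply, norm_smul, Complex.norm_I, one_mul]
    exact hbd s (le_of_lt hs)
  have hGi : IntegrableOn G (Set.Ioi 0) :=
    Integrable.mono' h1 hGc.aestronglyMeasurable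
      ((ae_restrict_iff' measurableSet_Ioi).2 (ae_of_all _ hGb))
  refine ⟨f + ∫ s in Set.Ioi (0 : ℝ), G s, ?_, ?_⟩
  · have h3 := (intervalIntegral_tendsto_integral_Ioi 0 hGi tendsto_id).const_add f
    refine h3.congr fun t => ?_
    exact (h.duhamel h' B hB f t).symm
  · rw [add_sub_cancel_left, ← h2]
    exact norm_integral_le_of_norm_le h1
      ((ae_restrict_iff' measurableSet_Ioi).2 (ae_of_all _ hGb))

/-- The domain of the strong limit of a family of contractions is closed. -/
theorem isClosed_setOf_exists_tendsto {T : ℝ → 𝓗 →L[ℂ] 𝓗} (hT : ∀ t x, ‖T t x‖ ≤ ‖x‖) :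
    IsClosed {x | ∃ y, Tendsto (fun t => T t x) atTop (𝓝 y)} := by
  refine isClosed_of_closure_subset fun x hx => ?_
  have hc : CauchySeq fun t => T t x := by
    rw [Metric.cauchySeq_iff]
    intro ε hε
    obtain ⟨x', ⟨y, hy⟩, hd⟩ := Metric.mem_closure_iff.1 hx (ε / 3) (by positivity)
    obtain ⟨N, hN⟩ := Metric.cauchySeq_iff.1 hy.cauchySeq (ε / 3) (by positivity)
    refine ⟨N, fun s hs t ht => ?_⟩
    have e : ∀ t, dist (T t x) (T t x') < ε / 3 := fun t => by
      rw [dist_eq_norm, ← map_sub]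
      exact (hT t _).trans_lt (by rwa [← dist_eq_norm])
    have e1 := dist_triangle4 (T s x) (T s x') (T t x') (T t x)
    have e2 := e s
    have e3 := e t
    rw [dist_comm] at e3
    have e4 := hN s hs t ht
    linarith
  exact cauchySeq_tendsto_of_complete hc

theorem isClosed_setOf_tendsto_zero {𝓗 𝓚 : Type*} [NormedAddCommGroup 𝓗]
    [NormedSpace ℂ 𝓗] [NormedAddCommGroup 𝓚] [NormedSpace ℂ 𝓚] {T : ℝ → 𝓗 →L[ℂ] 𝓚} {M : ℝ}
    (hT : ∀ t x, ‖T t x‖ ≤ M * ‖x‖) :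
    IsClosed {x | Tendsto (fun t => T t x) atTop (𝓝 0)} := by
  refine isClosed_of_closure_subset fun x hx => ?_
  refine Metric.tendsto_nhds.2 fun ε hε => ?_
  have hM : 0 < |M| + 1 := by positivity
  obtain ⟨x', hy, hd⟩ := Metric.mem_closure_iff.1 hx (ε / 2 / (|M| + 1)) (by positivity)
  filter_upwards [Metric.tendsto_nhds.1 hy (ε / 2) (by positivity)] with t ht
  have e1 : dist (T t x) (T t x') < ε / 2 := by
    rw [dist_eq_norm, ← map_sub]
    rw [lt_div_iff₀ hM] at hd
    refine (hT t _).trans_lt (lt_of_le_of_lt ?_ hd)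
    rw [dist_eq_norm, mul_comm]
    gcongr
    linarith [le_abs_self M]
  linarith [dist_triangle (T t x) (T t x') 0]

end Cook

/-! ### Outgoing and incoming regions of phase space -/

section Sectors

variable {d : ℕ} {η : 𝓢(E d, ℂ)} {δ : ℝ}

/-- The phase space region of position at least `n` in the direction `u`, and momentum at least `m`
in the direction `v`. It is outgoing for `v = u`, and incoming for `v = -u`. -/
def sector (u v : E d) (n m : ℝ) : Set (E d × E d) := {z | n ≤ inner ℝ z.1 u ∧ m ≤ inner ℝ z.2 v}

theorem measurableSet_sector (u v : E d) (n m : ℝ) : MeasurableSet (sector u v n m) :=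
  MeasurableSet.inter (measurableSet_le (f := fun _ : E d × E d => n) measurable_const (by fun_prop))
    (measurableSet_le (f := fun _ : E d × E d => m) measurable_const (by fun_prop))

variable {w : E d → ℂ} {hw : MemLp w ∞ volume} {u : E d} {R : ℝ}

theorem mulLp_localized (hs : ∀ y, w y ≠ 0 → inner ℝ y u ≤ R) (f : L2 d) :
    ∀ᵐ y, mulLp w hw f y ≠ 0 → inner ℝ y u ≤ R := by
  filter_upwards [coeFn_mulLp w hw f] with y hy h0
  rw [hy] at h0
  exact hs y (left_ne_zero_of_mul h0)

/-- Duality: smallness of the coefficients of localized states, evolved backwards, yields smallness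
of the localization of states prepared in the region `S`, evolved forwards. -/
theorem norm_mulLp_freeGroup_observable_le (hη1 : ∫ x, ‖η x‖ ^ 2 = 1) (hδ : 0 < δ)
    (hm : Measurable (rescale η δ)) (hh : MemLp (rescale η δ) 2 volume)
    (hr : ∀ x, (starRingEnd ℂ) (w x) = w x) {S : Set (E d × E d)} {τ b : ℝ}
    (hb : ∀ f, ‖coeffOp hm hh S (freeGroup d (-τ) (mulLp w hw f))‖ ≤ b * ‖mulLp w hw f‖)
    (hb0 : 0 ≤ b) (g : L2 d) :
    ‖mulLp w hw (freeGroup d τ (observable η δ S g))‖ ≤ b * ‖mulLp w hw‖ * ‖g‖ := by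
  set χ := mulLp w hw (freeGroup d τ (observable η δ S g)) with hχ
  have h1 : ‖χ‖ * ‖χ‖ ≤ ‖χ‖ * (b * ‖mulLp w hw‖ * ‖g‖) := by
    calc ‖χ‖ * ‖χ‖ = ‖(inner ℂ χ χ : ℂ)‖ := by
          rw [inner_self_eq_norm_sq_to_K]; simp [sq]
      _ = ‖(inner ℂ (coeffOp hm hh S (freeGroup d (-τ) (mulLp w hw χ))) (coeffOp hm hh S g) : ℂ)‖ := by
          rw [← inner_observable hm hh, isUnitaryGroupOf_freeGroup.inner_left, neg_neg,
            inner_mulLp_real hw hr, norm_inner_symm]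
      _ ≤ ‖coeffOp hm hh S (freeGroup d (-τ) (mulLp w hw χ))‖ * ‖coeffOp hm hh S g‖ :=
          norm_inner_le_norm _ _
      _ ≤ (b * (‖mulLp w hw‖ * ‖χ‖)) * ‖g‖ := by
          refine mul_le_mul ((hb χ).trans ?_) ?_ (norm_nonneg _) (by positivity)
          · gcongr
            exact (mulLp w hw).le_opNorm χ
          · refine (norm_coeffOp_le hm hh S g).trans ?_
            rw [norm_toLp_rescale hη1 hδ, one_mul]
      _ = _ := by ring
  rcases (norm_nonneg χ).eq_or_lt with h0 | h0
  · rw [← h0]; positivity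
  · exact le_of_mul_le_mul_left h1 h0

/-- States prepared in an outgoing region leave every slab, at an integrable rate. -/
theorem exists_norm_mulLp_freeGroup_observable_le
    (hη : tsupport (fourierU η) ⊆ Metric.closedBall 0 1) (hη1 : ∫ x, ‖η x‖ ^ 2 = 1) (hδ : 0 < δ)
    (hr : ∀ x, (starRingEnd ℂ) (w x) = w x) (hs : ∀ y, w y ≠ 0 → inner ℝ y u ≤ R)
    {m : ℝ} (hm0 : 0 < m) (hu : δ * ‖u‖ ≤ m / 4) (n : ℝ) (g : L2 d) :
    ∃ C : ℝ, 0 ≤ C ∧ ∀ s, 0 ≤ s →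
      ‖mulLp w hw (freeGroup d s (observable η δ (sector u u n m) g))‖ ≤ C / (1 + m * s) ^ 2 := by
  have hm := measurable_rescale η δ
  have hh := memLp_rescale hη1 hδ
  obtain ⟨C, hC, H⟩ := exists_norm_coeffOp_freeGroup_le hη hδ hm hh (u := u) (half_pos hm0)
    (by linarith)
  set K := mulLp w hw with hK
  set f := observable η δ (sector u u n m) g with hf
  -- after the time `T`, all classical trajectories from the region have passed `R + 1`
  set T := max 0 ((R + 1 - n) / m) with hT
  have hT0 : 0 ≤ T := le_max_left _ _
  refine ⟨max (C * ‖K‖ * ‖g‖) (‖K‖ * ‖f‖ * (1 + m * T) ^ 2), by positivity, fun s hs0 => ?_⟩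
  have hpos : 0 < (1 + m * s) ^ 2 := by positivity
  rcases le_total s T with hsT | hsT
  · rw [le_div_iff₀ hpos]
    refine le_trans ?_ (le_max_right _ _)
    gcongr
    exact (K.le_opNorm _).trans_eq (by rw [norm_freeGroup])
  · have h1 : R + 1 - n ≤ s * m := by
      rw [← div_le_iff₀ hm0]; exact (le_max_right _ _).trans hsT
    have h2 := norm_mulLp_freeGroup_observable_le (hw := hw) hη1 hδ hm hh hr (S := sector u u n m)
      (τ := s) (b := C / (1 + m * s) ^ 2) (fun f => ?_) (by positivity) g
    · refine h2.trans ?_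
      rw [div_mul_eq_mul_div, div_mul_eq_mul_div]
      gcongr
      exact le_max_left _ _
    · have h3 := H s (R + 1) R (sector u u n m) (mulLp w hw f) (by linarith)
        (measurableSet_sector u u n m) ?_ (mulLp_localized hs f)
      · convert h3 using 3
        rw [abs_of_nonneg hs0]
        ring
      · rintro z ⟨hz1, hz2⟩
        rw [abs_of_nonneg hs0]
        nlinarith [mul_le_mul_of_nonneg_left hz2 hs0]

theorem tendsto_bandProj_two_mul {u : E d} (hu : u ≠ 0) (ψ : L2 d) :
    Tendsto (fun m : ℝ => ‖bandProj u (2 * m) ψ‖) (𝓝[>] 0) (𝓝 0) := by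
  refine (tendsto_bandProj hu ψ).comp (tendsto_nhdsWithin_iff.2 ⟨?_, ?_⟩)
  · have : Tendsto (fun m : ℝ => 2 * m) (𝓝 0) (𝓝 (2 * 0)) := tendsto_id.const_mul 2
    rw [mul_zero] at this
    exact this.mono_left nhdsWithin_le_nhds
  · filter_upwards [self_mem_nhdsWithin] with m hm0
    have : 0 < m := hm0
    exact mul_pos two_pos this

/-- The states prepared in outgoing regions span a dense subspace: a state orthogonal to all of them
has no momentum in the direction `±u`. -/
theorem eq_top_of_forall_observable_sector_mem
    (hη : tsupport (fourierU η) ⊆ Metric.closedBall 0 1) (hη1 : ∫ x, ‖η x‖ ^ 2 = 1)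
    (hu : u ≠ 0) (D : Submodule ℂ (L2 d)) (hD : IsClosed (D : Set (L2 d)))
    (hmem : ∀ v, v = u ∨ v = -u → ∀ m δ : ℝ, 0 < m → 0 < δ → δ * ‖v‖ ≤ m / 4 →
      ∀ (n : ℝ) (g : L2 d), observable η δ (sector v v n m) g ∈ D) : D = ⊤ := by
  have : CompleteSpace D := hD.completeSpace_coe
  rw [← Submodule.orthogonal_eq_bot_iff, Submodule.eq_bot_iff]
  intro ψ hψ
  have hu0 : 0 < ‖u‖ := norm_pos_iff.2 hu
  have key : ∀ m, 0 < m → ‖ψ‖ ≤ ‖bandProj u (2 * m) ψ‖ := by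
    intro m hm0
    -- with this `δ` the window smears momenta by at most `m`
    set δ := m / 4 / ‖u‖ with hδ
    have hδ0 : 0 < δ := by positivity
    have hδu : δ * ‖u‖ = m / 4 := div_mul_cancel₀ _ hu0.ne'
    have hm := measurable_rescale η δ
    have hh := memLp_rescale hη1 hδ0
    have h0 : ∀ v, v = u ∨ v = -u → ‖coeffOp hm hh {z | m ≤ inner ℝ z.2 v} ψ‖ = 0 := by
      intro v hv
      have hvu : ‖v‖ = ‖u‖ := by rcases hv with rfl | rfl <;> simp
      have h1 : ∀ n : ℕ, ∫⁻ z in sector v v (-n) m, ‖windowCoeff (rescale η δ) ψ z‖ₑ ^ 2 = 0 := by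
        intro n
        have h2 : coeffOp hm hh (sector v v (-n) m) ψ = 0 := by
          rw [← inner_self_eq_zero (𝕜 := ℂ), ← inner_observable hm hh]
          exact Submodule.inner_left_of_mem_orthogonal
            (hmem v hv m δ hm0 hδ0 (by rw [hvu, hδu]) _ _) hψ
        have h3 := enorm_coeffOp_sq hm hh (sector v v (-n) m) ψ
        rw [h2, enorm_zero, zero_pow two_ne_zero, eq_comm, mul_eq_zero] at h3
        refine h3.resolve_left ?_
        rw [ENNReal.ofReal_eq_zero, not_le]
        exact Real.rpow_pos_of_pos Real.two_pi_pos _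
      have h4 : {z : E d × E d | m ≤ inner ℝ z.2 v} = ⋃ n : ℕ, sector v v (-n) m := by
        ext z
        simp only [Set.mem_ofPred_eq, Set.mem_iUnion, sector]
        refine ⟨fun h => ?_, fun ⟨_, _, h⟩ => h⟩
        obtain ⟨n, hn⟩ := exists_nat_ge (-inner ℝ z.1 v)
        exact ⟨n, by linarith, h⟩
      have h5 : ‖coeffOp hm hh {z | m ≤ inner ℝ z.2 v} ψ‖ₑ ^ 2 = 0 := by
        rw [enorm_coeffOp_sq, h4]
        refine mul_eq_zero_of_right _ (nonpos_iff_eq_zero.1 ((lintegral_iUnion_le _ _).trans ?_))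
        simp [h1]
      rwa [sq_eq_zero_iff, enorm_eq_zero, ← norm_eq_zero] at h5
    have hcov : (Set.univ : Set (E d × E d)) ⊆ ({z | m ≤ inner ℝ z.2 u} ∪ {z | m ≤ inner ℝ z.2 (-u)}) ∪
        {z | |inner ℝ z.2 u| ≤ m} := by
      intro z _
      simp only [Set.mem_union, Set.mem_ofPred_eq, inner_neg_right]
      by_contra! hcon
      have := abs_le.2 ⟨by linarith [hcon.1.2], hcon.1.1.le⟩
      linarith [hcon.2]
    have h6 := norm_coeffOp_univ hm hh ψ
    rw [norm_toLp_rescale hη1 hδ0, one_mul] at h6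
    rw [← h6]
    refine (norm_coeffOp_mono hm hh hcov ψ).trans ((norm_coeffOp_union_le hm hh _ _ ψ).trans ?_)
    have h7 := norm_coeffOp_union_le hm hh {z | m ≤ inner ℝ z.2 u} {z | m ≤ inner ℝ z.2 (-u)} ψ
    rw [h0 u (Or.inl rfl), h0 (-u) (Or.inr rfl)] at h7
    have h8 := norm_coeffOp_le_bandProj hη hη1 hδ0 hm hh (u := u) (m := m) (a := 2 * m)
      (by rw [hδu]; linarith) (S := {z | |inner ℝ z.2 u| ≤ m})
      (measurableSet_le (by fun_prop) measurable_const) (fun z hz => hz) ψ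
    linarith
  have h10 : ‖ψ‖ ≤ 0 := ge_of_tendsto (tendsto_bandProj_two_mul hu ψ) (by
    filter_upwards [self_mem_nhdsWithin] with m hm0 using key m hm0)
  exact norm_le_zero_iff.1 h10

end Sectors

/-! ### The wave operator -/

section Wave

variable {d : ℕ} {η : 𝓢(E d, ℂ)} {δ : ℝ} {V : E d → ℝ} {u : E d} {R : ℝ}

theorem mem_waveMinus_graph (φ ψ : L2 d) : (φ, ψ) ∈ (waveMinus V).graph ↔
    Tendsto (fun t => propagator (hamiltonian V) (-t) (freeGroup d t φ)) atTop (𝓝 ψ) := by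
  rw [waveMinus, strongLim, Submodule.toLinearPMap_graph_eq _ (strongLimGraph_functional _),
    propagator_freeHamiltonian]
  rfl

theorem mem_waveMinus_domain (φ : L2 d) : φ ∈ (waveMinus V).domain ↔ ∃ ψ,
    Tendsto (fun t => propagator (hamiltonian V) (-t) (freeGroup d t φ)) atTop (𝓝 ψ) := by
  rw [LinearPMap.mem_domain_iff]
  simp only [mem_waveMinus_graph]

theorem mem_ranWaveMinus (ψ : L2 d) : ψ ∈ ranWaveMinus V ↔ ∃ φ,
    Tendsto (fun t => propagator (hamiltonian V) (-t) (freeGroup d t φ)) atTop (𝓝 ψ) := by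
  have h : ψ ∈ ranWaveMinus V ↔ ψ ∈ Set.range (waveMinus V) := Iff.rfl
  rw [h, LinearPMap.mem_range_iff]
  simp only [mem_waveMinus_graph]

theorem mem_hamiltonian_graph_of_free (hV : MemLp (fun x => (V x : ℂ)) ∞ volume)
    (ψ φ : L2 d) (h : (ψ, φ) ∈ (freeHamiltonian d).graph) :
    (ψ, φ + mulLp _ hV ψ) ∈ (hamiltonian V).graph := by
  rw [mem_hamiltonian_graph hV, add_sub_cancel_right]
  exact h

theorem mem_free_graph_of_hamiltonian (hV : MemLp (fun x => (V x : ℂ)) ∞ volume)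
    (ψ φ : L2 d) (h : (ψ, φ) ∈ (hamiltonian V).graph) :
    (ψ, φ + (-mulLp _ hV) ψ) ∈ (freeHamiltonian d).graph := by
  rw [mem_hamiltonian_graph hV] at h
  rwa [neg_apply, ← sub_eq_add_neg]

theorem isClosed_waveMinus_domain (hV : MemLp (fun x => (V x : ℂ)) ∞ volume) :
    IsClosed ((waveMinus V).domain : Set (L2 d)) := by
  have h := isClosed_setOf_exists_tendsto (T := fun t =>
    propagator (hamiltonian V) (-t) * freeGroup d t) (fun t x => by
      change ‖propagator (hamiltonian V) (-t) (freeGroup d t x)‖ ≤ _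
      rw [(isUnitaryGroupOf_hamiltonian hV).norm_apply, norm_freeGroup])
  convert h using 1
  ext φ
  exact mem_waveMinus_domain φ

/-- Existence of the wave operator, by Cook's method on the states prepared in outgoing regions. -/
theorem waveMinus_domain_eq_top (hη : tsupport (fourierU η) ⊆ Metric.closedBall 0 1)
    (hη1 : ∫ x, ‖η x‖ ^ 2 = 1) (hV : MemLp (fun x => (V x : ℂ)) ∞ volume) (hu : u ≠ 0)
    (hs : ∀ y, V y ≠ 0 → |inner ℝ y u| ≤ R) : (waveMinus V).domain = ⊤ := by
  refine eq_top_of_forall_observable_sector_mem hη hη1 hu _ (isClosed_waveMinus_domain hV) ?_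
  intro v hv m δ hm0 hδ hδv n g
  have hs' : ∀ y, (V y : ℂ) ≠ 0 → inner ℝ y v ≤ R := by
    intro y hy
    have h1 := hs y (by exact_mod_cast hy)
    rcases hv with rfl | rfl
    · exact (le_abs_self _).trans h1
    · rw [inner_neg_right]; exact (neg_le_abs _).trans h1
  obtain ⟨C, hC, H⟩ := exists_norm_mulLp_freeGroup_observable_le (hw := hV) hη hη1 hδ
    (fun x => Complex.conj_ofReal _) hs' hm0 hδv n g
  obtain ⟨ψ, hψ, -⟩ := isUnitaryGroupOf_freeGroup.cook (isUnitaryGroupOf_hamiltonian hV)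
    (mulLp _ hV) (mem_hamiltonian_graph_of_free hV) one_pos hm0 hC _ H
  exact (mem_waveMinus_domain _).2 ⟨ψ, hψ⟩

/-- Under the free evolution every state leaves every slab. -/
theorem tendsto_mulLp_freeGroup (hη : tsupport (fourierU η) ⊆ Metric.closedBall 0 1)
    (hη1 : ∫ x, ‖η x‖ ^ 2 = 1) {w : E d → ℂ} (hw : MemLp w ∞ volume)
    (hr : ∀ x, (starRingEnd ℂ) (w x) = w x) (hu : u ≠ 0)
    (hs : ∀ y, w y ≠ 0 → |inner ℝ y u| ≤ R) (φ : L2 d) :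
    Tendsto (fun t => mulLp w hw (freeGroup d t φ)) atTop (𝓝 0) := by
  let D : Submodule ℂ (L2 d) :=
    { carrier := {φ | Tendsto (fun t => mulLp w hw (freeGroup d t φ)) atTop (𝓝 0)}
      zero_mem' := by simp
      add_mem' := by
        intro a b ha hb
        simpa using Tendsto.add ha hb
      smul_mem' := by
        intro c a ha
        simpa using Tendsto.const_smul ha c }
  have hD : IsClosed (D : Set (L2 d)) :=
    isClosed_setOf_tendsto_zero (T := fun t => mulLp w hw ∘L freeGroup d t) (M := ‖mulLp w hw‖)
      (fun t x => ((mulLp w hw).le_opNorm _).trans_eq (congrArg _ (norm_freeGroup t x)))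
  have htop : D = ⊤ := by
    refine eq_top_of_forall_observable_sector_mem hη hη1 hu D hD ?_
    intro v hv m δ hm0 hδ hδv n g
    have hs' : ∀ y, w y ≠ 0 → inner ℝ y v ≤ R := by
      intro y hy
      have h1 := hs y hy
      rcases hv with rfl | rfl
      · exact (le_abs_self _).trans h1
      · rw [inner_neg_right]; exact (neg_le_abs _).trans h1
    obtain ⟨C, hC, H⟩ := exists_norm_mulLp_freeGroup_observable_le (hw := hw) hη hη1 hδ
      hr hs' hm0 hδv n g
    have h1 : Tendsto (fun s : ℝ => C / (1 + m * s) ^ 2) atTop (𝓝 0) := by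
      refine tendsto_const_nhds.div_atTop ((tendsto_pow_atTop two_ne_zero).comp ?_)
      exact tendsto_atTop_add_const_left _ _ (tendsto_id.const_mul_atTop hm0)
    exact squeeze_zero_norm' (by filter_upwards [eventually_ge_atTop 0] with s hs using H s hs) h1
  have : φ ∈ D := by rw [htop]; trivial
  exact this

theorem norm_eq_of_tendsto_wave (hV : MemLp (fun x => (V x : ℂ)) ∞ volume) {φ ψ : L2 d}
    (h : Tendsto (fun t => propagator (hamiltonian V) (-t) (freeGroup d t φ)) atTop (𝓝 ψ)) :
    ‖ψ‖ = ‖φ‖ := by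
  refine tendsto_nhds_unique h.norm (tendsto_const_nhds.congr fun t => ?_)
  rw [(isUnitaryGroupOf_hamiltonian hV).norm_apply, norm_freeGroup]

theorem isClosed_ranWaveMinus (hV : MemLp (fun x => (V x : ℂ)) ∞ volume) :
    IsClosed (ranWaveMinus V : Set (L2 d)) := by
  have : CompleteSpace (waveMinus V).domain := (isClosed_waveMinus_domain hV).completeSpace_coe
  let W : (waveMinus V).domain →ₗᵢ[ℂ] L2 d :=
    { toLinearMap := (waveMinus V).toFun
      norm_map' := fun x => norm_eq_of_tendsto_wave hV
        ((mem_waveMinus_graph _ _).1 ((waveMinus V).mem_graph x)) }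
  have h := W.isometry.isClosedEmbedding.isClosed_range
  exact h

/-- The range of the wave operator is invariant under the full evolution. -/
theorem propagator_mem_ranWaveMinus (hV : MemLp (fun x => (V x : ℂ)) ∞ volume) (s : ℝ) {ψ : L2 d}
    (hψ : ψ ∈ ranWaveMinus V) : propagator (hamiltonian V) s ψ ∈ ranWaveMinus V := by
  obtain ⟨φ, hφ⟩ := (mem_ranWaveMinus ψ).1 hψ
  have hH := isUnitaryGroupOf_hamiltonian hV
  refine (mem_ranWaveMinus _).2 ⟨freeGroup d s φ, ?_⟩
  have h1 := ((propagator (hamiltonian V) s).continuous.tendsto ψ).comp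
    (hφ.comp (tendsto_atTop_add_const_right _ s tendsto_id))
  refine h1.congr fun t => ?_
  simp only [Function.comp_apply, id]
  rw [← hH.apply_add, isUnitaryGroupOf_freeGroup.apply_add]
  congr 2
  ring

theorem propagator_mem_orthogonal (hV : MemLp (fun x => (V x : ℂ)) ∞ volume) (s : ℝ) {χ : L2 d}
    (hχ : χ ∈ (ranWaveMinus V)ᗮ) : propagator (hamiltonian V) s χ ∈ (ranWaveMinus V)ᗮ := by
  rw [Submodule.mem_orthogonal'] at hχ ⊢
  intro ψ hψ
  rw [(isUnitaryGroupOf_hamiltonian hV).inner_left]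
  exact hχ _ (propagator_mem_ranWaveMinus hV _ hψ)

/-! ### States orthogonal to the range of the wave operator -/

/-- A state orthogonal to the range of the wave operator is small in outgoing regions: there `1 - Ω`
is small. -/
theorem exists_norm_coeffOp_outgoing_le (hη : tsupport (fourierU η) ⊆ Metric.closedBall 0 1)
    (hη1 : ∫ x, ‖η x‖ ^ 2 = 1) (hδ : 0 < δ) (hm : Measurable (rescale η δ))
    (hh : MemLp (rescale η δ) 2 volume) (hV : MemLp (fun x => (V x : ℂ)) ∞ volume)
    (hs : ∀ y, V y ≠ 0 → |inner ℝ y u| ≤ R)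
    {m : ℝ} (hm0 : 0 < m) (hu : δ * ‖u‖ ≤ m / 2) : ∃ C : ℝ, 0 ≤ C ∧ ∀ n, R < n →
      ∀ χ ∈ (ranWaveMinus V)ᗮ,
        ‖coeffOp hm hh (sector u u n m) χ‖ ^ 2 ≤ C / (n - R) * ‖χ‖ ^ 2 := by
  obtain ⟨C, hC, H⟩ := exists_norm_coeffOp_freeGroup_le hη hδ hm hh hm0 hu
  set K := mulLp _ hV with hK
  refine ⟨C * ‖K‖ / (2 * m), by positivity, fun n hn χ hχ => ?_⟩
  have hn' : 0 < n - R := sub_pos.2 hn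
  set f := observable η δ (sector u u n m) χ with hf
  have hs' : ∀ y, (V y : ℂ) ≠ 0 → inner ℝ y u ≤ R := fun y hy =>
    (le_abs_self _).trans (hs y (by exact_mod_cast hy))
  have h1 : ∀ s, 0 ≤ s → ‖K (freeGroup d s f)‖ ≤
      (C * ‖K‖ * ‖χ‖) / ((n - R) + 2 * m * s) ^ 2 := by
    intro s hs0
    have h2 := norm_mulLp_freeGroup_observable_le (hw := hV) hη1 hδ hm hh
      (fun x => Complex.conj_ofReal _) (S := sector u u n m) (τ := s)
      (b := C / (n - R + 2 * m * s) ^ 2) (fun g => ?_) (by positivity) χ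
    · refine h2.trans (le_of_eq ?_)
      ring
    · have h3 := H s n R (sector u u n m) (mulLp _ hV g) hn (measurableSet_sector u u n m) ?_
        (mulLp_localized hs' g)
      · rwa [abs_of_nonneg hs0] at h3
      · rintro z ⟨hz1, hz2⟩
        rw [abs_of_nonneg hs0]
        nlinarith [mul_le_mul_of_nonneg_left hz2 hs0]
  obtain ⟨ψ, hψ, hd⟩ := isUnitaryGroupOf_freeGroup.cook (isUnitaryGroupOf_hamiltonian hV)
    K (mem_hamiltonian_graph_of_free hV) hn' (by positivity : 0 < 2 * m) (by positivity) f h1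
  have hψr : ψ ∈ ranWaveMinus V := (mem_ranWaveMinus _).2 ⟨f, hψ⟩
  have h4 : (inner ℂ χ (f - ψ) : ℂ) = inner ℂ (coeffOp hm hh (sector u u n m) χ)
      (coeffOp hm hh (sector u u n m) χ) := by
    rw [inner_sub_right, (Submodule.mem_orthogonal' _ _).1 hχ ψ hψr, sub_zero,
      inner_observable hm hh]
  have h5 : ‖coeffOp hm hh (sector u u n m) χ‖ ^ 2 = ‖(inner ℂ χ (f - ψ) : ℂ)‖ := by
    rw [h4, inner_self_eq_norm_sq_to_K]; simp
  rw [h5]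
  refine (norm_inner_le_norm _ _).trans ?_
  rw [norm_sub_rev]
  refine (mul_le_mul_of_nonneg_left hd (norm_nonneg χ)).trans (le_of_eq ?_)
  field_simp

/-- In incoming regions the full evolution stays close to the free one: what is there at a time
`t ≥ 0` cannot have interacted with the potential since the time `0`. -/
theorem exists_norm_coeffOp_incoming_le (hη : tsupport (fourierU η) ⊆ Metric.closedBall 0 1)
    (hδ : 0 < δ) (hm : Measurable (rescale η δ))
    (hh : MemLp (rescale η δ) 2 volume) (hV : MemLp (fun x => (V x : ℂ)) ∞ volume)
    (hs : ∀ y, V y ≠ 0 → |inner ℝ y u| ≤ R)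
    {m : ℝ} (hm0 : 0 < m) (hu : δ * ‖u‖ ≤ m / 2) : ∃ C : ℝ, 0 ≤ C ∧ ∀ n, R < n →
      ∀ t, 0 ≤ t → ∀ χ : L2 d,
        ‖coeffOp hm hh (sector u (-u) n m) (propagator (hamiltonian V) t χ)‖ ≤
          ‖coeffOp hm hh (sector u (-u) n m) (freeGroup d t χ)‖ + C / (n - R) * ‖χ‖ := by
  obtain ⟨C, hC, H⟩ := exists_norm_coeffOp_freeGroup_le hη hδ hm hh hm0 hu
  have hH := isUnitaryGroupOf_hamiltonian hV
  have hF := isUnitaryGroupOf_freeGroup (d := d)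
  set K := mulLp _ hV with hK
  refine ⟨C * ‖K‖ / (2 * m), by positivity, fun n hn t ht χ => ?_⟩
  have hn' : 0 < n - R := sub_pos.2 hn
  set L := coeffOp hm hh (sector u (-u) n m) with hL
  set G : ℝ → L2 d := fun s =>
    freeGroup d (t - s) (Complex.I • (-K) (propagator (hamiltonian V) s χ)) with hG
  have hs' : ∀ y, (V y : ℂ) ≠ 0 → inner ℝ y u ≤ R := fun y hy =>
    (le_abs_self _).trans (hs y (by exact_mod_cast hy))
  have hKc : Continuous fun s => Complex.I • (-K) (propagator (hamiltonian V) s χ) := by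
    have h0 : Continuous fun s => (-K) (propagator (hamiltonian V) s χ) :=
      (-K).continuous.comp (hH.continuous χ)
    exact h0.const_smul Complex.I
  have hGc : Continuous G := hF.continuous_apply (continuous_const.sub continuous_id) hKc
  have h1 : propagator (hamiltonian V) t χ = freeGroup d t χ + ∫ s in (0 : ℝ)..t, G s := by
    have h2 := congrArg (freeGroup d t)
      (hH.duhamel hF (-K) (mem_free_graph_of_hamiltonian hV) χ t)
    rw [hF.apply_neg_self, map_add] at h2
    rw [h2, ← ContinuousLinearMap.intervalIntegral_comp_comm]
    · congr 1
      refine intervalIntegral.integral_congr fun s _ => ?_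
      simp only [hG, sub_eq_add_neg, hF.apply_add]
    · refine Continuous.intervalIntegrable ?_ _ _
      exact hF.continuous_apply continuous_neg hKc
  have h3 : ∀ s ∈ Set.Ioc 0 t, ‖L (G s)‖ ≤ C * ‖K‖ * ‖χ‖ / ((n - R) + 2 * m * (t - s)) ^ 2 := by
    intro s hs0
    have hts : 0 ≤ t - s := sub_nonneg.2 hs0.2
    have e1 : ‖L (G s)‖ = ‖L (freeGroup d (-(-(t - s))) (K (propagator (hamiltonian V) s χ)))‖ := by
      simp only [hG, neg_neg, map_smul, neg_apply, map_neg, smul_neg, norm_neg, norm_smul,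
        Complex.norm_I, one_mul]
    rw [e1]
    have h4 := H (-(t - s)) n R (sector u (-u) n m) (K (propagator (hamiltonian V) s χ)) hn
      (measurableSet_sector _ _ _ _) ?_ (mulLp_localized hs' _)
    · rw [abs_neg, abs_of_nonneg hts] at h4
      refine h4.trans ?_
      rw [div_mul_eq_mul_div, mul_assoc C]
      gcongr
      refine (K.le_opNorm _).trans_eq ?_
      rw [hH.norm_apply]
    · rintro z ⟨hz1, hz2⟩
      rw [inner_neg_right] at hz2
      rw [abs_neg, abs_of_nonneg hts]
      nlinarith [mul_le_mul_of_nonneg_left hz2 hts]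
  have h5 : ‖L (∫ s in (0 : ℝ)..t, G s)‖ ≤ C * ‖K‖ * ‖χ‖ / ((n - R) * (2 * m)) := by
    rw [← ContinuousLinearMap.intervalIntegral_comp_comm _ (hGc.intervalIntegrable _ _)]
    refine le_trans ?_ (intervalIntegral_inv_sq_le hn' (by positivity : 0 < 2 * m)
      (by positivity : 0 ≤ C * ‖K‖ * ‖χ‖) ht)
    have e2 := intervalIntegral.integral_comp_sub_left (a := 0) (b := t)
      (fun s => C * ‖K‖ * ‖χ‖ / ((n - R) + 2 * m * s) ^ 2) t
    rw [sub_self, sub_zero] at e2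
    rw [← e2]
    refine intervalIntegral.norm_integral_le_of_norm_le ht (ae_of_all _ h3) ?_
    refine ContinuousOn.intervalIntegrable_of_Icc ht ?_
    refine ContinuousOn.div (by fun_prop) (by fun_prop) fun s hs0 => ?_
    have : 0 ≤ t - s := sub_nonneg.2 hs0.2
    positivity
  rw [h1, map_add]
  refine (norm_add_le _ _).trans (add_le_add le_rfl (h5.trans (le_of_eq ?_)))
  field_simp

/-- The half space `⟨y, u⟩ ≤ R`. -/
def halfSpace (u : E d) (R : ℝ) : Set (E d) := {y | inner ℝ y u ≤ R}

theorem measurableSet_halfSpace (u : E d) (R : ℝ) : MeasurableSet (halfSpace u R) :=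
  measurableSet_le (by fun_prop) measurable_const

/-- Every state is localized in a large half space. -/
theorem tendsto_sub_mulLp_halfSpace (u : E d) (χ : L2 d) :
    Tendsto (fun R : ℝ => ‖χ - mulLp _ (memLp_top_indicator_one (measurableSet_halfSpace u R)) χ‖)
      atTop (𝓝 0) := by
  have h1 : Tendsto (fun R : ℝ =>
      χ - mulLp _ (memLp_top_indicator_one (measurableSet_halfSpace u R)) χ) atTop (𝓝 0) := by
    refine tendsto_zero_of_dominated _
      (fun R y => χ y - (halfSpace u R).indicator (fun _ => (1 : ℂ)) y * χ y)
      (fun y => ‖χ y‖) (fun R => ?_) (Lp.memLp χ).norm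
      (Eventually.of_forall fun R => ae_of_all _ fun y => ?_) (ae_of_all _ fun y => ?_)
    · filter_upwards [Lp.coeFn_sub χ
        (mulLp _ (memLp_top_indicator_one (measurableSet_halfSpace u R)) χ),
        coeFn_mulLp _ (memLp_top_indicator_one (measurableSet_halfSpace u R)) χ] with y h1 h2
      rw [h1, Pi.sub_apply, h2]
    · by_cases hy : y ∈ halfSpace u R <;> simp [hy]
    · refine tendsto_const_nhds.congr' ?_
      filter_upwards [eventually_ge_atTop (inner ℝ y u)] with R hR
      have : y ∈ halfSpace u R := hR
      simp [this]
  simpa using h1.norm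

theorem eventually_norm_coeffOp_freeGroup_incoming_le
    (hη : tsupport (fourierU η) ⊆ Metric.closedBall 0 1) (hη1 : ∫ x, ‖η x‖ ^ 2 = 1)
    (hδ : 0 < δ) (hm : Measurable (rescale η δ)) (hh : MemLp (rescale η δ) 2 volume)
    {m : ℝ} (hm0 : 0 < m) (hu : δ * ‖u‖ ≤ m / 2) (χ : L2 d) {ε : ℝ} (hε : 0 < ε) :
    ∀ᶠ n in atTop, ∀ t, 0 ≤ t →
      ‖coeffOp hm hh (sector u (-u) n m) (freeGroup d t χ)‖ ≤ ε := by
  obtain ⟨C, hC, H⟩ := exists_norm_coeffOp_freeGroup_le hη hδ hm hh hm0 hu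
  -- cut off the initial state at distance `n / 2`, which grows but stays far from `n`
  have hhalf : Tendsto (fun n : ℝ => n / 2) atTop atTop := tendsto_id.atTop_div_const two_pos
  have h1 := (tendsto_sub_mulLp_halfSpace u χ).comp hhalf
  have h2 : Tendsto (fun n : ℝ => C / (n / 2) ^ 2 * ‖χ‖) atTop (𝓝 (0 * ‖χ‖)) := by
    refine Tendsto.mul_const _ ?_
    exact tendsto_const_nhds.div_atTop ((tendsto_pow_atTop two_ne_zero).comp hhalf)
  rw [zero_mul] at h2
  filter_upwards [h1.eventually_le_const (half_pos hε), h2.eventually_le_const (half_pos hε),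
    eventually_gt_atTop 0] with n hn1 hn2 hn0 t ht
  set K := mulLp _ (memLp_top_indicator_one (measurableSet_halfSpace u (n / 2))) with hK
  set L := coeffOp hm hh (sector u (-u) n m) with hL
  have hKn : ‖K χ‖ ≤ ‖χ‖ := by
    refine (norm_mulLp_le _ (C := 1) (ae_of_all _ fun y => ?_) χ).trans_eq (one_mul _)
    refine (norm_indicator_le_norm_self _ _).trans ?_
    simp
  have h3 : ‖L (freeGroup d t (χ - K χ))‖ ≤ ε / 2 := by
    refine (norm_coeffOp_le hm hh _ _).trans ?_
    rw [norm_toLp_rescale hη1 hδ, one_mul, norm_freeGroup]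
    exact hn1
  have h4 : ‖L (freeGroup d t (K χ))‖ ≤ ε / 2 := by
    have h5 := H (-t) n (n / 2) (sector u (-u) n m) (K χ) (by linarith)
      (measurableSet_sector _ _ _ _) ?_ ?_
    · rw [neg_neg, abs_neg, abs_of_nonneg ht] at h5
      refine (h5.trans ?_).trans hn2
      have : n / 2 ≤ n - n / 2 + 2 * m * t := by nlinarith [mul_nonneg hm0.le ht]
      gcongr
    · rintro z ⟨hz1, hz2⟩
      rw [inner_neg_right] at hz2
      rw [abs_neg, abs_of_nonneg ht]
      nlinarith [mul_le_mul_of_nonneg_left hz2 ht]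
    · refine mulLp_localized (fun y hy => ?_) χ
      by_contra hcon
      exact hy (Set.indicator_of_notMem (s := halfSpace u (n / 2)) hcon _)
  calc ‖L (freeGroup d t χ)‖ = ‖L (freeGroup d t (χ - K χ)) + L (freeGroup d t (K χ))‖ := by
        rw [← map_add, ← map_add, sub_add_cancel]
    _ ≤ ε := (norm_add_le _ _).trans (by linarith)

/-- A state orthogonal to the range of the wave operator never reaches the regions with a large
position and a nonzero momentum in the direction `u`. -/
theorem eventually_norm_coeffOp_sector_le (hη : tsupport (fourierU η) ⊆ Metric.closedBall 0 1)
    (hη1 : ∫ x, ‖η x‖ ^ 2 = 1) (hδ : 0 < δ) (hm : Measurable (rescale η δ))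
    (hh : MemLp (rescale η δ) 2 volume) (hV : MemLp (fun x => (V x : ℂ)) ∞ volume)
    (hs : ∀ y, V y ≠ 0 → |inner ℝ y u| ≤ R)
    {m : ℝ} (hm0 : 0 < m) (hu : δ * ‖u‖ ≤ m / 2) {v : E d} (hv : v = u ∨ v = -u) {χ : L2 d}
    (hχ : χ ∈ (ranWaveMinus V)ᗮ) {ε : ℝ} (hε : 0 < ε) :
    ∀ᶠ n in atTop, ∀ t, 0 ≤ t →
      ‖coeffOp hm hh (sector u v n m) (propagator (hamiltonian V) t χ)‖ ≤ ε := by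
  have hlim : ∀ C a : ℝ, Tendsto (fun n : ℝ => C / (n - R) * a) atTop (𝓝 0) := by
    intro C a
    have h : Tendsto (fun n : ℝ => C / (n - R) * a) atTop (𝓝 (0 * a)) :=
      (tendsto_const_nhds.div_atTop (tendsto_atTop_add_const_right _ (-R) tendsto_id)).mul_const a
    rwa [zero_mul] at h
  rcases hv with rfl | rfl
  · obtain ⟨C, hC, H⟩ := exists_norm_coeffOp_outgoing_le hη hη1 hδ hm hh hV hs hm0 hu
    filter_upwards [(hlim C (‖χ‖ ^ 2)).eventually_le_const (pow_pos hε 2), eventually_gt_atTop R]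
      with n hn1 hn2 t ht
    have h1 := H n hn2 _ (propagator_mem_orthogonal hV t hχ)
    rw [(isUnitaryGroupOf_hamiltonian hV).norm_apply] at h1
    exact le_of_sq_le_sq (h1.trans hn1) hε.le
  · obtain ⟨C, hC, H⟩ := exists_norm_coeffOp_incoming_le hη hδ hm hh hV hs hm0 hu
    filter_upwards [(hlim C ‖χ‖).eventually_le_const (half_pos hε), eventually_gt_atTop R,
      eventually_norm_coeffOp_freeGroup_incoming_le hη hη1 hδ hm hh hm0 hu χ (half_pos hε)]
      with n hn1 hn2 hn3 t ht
    have h1 := H n hn2 t ht χ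
    have h2 := hn3 t ht
    linarith

end Wave

/-! ### Covering the far region by sectors -/

section Geometry

variable {k l : ℕ}

/-- The inclusion `w ↦ (0, w)` of `ℝˡ` into `ℝᵏ × ℝˡ`. -/
def liftPerp (k : ℕ) (w : E l) : E (k + l) := WithLp.toLp 2 (Fin.append 0 w)

theorem inner_liftPerp (y : E (k + l)) (w : E l) :
    inner ℝ y (liftPerp k w) = inner ℝ (perp y) w := by
  simp [PiLp.inner_apply, Fin.sum_univ_add, liftPerp, perp]

theorem perp_liftPerp (w : E l) : perp (liftPerp k w) = w := by
  ext i
  simp [perp, liftPerp]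

theorem norm_liftPerp (w : E l) : ‖liftPerp k w‖ = ‖w‖ := by
  have h : ‖liftPerp k w‖ ^ 2 = ‖w‖ ^ 2 := by
    rw [← real_inner_self_eq_norm_sq, inner_liftPerp, perp_liftPerp, real_inner_self_eq_norm_sq]
  exact (sq_eq_sq₀ (norm_nonneg _) (norm_nonneg _)).1 h

theorem abs_inner_liftPerp_le (y : E (k + l)) (w : E l) :
    |inner ℝ y (liftPerp k w)| ≤ ‖perp y‖ * ‖w‖ := by
  rw [inner_liftPerp]
  exact abs_real_inner_le_norm _ _

/-- The sign attached to a Boolean. -/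
def sgn (b : Bool) : ℝ := if b then 1 else -1

theorem abs_sgn (b : Bool) : |sgn b| = 1 := by cases b <;> simp [sgn]

theorem exists_sgn_mul_eq_abs (x : ℝ) : ∃ b, sgn b * x = |x| := by
  rcases le_total 0 x with h | h
  · exact ⟨true, by simp [sgn, abs_of_nonneg h]⟩
  · exact ⟨false, by simp [sgn, abs_of_nonpos h]⟩

/-- The finitely many transverse directions `±eᵢ ± eⱼ/2`. -/
def direction (q : Fin l × Fin l × Bool × Bool) : E l :=
  EuclideanSpace.single q.1 (sgn q.2.2.1) + EuclideanSpace.single q.2.1 (sgn q.2.2.2 / 2)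

theorem norm_direction_le (q : Fin l × Fin l × Bool × Bool) : ‖direction q‖ ≤ 3 / 2 := by
  refine (norm_add_le _ _).trans ?_
  rw [PiLp.norm_single, PiLp.norm_single, norm_div, Real.norm_eq_abs,
    Real.norm_eq_abs, abs_sgn, abs_sgn]
  norm_num

theorem inner_direction (x : E l) (q : Fin l × Fin l × Bool × Bool) :
    inner ℝ x (direction q) = sgn q.2.2.1 * x q.1 + sgn q.2.2.2 * x q.2.1 / 2 := by
  simp only [direction, inner_add_right, EuclideanSpace.inner_single_right, conj_trivial]
  ring

theorem exists_max_coord (hl : 1 ≤ l) (x : E l) :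
    ∃ i, (∀ j, |x j| ≤ |x i|) ∧ ‖x‖ ≤ l * |x i| := by
  obtain ⟨i, -, hi⟩ := Finset.exists_max_image Finset.univ (fun i => |x i|)
    ⟨(⟨0, hl⟩ : Fin l), Finset.mem_univ _⟩
  refine ⟨i, fun j => hi j (Finset.mem_univ j), ?_⟩
  have hl' : (1 : ℝ) ≤ l := by exact_mod_cast hl
  refine le_of_sq_le_sq ?_ (by positivity)
  rw [EuclideanSpace.norm_sq_eq]
  calc ∑ j, ‖x j‖ ^ 2 ≤ ∑ _j : Fin l, |x i| ^ 2 := by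
        refine Finset.sum_le_sum fun j _ => ?_
        rw [Real.norm_eq_abs]
        exact pow_le_pow_left₀ (abs_nonneg _) (hi j (Finset.mem_univ j)) 2
    _ = l * |x i| ^ 2 := by simp
    _ ≤ (l * |x i|) ^ 2 := by
        rw [mul_pow]
        gcongr
        nlinarith

/-- Two vectors are simultaneously nonorthogonal to one of the directions, in a quantitative way:
take the largest coordinates `xᵢ` and `pⱼ`, and choose the signs so as to avoid cancellation. -/
theorem exists_direction (hl : 1 ≤ l) (x p : E l) : ∃ q : Fin l × Fin l × Bool × Bool,
    ‖x‖ / (2 * l) ≤ inner ℝ x (direction q) ∧ ‖p‖ / (2 * l) ≤ |inner ℝ p (direction q)| := by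
  have hl' : (0 : ℝ) < 2 * l := by
    have : (1 : ℝ) ≤ l := by exact_mod_cast hl
    linarith
  obtain ⟨i, hi, hi'⟩ := exists_max_coord hl x
  obtain ⟨j, -, hj'⟩ := exists_max_coord hl p
  obtain ⟨σ, hσ⟩ := exists_sgn_mul_eq_abs (x i)
  have hτ : ∃ τ, |p j| / 2 ≤ |sgn σ * p i + sgn τ * p j / 2| := by
    rcases le_total 0 (sgn σ * p i) with h | h
    · obtain ⟨τ, hτ⟩ := exists_sgn_mul_eq_abs (p j)
      refine ⟨τ, le_trans ?_ (le_abs_self _)⟩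
      linarith
    · obtain ⟨τ, hτ⟩ := exists_sgn_mul_eq_abs (-p j)
      refine ⟨τ, le_trans ?_ (neg_le_abs _)⟩
      rw [abs_neg] at hτ
      linarith
  obtain ⟨τ, hτ⟩ := hτ
  refine ⟨(i, j, σ, τ), ?_, ?_⟩
  · rw [inner_direction, div_le_iff₀ hl']
    simp only [hσ]
    have h1 : -|x i| ≤ sgn τ * x j := by
      have := neg_abs_le (sgn τ * x j)
      rw [abs_mul, abs_sgn, one_mul] at this
      linarith [hi j]
    have h2 : |x i| / 2 ≤ |x i| + sgn τ * x j / 2 := by linarith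
    nlinarith
  · rw [inner_direction, div_le_iff₀ hl']
    simp only
    nlinarith

theorem farSet_subset (hl : 1 ≤ l) (n m : ℝ) : farSet k l n m ⊆
    ⋃ q ∈ (Finset.univ : Finset ((Fin l × Fin l × Bool × Bool) × Bool)),
      sector (liftPerp k (direction q.1)) (sgn q.2 • liftPerp k (direction q.1))
        (n / (2 * l)) (m / (2 * l)) := by
  rintro ⟨x, p⟩ ⟨hx, hp⟩
  obtain ⟨q, h1, h2⟩ := exists_direction hl (perp x) (perp p)
  obtain ⟨b, hb⟩ := exists_sgn_mul_eq_abs (inner ℝ (perp p) (direction q))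
  simp only [Set.mem_iUnion, Finset.mem_univ, exists_prop, true_and]
  refine ⟨(q, b), ?_, ?_⟩
  · rw [inner_liftPerp]
    refine le_trans ?_ h1
    gcongr
  · rw [inner_smul_right, inner_liftPerp, hb]
    refine le_trans ?_ h2
    gcongr

theorem measurableSet_farSet (n m : ℝ) : MeasurableSet (farSet k l n m) := by
  have h : Continuous (perp : E (k + l) → E l) := by unfold perp; fun_prop
  exact MeasurableSet.inter (measurableSet_lt measurable_const (h.comp continuous_fst).norm.measurable)
    (measurableSet_lt measurable_const (h.comp continuous_snd).norm.measurable)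

end Geometry

/-! ### Position localization -/

section Position

variable {d : ℕ} {h : E d → ℂ} {u : E d}

theorem measurableSet_lt_abs_inner (u : E d) (r : ℝ) : MeasurableSet {z : E d | r < |inner ℝ z u|} :=
  measurableSet_lt measurable_const (by fun_prop)

theorem tendsto_norm_indicator_toLp (hh : MemLp h 2 volume) :
    Tendsto (fun r => ‖(hh.indicator (measurableSet_lt_abs_inner u r)).toLp _‖) atTop (𝓝 0) := by
  have h1 : Tendsto (fun r => (hh.indicator (measurableSet_lt_abs_inner u r)).toLp _) atTop
      (𝓝 0) := by
    refine tendsto_zero_of_dominated _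
      (fun r z => {z : E d | r < |inner ℝ z u|}.indicator h z)
      (fun z => ‖h z‖) (fun r => MemLp.coeFn_toLp _) hh.norm
      (Eventually.of_forall fun r => ae_of_all _ fun z => norm_indicator_le_norm_self _ _)
      (ae_of_all _ fun z => ?_)
    refine tendsto_const_nhds.congr' ?_
    filter_upwards [eventually_ge_atTop |inner ℝ z u|] with r hr
    exact (Set.indicator_of_notMem (s := {z : E d | r < |inner ℝ z u|}) (not_lt.2 hr) h).symm
  simpa using h1.norm

/-- At positions `|⟨x, u⟩| ≤ n`, only the tail of the window sees a state localized in
`|⟨y, u⟩| > R`. -/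
theorem norm_coeffOp_position_le (hm : Measurable h) (hh : MemLp h 2 volume) {n R : ℝ}
    {S : Set (E d × E d)} (hS : MeasurableSet S) (hx : ∀ z ∈ S, |inner ℝ z.1 u| ≤ n) (g : L2 d)
    (hg : ∀ᵐ y, g y ≠ 0 → R < |inner ℝ y u|) : ‖coeffOp hm hh S g‖ ≤
      ‖(hh.indicator (measurableSet_lt_abs_inner u (R - n))).toLp _‖ * ‖g‖ := by
  have hcm := hm.indicator (measurableSet_lt_abs_inner u (R - n))
  rw [← norm_coeffOp_univ hcm]
  refine norm_le_of_enorm_sq_le (norm_nonneg _) ?_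
  rw [ofReal_norm_sq, enorm_coeffOp_sq, enorm_coeffOp_sq, Measure.restrict_univ]
  refine mul_le_mul_right ?_ _
  refine (setLIntegral_mono' hS ?_).trans (setLIntegral_le_lintegral S _)
  rintro ⟨x, p⟩ hz
  have hz' : |inner ℝ x u| ≤ n := hx _ hz
  refine le_of_eq (congrArg (fun c : ℂ => ‖c‖ₑ ^ 2) ?_)
  refine integral_congr_ae ?_
  filter_upwards [hg] with y hy
  by_cases hgy : g y = 0
  · simp [hgy]
  · have hmem : y - x ∈ {z : E d | R - n < |inner ℝ z u|} := by
      have h1 := hy hgy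
      change R - n < |inner ℝ (y - x) u|
      rw [inner_sub_left]
      have := abs_sub_abs_le_abs_sub (inner ℝ y u) (inner ℝ x u)
      linarith
    simp only [Set.indicator_of_mem hmem]

variable {η : 𝓢(E d, ℂ)} {δ : ℝ}

/-- Under the free evolution the coherent state coefficients leave every slab. -/
theorem tendsto_coeffOp_position (hη : tsupport (fourierU η) ⊆ Metric.closedBall 0 1)
    (hη1 : ∫ x, ‖η x‖ ^ 2 = 1) (hδ : 0 < δ) (hm : Measurable (rescale η δ))
    (hh : MemLp (rescale η δ) 2 volume) (hu : u ≠ 0) {n : ℝ} {S : Set (E d × E d)}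
    (hS : MeasurableSet S) (hx : ∀ z ∈ S, |inner ℝ z.1 u| ≤ n) (φ : L2 d) :
    Tendsto (fun t => ‖coeffOp hm hh S (freeGroup d t φ)‖) atTop (𝓝 0) := by
  rw [Metric.tendsto_nhds]
  intro ε hε
  have h1 : Tendsto (fun R => ‖(hh.indicator (measurableSet_lt_abs_inner u (R - n))).toLp _‖ * ‖φ‖)
      atTop (𝓝 (0 * ‖φ‖)) :=
    ((tendsto_norm_indicator_toLp hh).comp
      (tendsto_atTop_add_const_right _ (-n) tendsto_id)).mul_const _
  rw [zero_mul] at h1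
  obtain ⟨R, hR⟩ := (h1.eventually_lt_const (half_pos hε)).exists
  have hA : MeasurableSet {y : E d | |inner ℝ y u| ≤ R} :=
    measurableSet_le (by fun_prop) measurable_const
  set K := mulLp _ (memLp_top_indicator_one hA) with hK
  have h2 : Tendsto (fun t => ‖K (freeGroup d t φ)‖) atTop (𝓝 0) := by
    have := (tendsto_mulLp_freeGroup hη hη1 (memLp_top_indicator_one hA) (fun y => ?_) hu
      (R := R) (fun y hy => ?_) φ).norm
    · simpa using this
    · by_cases hy : y ∈ {y : E d | |inner ℝ y u| ≤ R} <;> simp [Set.indicator, hy]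
    · by_contra hcon
      exact hy (Set.indicator_of_notMem (s := {y : E d | |inner ℝ y u| ≤ R}) hcon _)
  filter_upwards [h2.eventually_lt_const (half_pos hε)] with t ht
  set g := freeGroup d t φ with hg
  have h3 : ‖coeffOp hm hh S (K g)‖ < ε / 2 := by
    refine (norm_coeffOp_le hm hh _ _).trans_lt ?_
    rwa [norm_toLp_rescale hη1 hδ, one_mul]
  have h4 : ∀ᵐ y, (g - K g) y = if |inner ℝ y u| ≤ R then 0 else g y := by
    filter_upwards [Lp.coeFn_sub g (K g), coeFn_mulLp _ (memLp_top_indicator_one hA) g]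
      with y e1 e2
    rw [e1, Pi.sub_apply, e2]
    by_cases hy : |inner ℝ y u| ≤ R <;> simp [Set.indicator, hy]
  have h5 : ‖coeffOp hm hh S (g - K g)‖ < ε / 2 := by
    refine (norm_coeffOp_position_le (R := R) hm hh hS hx _ ?_).trans_lt (lt_of_le_of_lt ?_ hR)
    · filter_upwards [h4] with y hy h0
      by_contra hcon
      rw [hy, if_pos (not_lt.1 hcon)] at h0
      exact h0 rfl
    · refine mul_le_mul_of_nonneg_left ?_ (norm_nonneg _)
      rw [← norm_freeGroup t φ]
      refine Lp.norm_le_norm_of_ae_le ?_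
      filter_upwards [h4] with y hy
      rw [hy]
      split_ifs
      · simp
      · exact le_rfl
  rw [Real.dist_eq, sub_zero, abs_of_nonneg (norm_nonneg _)]
  calc ‖coeffOp hm hh S g‖ = ‖coeffOp hm hh S (K g) + coeffOp hm hh S (g - K g)‖ := by
        rw [← map_add, add_sub_cancel]
    _ < ε := (norm_add_le _ _).trans_lt (by linarith)

end Position

/-! ### Identification of the surface subspace -/

section Main

variable {k l : ℕ} {η : 𝓢(E (k + l), ℂ)} {V : E (k + l) → ℝ} {r₀ : ℝ}

theorem abs_inner_liftPerp_le_of_mem_support (hVsupp : tsupport V ⊆ slab k l r₀) (w : E l)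
    (y : E (k + l)) (hy : V y ≠ 0) : |inner ℝ y (liftPerp k w)| ≤ r₀ * ‖w‖ := by
  have h : ‖perp y‖ ≤ r₀ := hVsupp (subset_tsupport V hy)
  exact (abs_inner_liftPerp_le y w).trans (by gcongr)

/-- A state orthogonal to the range of the wave operator is a surface state. -/
theorem orthogonal_le_surTilde (hl : 1 ≤ l) (hη : IsWindow η)
    (hV : MemLp (fun x => (V x : ℂ)) ∞ volume) (hVsupp : tsupport V ⊆ slab k l r₀) :
    (ranWaveMinus V)ᗮ ≤ surTilde η (hamiltonian V) := by
  intro χ hχ m hm0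
  have hl' : (0 : ℝ) < 2 * l := by
    have : (1 : ℝ) ≤ l := by exact_mod_cast hl
    linarith
  have hc : 0 < m / (2 * l) := by positivity
  -- `3 / 2` bounds the norm of the directions that cover the far region
  have hlim : ∀ δ : ℝ, 0 < δ → δ * (3 / 2) ≤ m / (2 * l) / 2 →
      limsup (fun n : ℝ => ⨆ (t : ℝ) (_ : 0 ≤ t),
        ‖observable η δ (farSet k l n m) (propagator (hamiltonian V) t χ)‖ₑ) atTop = 0 := by
    intro δ hδ hδm
    have hm := measurable_rescale η δ
    have hh := memLp_rescale hη.norm_one hδ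
    refine nonpos_iff_eq_zero.1 (ENNReal.le_of_forall_pos_le_add fun ε hε _ => ?_)
    rw [zero_add]
    let I := (Fin l × Fin l × Bool × Bool) × Bool
    set ε' : ℝ := ε / (Fintype.card I + 1) with hε'
    have hε'0 : 0 < ε' := by positivity
    have h1 : ∀ q : I, ∀ᶠ n : ℝ in atTop, ∀ t, 0 ≤ t →
        ‖coeffOp hm hh (sector (liftPerp k (direction q.1)) (sgn q.2 • liftPerp k (direction q.1))
          (n / (2 * l)) (m / (2 * l))) (propagator (hamiltonian V) t χ)‖ ≤ ε' := by
      intro q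
      have h2 := eventually_norm_coeffOp_sector_le (u := liftPerp k (direction q.1))
        (v := sgn q.2 • liftPerp k (direction q.1)) hη.fourier_supp hη.norm_one hδ hm hh hV
        (abs_inner_liftPerp_le_of_mem_support hVsupp (direction q.1)) hc ?_ ?_ hχ hε'0
      · exact (tendsto_id.atTop_div_const hl').eventually h2
      · rw [norm_liftPerp]
        exact (mul_le_mul_of_nonneg_left (norm_direction_le q.1) hδ.le).trans hδm
      · rcases q with ⟨q, _ | _⟩
        · right; simp [sgn]
        · left; simp [sgn]
    refine limsup_le_of_le (h := ?_)
    filter_upwards [eventually_all.2 h1] with n hn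
    refine iSup₂_le fun t ht => ?_
    have h3 : ‖observable η δ (farSet k l n m) (propagator (hamiltonian V) t χ)‖ ≤ ε := by
      refine (norm_observable_le hm hh (norm_toLp_rescale hη.norm_one hδ hh).le _ _).trans ?_
      refine (norm_coeffOp_mono hm hh (farSet_subset hl n m) _).trans ?_
      refine (norm_coeffOp_iUnion_le hm hh _ _ _).trans ?_
      refine (Finset.sum_le_card_nsmul _ _ ε' fun q _ => hn q t ht).trans ?_
      rw [nsmul_eq_mul, Finset.card_univ, hε', mul_div_assoc', div_le_iff₀ (by positivity)]
      nlinarith [ε.2]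
    rw [← ofReal_norm]
    exact (ENNReal.ofReal_le_ofReal h3).trans_eq (ENNReal.ofReal_coe_nnreal)
  have h4 : ∀ᶠ δ : ℝ in 𝓝[>] 0, limsup (fun n : ℝ => ⨆ (t : ℝ) (_ : 0 ≤ t),
        ‖observable η δ (farSet k l n m) (propagator (hamiltonian V) t χ)‖ₑ) atTop = 0 := by
    have h5 : ∀ᶠ δ : ℝ in 𝓝[>] 0, δ < m / (2 * l) / 3 :=
      nhdsWithin_le_nhds (Iio_mem_nhds (by positivity))
    filter_upwards [self_mem_nhdsWithin, h5] with δ hδ hδm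
    exact hlim δ hδ (by linarith)
  rw [surNorm, limsup_congr h4]
  exact limsup_const 0

theorem inner_coeffOp_univ {d : ℕ} {h : E d → ℂ} (hm : Measurable h) (hh : MemLp h 2 volume)
    (h1 : ‖hh.toLp h‖ = 1) (φ ψ : L2 d) :
    inner ℂ (coeffOp hm hh Set.univ φ) (coeffOp hm hh Set.univ ψ) = (inner ℂ φ ψ : ℂ) := by
  let W : L2 d →ₗᵢ[ℂ] Lp ℂ 2 ((volume : Measure (E d × E d)).restrict Set.univ) :=
    { toLinearMap := (coeffOp hm hh Set.univ : L2 d →ₗ[ℂ] _)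
      norm_map' := fun g => by
        change ‖coeffOp hm hh Set.univ g‖ = ‖g‖
        rw [norm_coeffOp_univ, h1, one_mul] }
  exact W.inner_map_map φ ψ

/-- A surface state is orthogonal to the range of the wave operator: freely moving states end up far
from the surface with nonzero transverse momentum, where surface states are not. -/
theorem surTilde_le_orthogonal (hl : 1 ≤ l) (hη : IsWindow η)
    (hV : MemLp (fun x => (V x : ℂ)) ∞ volume) :
    surTilde η (hamiltonian V) ≤ (ranWaveMinus V)ᗮ := by
  intro χ hχ
  rw [Submodule.mem_orthogonal]
  intro ψ hψ
  obtain ⟨φ, hφ⟩ := (mem_ranWaveMinus ψ).1 hψ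
  have hH := isUnitaryGroupOf_hamiltonian hV
  set w : E l := EuclideanSpace.single ⟨0, hl⟩ 1 with hw
  have hw1 : ‖w‖ = 1 := by rw [hw, PiLp.norm_single]; simp
  set u := liftPerp k w with hu
  have hu1 : ‖u‖ = 1 := by rw [hu, norm_liftPerp, hw1]
  have hu0 : u ≠ 0 := norm_ne_zero_iff.1 (by rw [hu1]; exact one_ne_zero)
  have key : ∀ m : ℝ, 0 < m →
      ‖(inner ℂ ψ χ : ℂ)‖ ≤ ‖φ‖ * m + (m + ‖bandProj u (2 * m) φ‖) * ‖χ‖ := by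
    intro m hm0
    have h1 : ∀ᶠ δ : ℝ in 𝓝[>] 0, limsup (fun n : ℝ => ⨆ (t : ℝ) (_ : 0 ≤ t),
        ‖observable η δ (farSet k l n m) (propagator (hamiltonian V) t χ)‖ₑ) atTop <
          ENNReal.ofReal m :=
      eventually_lt_of_limsup_lt ((hχ m hm0).trans_lt (ENNReal.ofReal_pos.2 hm0))
    have h2 : ∀ᶠ δ : ℝ in 𝓝[>] 0, δ < m := nhdsWithin_le_nhds (Iio_mem_nhds hm0)
    have h3 : ∀ᶠ δ : ℝ in 𝓝[>] 0, 0 < δ := self_mem_nhdsWithin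
    -- `δ` and `n` are fixed before `t` tends to infinity
    obtain ⟨δ, hδ1, hδ2, hδ⟩ := (h1.and (h2.and h3)).exists
    obtain ⟨n, hn⟩ := (eventually_lt_of_limsup_lt hδ1).exists
    have hm := measurable_rescale η δ
    have hh := memLp_rescale hη.norm_one hδ
    have hnorm := norm_toLp_rescale hη.norm_one hδ hh
    set X : Set (E (k + l) × E (k + l)) := {z | |inner ℝ z.1 u| ≤ n} with hX
    set Y : Set (E (k + l) × E (k + l)) := {z | |inner ℝ z.2 u| ≤ m} with hY
    have hXm : MeasurableSet X := measurableSet_le (by fun_prop) measurable_const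
    have hYm : MeasurableSet Y := measurableSet_le (by fun_prop) measurable_const
    have hcov : (farSet k l n m)ᶜ ⊆ X ∪ Y := by
      rintro ⟨x, p⟩ hz
      have hle : ∀ y : E (k + l), |inner ℝ y u| ≤ ‖perp y‖ := fun y => by
        have := abs_inner_liftPerp_le y w
        rwa [hw1, mul_one] at this
      by_cases h : n < ‖perp x‖
      · right
        have hp : ‖perp p‖ ≤ m := not_lt.1 fun h' => hz ⟨h, h'⟩
        exact (hle p).trans hp
      · left
        exact (hle x).trans (not_lt.1 h)
    have hlimX := tendsto_coeffOp_position hη.fourier_supp hη.norm_one hδ hm hh hu0 hXm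
      (fun z hz => hz) φ
    refine le_of_tendsto (hφ.inner (tendsto_const_nhds (x := χ))).norm ?_
    filter_upwards [eventually_ge_atTop 0, hlimX.eventually_le_const hm0] with t ht htX
    have e1 : (inner ℂ (propagator (hamiltonian V) (-t) (freeGroup (k + l) t φ)) χ : ℂ) =
        inner ℂ (freeGroup (k + l) t φ)
          (observable η δ (farSet k l n m) (propagator (hamiltonian V) t χ)) +
        inner ℂ (coeffOp hm hh (farSet k l n m)ᶜ (freeGroup (k + l) t φ))
          (coeffOp hm hh (farSet k l n m)ᶜ (propagator (hamiltonian V) t χ)) := by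
      rw [hH.inner_left, neg_neg, inner_observable hm hh,
        inner_coeffOp_add_compl hm hh (measurableSet_farSet n m), inner_coeffOp_univ hm hh hnorm]
    rw [e1]
    refine (norm_add_le _ _).trans (add_le_add ?_ ?_)
    · refine (norm_inner_le_norm _ _).trans ?_
      rw [norm_freeGroup]
      refine mul_le_mul_of_nonneg_left ?_ (norm_nonneg _)
      have h4 : ‖observable η δ (farSet k l n m) (propagator (hamiltonian V) t χ)‖ₑ ≤
          ENNReal.ofReal m :=
        (le_iSup₂ (f := fun (t : ℝ) (_ : 0 ≤ t) =>
          ‖observable η δ (farSet k l n m) (propagator (hamiltonian V) t χ)‖ₑ) t ht).trans hn.le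
      rw [← ofReal_norm] at h4
      exact (ENNReal.ofReal_le_ofReal_iff hm0.le).1 h4
    · refine (norm_inner_le_norm _ _).trans ?_
      refine mul_le_mul ?_ ?_ (norm_nonneg _) (by positivity)
      · refine (norm_coeffOp_mono hm hh hcov _).trans ((norm_coeffOp_union_le hm hh _ _ _).trans ?_)
        refine add_le_add htX ?_
        rw [← norm_bandProj_freeGroup u (2 * m) t φ]
        exact norm_coeffOp_le_bandProj hη.fourier_supp hη.norm_one hδ hm hh (m := m)
          (by rw [hu1]; linarith) hYm (fun z hz => hz) _
      · refine (norm_coeffOp_le hm hh _ _).trans_eq ?_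
        rw [hnorm, one_mul, hH.norm_apply]
  have hlim : Tendsto (fun m : ℝ => ‖φ‖ * m + (m + ‖bandProj u (2 * m) φ‖) * ‖χ‖) (𝓝[>] 0)
      (𝓝 (‖φ‖ * 0 + (0 + 0) * ‖χ‖)) := by
    have hid : Tendsto (fun m : ℝ => m) (𝓝[>] 0) (𝓝 0) := nhdsWithin_le_nhds
    exact (hid.const_mul _).add ((hid.add (tendsto_bandProj_two_mul hu0 φ)).mul_const _)
  have h0 := ge_of_tendsto hlim (by
    filter_upwards [self_mem_nhdsWithin] with m hm0 using key m hm0)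
  simp only [mul_zero, add_zero, zero_mul] at h0
  exact norm_le_zero_iff.1 h0

end Main

end SurfaceScattering

end

theorem lemma5p2 (k l : ℕ) (hk : 1 ≤ k) (hl : 1 ≤ l)
    (η : 𝓢(SurfaceScattering.E (k + l), ℂ)) (hη : SurfaceScattering.IsWindow η)
    (V : SurfaceScattering.E (k + l) → ℝ) (hVm : AEStronglyMeasurable V volume)
    (M : ℝ) (hVM : ∀ x, |V x| ≤ M)
    (r₀ : ℝ) (hr₀ : 0 < r₀) (hVsupp : tsupport V ⊆ SurfaceScattering.slab k l r₀) :
    (SurfaceScattering.waveMinus V).domain = ⊤ ∧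
    IsCompl (SurfaceScattering.ranWaveMinus V)
      (SurfaceScattering.surTilde η (SurfaceScattering.hamiltonian V)) ∧
    SurfaceScattering.ranWaveMinus V ⟂
      SurfaceScattering.surTilde η (SurfaceScattering.hamiltonian V) := by
  have hV := SurfaceScattering.memLp_top_potential hVm hVM
  have hsur : SurfaceScattering.surTilde η (SurfaceScattering.hamiltonian V) =
      (SurfaceScattering.ranWaveMinus V)ᗮ :=
    le_antisymm (SurfaceScattering.surTilde_le_orthogonal hl hη hV)
      (SurfaceScattering.orthogonal_le_surTilde hl hη hV hVsupp)
  have hcomp : CompleteSpace (SurfaceScattering.ranWaveMinus V) :=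
    (SurfaceScattering.isClosed_ranWaveMinus hV).completeSpace_coe
  have hw : (EuclideanSpace.single ⟨0, hl⟩ 1 : SurfaceScattering.E l) ≠ 0 := by simp
  have hw' : SurfaceScattering.liftPerp k (EuclideanSpace.single ⟨0, hl⟩ 1) ≠ 0 := by
    rwa [← norm_ne_zero_iff, SurfaceScattering.norm_liftPerp, norm_ne_zero_iff]
  refine ⟨?_, ?_, ?_⟩
  · exact SurfaceScattering.waveMinus_domain_eq_top hη.fourier_supp hη.norm_one hV hw'
      (SurfaceScattering.abs_inner_liftPerp_le_of_mem_support hVsupp _)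
  · rw [hsur]
    exact Submodule.isCompl_orthogonal _
  · rw [hsur]
    exact Submodule.isOrtho_orthogonal_right _
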